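/- Work in the two-sorted vocabulary $0,1,+,\cdot,|\ |,=_1,=_2,\le,\in$ of bounded arithmetic (numbers $x,y,i,\dots$; finite binary strings $X,Y,\dots$ with length $|X|$; $X(i)$ stands for $i\in X$; $(Q X\le t)$ bounds the length $|X|$ by $t$). $\Sigma^B_0$ is the class of formulas all of whose quantifiers are bounded number quantifiers, and $\Sigma^B_1$ (resp. $\Pi^B_1$) consists of the formulas $(\exists\vec X\le\vec t)\,\theta$ (resp. $(\forall\vec X\le\vec t)\,\theta$) with $\theta\in\Sigma^B_0$ and $\vec t$ not mentioning $\vec X$. $\mathrm V^1$ is the theory with the axioms B1–B12, L1, L2, SE of Cook and Nguyen and comprehension $(\exists Y\le x)(\forall i<x)[Y(i)\leftrightarrow\theta(i)]$ for $\theta\in\Sigma^B_1$; "$\mathrm V^1$ proves $A$" means that the universal closure of $A$ is a logical consequence of the axioms. For a number $x$ let $|x|$ be its binary length ($|0|=0$). Let $\langle x,y\rangle=(x+y)(x+y+1)+2y$, $Z^{[j]}(i)\leftrightarrow i<|Z|\wedge Z(\langle j,i\rangle)$, let $S(X)$ be the string successor (binary $+1$, bit $0$ least significant), $\mathrm{One}(n)$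 the string of $n$ ones, and $\le$ on strings the numerical order. Let $\mathrm{val}(k,X)$ be the number whose binary expansion consists of the $k$ most significant bits of $X$ (of all bits of $X$ if $|X|\le k$). Let $\varphi(i,Y)$ be a $\Sigma^B_0$ formula, possibly with further free variables as parameters. Let $\psi_{P_\varphi}(x,y,X,Y)$ be the formula expressing that, for $v=\mathrm{val}(|y|,X)$, there is a string $Z$ with $|Z|\le\langle v,x\rangle+1$ such that $$(\forall j\le v)\,|Z^{[j]}|\le x,\quad Z^{[0]}=\emptyset,\quad Z^{[v]}=Y,\quad (\forall j<v)(\forall i<x)\,[Z^{[j+1]}(i)\leftrightarrow\varphi(i,Z^{[j]})];$$ here $|y|$ and $v$ are expressed through strings coding the number sequences $1,2,4,\dots,2^{|y|}$ and $\mathrm{val}(0,X),\dots,\mathrm{val}(|y|,X)$, and all string quantifiers are bounded, existential and in front. So $\psi_{P_\varphi}(x,y,X,Y)$ says that $Y$ is the $X$-th iterate (from $\emptyset$) of the operator defined by $\varphi$ on the first $x$ bits, for $|X|\le|y|$. **Theorem.** 1. $\psi_{P_\varphi}$ is a $\Delta^B_1$ formula in $\mathrm V^1$: it is $\Sigma^B_1$,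 and $\mathrm V^1$ proves it equivalent to a $\Pi^B_1$ formula. 2. $\mathrm V^1$ proves $\forall x,y\,(\forall X\le|y|)(\exists!\,Y\le x)\,\psi_{P_\varphi}(x,y,X,Y)$. 3. $\mathrm V^1$ proves, for all $x$: if $\varphi$ is inflationary, i.e. $(\forall Y\le x)(\forall i<x)[Y(i)\rightarrow\varphi(i,Y)]$, then there is a string $U\le\mathrm{One}(|x|)$ such that $$\forall Y,Z\,\bigl[\psi_{P_\varphi}(x,2x,S(U),Y)\wedge\psi_{P_\varphi}(x,2x,U,Z)\rightarrow(\forall i<x)(Y(i)\leftrightarrow Z(i))\bigr].$$ -/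

import Mathlib

universe u v

namespace TwoSorted

/-! ## Formulas over the two-sorted vocabulary `0, 1, +, ·, | |, =₁, =₂, ≤, ∈`

Well-scoped syntax: `n` is the number of free number variables in scope and `m` the number of free
string variables. Variables are levels: a quantifier binds the variable with the new largest
index, and the old variables keep their indices. -/

/-- Number terms. The only string terms are the string variables `X : Fin m`. -/
inductive Tm (n m : ℕ) : Type
  | var (i : Fin n) : Tm n m
  | zero : Tm n m
  | one : Tm n m
  | add (t s : Tm n m) : Tm n m
  | mul (t s : Tm n m) : Tm n m
  | len (X : Fin m) : Tm n m

inductive Fml : ℕ → ℕ → Type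
  | eq {n m : ℕ} (t s : Tm n m) : Fml n m
  | strEq {n m : ℕ} (X Y : Fin m) : Fml n m
  | le {n m : ℕ} (t s : Tm n m) : Fml n m
  | mem {n m : ℕ} (t : Tm n m) (X : Fin m) : Fml n m
  | not {n m : ℕ} (A : Fml n m) : Fml n m
  | and {n m : ℕ} (A B : Fml n m) : Fml n m
  | or {n m : ℕ} (A B : Fml n m) : Fml n m
  | allN {n m : ℕ} (A : Fml (n + 1) m) : Fml n m
  | exN {n m : ℕ} (A : Fml (n + 1) m) : Fml n m
  | allS {n m : ℕ} (A : Fml n (m + 1)) : Fml n m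
  | exS {n m : ℕ} (A : Fml n (m + 1)) : Fml n m

/-! ## Semantics, theories, logical consequence -/

/-- Two-sorted structures; both equality symbols are interpreted by true equality. -/
structure Struct where
  Num : Type u
  Str : Type v
  zero : Num
  one : Num
  add : Num → Num → Num
  mul : Num → Num → Num
  le : Num → Num → Prop
  len : Str → Num
  mem : Num → Str → Prop

def Tm.val (M : Struct.{u, v}) {n m : ℕ} (a : Fin n → M.Num) (A : Fin m → M.Str) :
    Tm n m → M.Num
  | .var i => a i
  | .zero => M.zero
  | .one => M.one
  | .add t s => M.add (t.val M a A) (s.val M a A)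
  | .mul t s => M.mul (t.val M a A) (s.val M a A)
  | .len X => M.len (A X)

def Fml.Realize (M : Struct.{u, v}) :
    {n m : ℕ} → Fml n m → (Fin n → M.Num) → (Fin m → M.Str) → Prop
  | _, _, .eq t s, a, A => t.val M a A = s.val M a A
  | _, _, .strEq X Y, _, A => A X = A Y
  | _, _, .le t s, a, A => M.le (t.val M a A) (s.val M a A)
  | _, _, .mem t X, a, A => M.mem (t.val M a A) (A X)
  | _, _, .not B, a, A => ¬ B.Realize M a A
  | _, _, .and B C, a, A => B.Realize M a A ∧ C.Realize M a A
  | _, _, .or B C, a, A => B.Realize M a A ∨ C.Realize M a A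
  | _, _, .allN B, a, A => ∀ c : M.Num, B.Realize M (Fin.snoc a c) A
  | _, _, .exN B, a, A => ∃ c : M.Num, B.Realize M (Fin.snoc a c) A
  | _, _, .allS B, a, A => ∀ C : M.Str, B.Realize M a (Fin.snoc A C)
  | _, _, .exS B, a, A => ∃ C : M.Str, B.Realize M a (Fin.snoc A C)

/-- `M` satisfies the universal closure of `B`. -/
def Struct.Valid (M : Struct.{u, v}) {n m : ℕ} (B : Fml n m) : Prop :=
  ∀ (a : Fin n → M.Num) (A : Fin m → M.Str), B.Realize M a A

/-- A set of axioms: formulas, read as their universal closures. -/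
def Axioms : Type := (n m : ℕ) → Fml n m → Prop

/-- `B` is a theorem of the theory axiomatised by `T`: its universal closure is a logical
consequence of the universal closures of the formulas in `T`. -/
def Proves (T : Axioms) {n m : ℕ} (B : Fml n m) : Prop :=
  ∀ M : Struct.{u, v}, (∀ (k l : ℕ) (C : Fml k l), T k l C → M.Valid C) → M.Valid B

/-! ## Abbreviations -/

infixr:35 " ⩓ " => Fml.and
infixr:30 " ⩔ " => Fml.or

def Fml.imp {n m : ℕ} (A B : Fml n m) : Fml n m := A.not ⩔ B
infixr:25 " ⟹ᶠ " => Fml.imp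

def Fml.iff {n m : ℕ} (A B : Fml n m) : Fml n m := (A ⟹ᶠ B) ⩓ (B ⟹ᶠ A)
infix:20 " ⟺ᶠ " => Fml.iff

/-- The number variable with index `k`. -/
def nv (k : ℕ) {n m : ℕ} (h : k < n := by omega) : Tm n m := .var ⟨k, h⟩

/-- The string variable with index `k`. -/
def sv (k : ℕ) {m : ℕ} (h : k < m := by omega) : Fin m := ⟨k, h⟩

/-- The most recently bound number variable. -/
def new {n m : ℕ} : Tm (n + 1) m := .var (Fin.last n)

/-- The term `t`, with one more number variable in scope. -/
def Tm.up {n m : ℕ} : Tm n m → Tm (n + 1) m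
  | .var i => .var i.castSucc
  | .zero => .zero
  | .one => .one
  | .add t s => .add t.up s.up
  | .mul t s => .mul t.up s.up
  | .len X => .len X

/-- The term `t`, with `k` more string variables in scope. -/
def Tm.upS {n m : ℕ} (k : ℕ) : Tm n m → Tm n (m + k)
  | .var i => .var i
  | .zero => .zero
  | .one => .one
  | .add t s => .add (t.upS k) (s.upS k)
  | .mul t s => .mul (t.upS k) (s.upS k)
  | .len X => .len (X.castAdd k)

/-- `t + 1` -/
def Tm.succ {n m : ℕ} (t : Tm n m) : Tm n m := .add t .one

/-- `2 · t` -/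
def Tm.dbl {n m : ℕ} (t : Tm n m) : Tm n m := .mul (.add .one .one) t

/-- The pairing term `⟨t, s⟩ = (t + s) · (t + s + 1) + 2 · s`. -/
def Tm.pair {n m : ℕ} (t s : Tm n m) : Tm n m :=
  .add (.mul (.add t s) (Tm.add t s).succ) s.dbl

def Fml.lt {n m : ℕ} (t s : Tm n m) : Fml n m := .le t s ⩓ (Fml.eq t s).not

/-- `(∀ i ≤ t) A(i)` -/
def allLe {n m : ℕ} (t : Tm n m) (A : Fml (n + 1) m) : Fml n m := .allN (.le new t.up ⟹ᶠ A)

/-- `(∃ i ≤ t) A(i)` -/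
def exLe {n m : ℕ} (t : Tm n m) (A : Fml (n + 1) m) : Fml n m := .exN (.le new t.up ⩓ A)

/-- `(∀ i < t) A(i)` -/
def allLt {n m : ℕ} (t : Tm n m) (A : Fml (n + 1) m) : Fml n m := allLe t (.lt new t.up ⟹ᶠ A)

/-- `(∃ i < t) A(i)` -/
def exLt {n m : ℕ} (t : Tm n m) (A : Fml (n + 1) m) : Fml n m := exLe t (.lt new t.up ⩓ A)

/-- `(∀ X ≤ t) A(X)`, that is, `∀ X (|X| ≤ t → A(X))` -/
def allSLe {n m : ℕ} (t : Tm n m) (A : Fml n (m + 1)) : Fml n m :=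
  .allS (.le (.len (Fin.last m)) (t.upS 1) ⟹ᶠ A)

/-- `(∃ X ≤ t) A(X)`, that is, `∃ X (|X| ≤ t ∧ A(X))` -/
def exSLe {n m : ℕ} (t : Tm n m) (A : Fml n (m + 1)) : Fml n m :=
  .exS (.le (.len (Fin.last m)) (t.upS 1) ⩓ A)

/-! ## The classes `Σᴮ₀`, `Σᴮ₁`, `Πᴮ₁` -/

/-- `Σᴮ₀`: all quantifiers are bounded number quantifiers. -/
inductive IsSigB0 : {n m : ℕ} → Fml n m → Prop
  | eq {n m : ℕ} (t s : Tm n m) : IsSigB0 (.eq t s)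
  | strEq {n m : ℕ} (X Y : Fin m) : IsSigB0 (.strEq X Y : Fml n m)
  | le {n m : ℕ} (t s : Tm n m) : IsSigB0 (.le t s)
  | mem {n m : ℕ} (t : Tm n m) (X : Fin m) : IsSigB0 (.mem t X)
  | not {n m : ℕ} {A : Fml n m} : IsSigB0 A → IsSigB0 A.not
  | and {n m : ℕ} {A B : Fml n m} : IsSigB0 A → IsSigB0 B → IsSigB0 (A ⩓ B)
  | or {n m : ℕ} {A B : Fml n m} : IsSigB0 A → IsSigB0 B → IsSigB0 (A ⩔ B)
  | allLe {n m : ℕ} (t : Tm n m) {A : Fml (n + 1) m} : IsSigB0 A → IsSigB0 (allLe t A)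
  | exLe {n m : ℕ} (t : Tm n m) {A : Fml (n + 1) m} : IsSigB0 A → IsSigB0 (exLe t A)

/-- Blocks `(∃ X₁ ≤ t₁) ⋯ (∃ Xᵣ ≤ tᵣ) A` with `A` in `Σᴮ₀`, inside a scope of `m + k` string
variables, where the terms `tᵢ` mention only the first `m` of these variables. -/
inductive IsExBlock {n m : ℕ} : (k : ℕ) → Fml n (m + k) → Prop
  | base {k : ℕ} {A : Fml n (m + k)} : IsSigB0 A → IsExBlock k A
  | step {k : ℕ} (t : Tm n m) {A : Fml n (m + (k + 1))} :
      IsExBlock (k + 1) A → IsExBlock k (exSLe (t.upS k) A)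

/-- The same with `∀`. -/
inductive IsAllBlock {n m : ℕ} : (k : ℕ) → Fml n (m + k) → Prop
  | base {k : ℕ} {A : Fml n (m + k)} : IsSigB0 A → IsAllBlock k A
  | step {k : ℕ} (t : Tm n m) {A : Fml n (m + (k + 1))} :
      IsAllBlock (k + 1) A → IsAllBlock k (allSLe (t.upS k) A)

def IsSigB1 {n m : ℕ} (A : Fml n m) : Prop := IsExBlock (m := m) 0 A

def IsPiB1 {n m : ℕ} (A : Fml n m) : Prop := IsAllBlock (m := m) 0 A

/-- `A` is a `Σᴮ₁` formula that is equivalent, provably in `T`, to a `Πᴮ₁` formula. -/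
def IsDelB1 (T : Axioms) {n m : ℕ} (A : Fml n m) : Prop :=
  IsSigB1 A ∧ ∃ B : Fml n m, IsPiB1 B ∧ Proves.{u, v} T (A ⟺ᶠ B)

/-! ## Substitution -/

/-- What may be substituted for a string variable: a string variable, or a row `Z^[j]` of one,
where `l` is a number term whose value is meant to be the length of `Z^[j]`. -/
inductive STm (n m : ℕ) : Type
  | var (X : Fin m) : STm n m
  | row (Z : Fin m) (j l : Tm n m) : STm n m

/-- `Z^[j](i)`, that is, `i < |Z| ∧ Z(⟨j, i⟩)` -/
def rowMem {n m : ℕ} (Z : Fin m) (j i : Tm n m) : Fml n m := .lt i (.len Z) ⩓ .mem (.pair j i) Z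

def STm.len {n m : ℕ} : STm n m → Tm n m
  | .var X => .len X
  | .row _ _ l => l

/-- `s(t)` -/
def STm.mem {n m : ℕ} (t : Tm n m) : STm n m → Fml n m
  | .var X => .mem t X
  | .row Z j _ => rowMem Z j t

def STm.up {n m : ℕ} : STm n m → STm (n + 1) m
  | .var X => .var X
  | .row Z j l => .row Z j.up l.up

def STm.upS {n m : ℕ} : STm n m → STm n (m + 1)
  | .var X => .var X.castSucc
  | .row Z j l => .row Z.castSucc (j.upS 1) (l.upS 1)

/-- `s = r`, written out with lengths and bits if a row is involved. -/
def STm.eq {n m : ℕ} : STm n m → STm n m → Fml n m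
  | .var X, .var Y => .strEq X Y
  | s, r => .eq s.len r.len ⩓ allLt s.len (s.up.mem new ⟺ᶠ r.up.mem new)

def Tm.subst {n m n' m' : ℕ} (σ : Fin n → Tm n' m') (τ : Fin m → STm n' m') : Tm n m → Tm n' m'
  | .var i => σ i
  | .zero => .zero
  | .one => .one
  | .add t s => .add (t.subst σ τ) (s.subst σ τ)
  | .mul t s => .mul (t.subst σ τ) (s.subst σ τ)
  | .len X => (τ X).len

/-- Simultaneous substitution for all free variables. -/
def Fml.subst : {n m n' m' : ℕ} → Fml n m → (Fin n → Tm n' m') → (Fin m → STm n' m') → Fml n' m'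
  | _, _, _, _, .eq t s, σ, τ => .eq (t.subst σ τ) (s.subst σ τ)
  | _, _, _, _, .strEq X Y, _, τ => (τ X).eq (τ Y)
  | _, _, _, _, .le t s, σ, τ => .le (t.subst σ τ) (s.subst σ τ)
  | _, _, _, _, .mem t X, σ, τ => (τ X).mem (t.subst σ τ)
  | _, _, _, _, .not A, σ, τ => (A.subst σ τ).not
  | _, _, _, _, .and A B, σ, τ => A.subst σ τ ⩓ B.subst σ τ
  | _, _, _, _, .or A B, σ, τ => A.subst σ τ ⩔ B.subst σ τ
  | _, _, _, _, .allN A, σ, τ =>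
      .allN (A.subst (Fin.snoc (fun k => (σ k).up) new) (fun k => (τ k).up))
  | _, _, _, _, .exN A, σ, τ =>
      .exN (A.subst (Fin.snoc (fun k => (σ k).up) new) (fun k => (τ k).up))
  | _, _, _, _, .allS A, σ, τ =>
      .allS (A.subst (fun k => (σ k).upS 1) (Fin.snoc (fun k => (τ k).upS) (.var (Fin.last _))))
  | _, _, _, _, .exS A, σ, τ =>
      .exS (A.subst (fun k => (σ k).upS 1) (Fin.snoc (fun k => (τ k).upS) (.var (Fin.last _))))

/-- The formula `A`, with one more string variable in scope. -/
def Fml.upS {n m : ℕ} (A : Fml n m) : Fml n (m + 1) :=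
  A.subst (fun k => .var k) (fun k => .var k.castSucc)

/-! ## The theory `V¹` -/

/-- The axioms of `V¹`: B1-B12, L1, L2, SE, and comprehension
`(∃ Y ≤ x)(∀ i < x)(Y(i) ↔ A(i))` for `Σᴮ₁` formulas `A`. In `comp` there are `k` further number
variables and `l` string variables, `x` has index `k`, `i` has index `k + 1`, `Y` has index `l`. -/
inductive V1 : Axioms
  | b1 : V1 1 0 (Fml.eq (nv 0).succ .zero).not
  | b2 : V1 2 0 (.eq (nv 0).succ (nv 1).succ ⟹ᶠ .eq (nv 0) (nv 1))
  | b3 : V1 1 0 (.eq (.add (nv 0) .zero) (nv 0))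
  | b4 : V1 2 0 (.eq (.add (nv 0) (nv 1).succ) (Tm.add (nv 0) (nv 1)).succ)
  | b5 : V1 1 0 (.eq (.mul (nv 0) .zero) .zero)
  | b6 : V1 2 0 (.eq (.mul (nv 0) (nv 1).succ) (.add (.mul (nv 0) (nv 1)) (nv 0)))
  | b7 : V1 2 0 (.le (nv 0) (nv 1) ⩓ .le (nv 1) (nv 0) ⟹ᶠ .eq (nv 0) (nv 1))
  | b8 : V1 2 0 (.le (nv 0) (.add (nv 0) (nv 1)))
  | b9 : V1 1 0 (.le .zero (nv 0))
  | b10 : V1 2 0 (.le (nv 0) (nv 1) ⩔ .le (nv 1) (nv 0))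
  | b11 : V1 2 0 (.le (nv 0) (nv 1) ⟺ᶠ .lt (nv 0) (nv 1).succ)
  | b12 : V1 1 0 ((Fml.eq (nv 0) .zero).not ⟹ᶠ exLe (nv 0) (.eq (nv 1).succ (nv 0)))
  | l1 : V1 1 1 (.mem (nv 0) (sv 0) ⟹ᶠ .lt (nv 0) (.len (sv 0)))
  | l2 : V1 1 1 (.eq (nv 0).succ (.len (sv 0)) ⟹ᶠ .mem (nv 0) (sv 0))
  | se : V1 0 2 (.eq (.len (sv 0)) (.len (sv 1)) ⩓
      allLt (.len (sv 0)) (.mem (nv 0) (sv 0) ⟺ᶠ .mem (nv 0) (sv 1)) ⟹ᶠ .strEq (sv 0) (sv 1))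
  | comp {k l : ℕ} (A : Fml (k + 2) l) (hA : IsSigB1 A) :
      V1 (k + 1) l (exSLe (nv k) (allLt (nv k) (.mem (nv (k + 1)) (sv l) ⟺ᶠ A.upS)))

/-! ## String functions and relations, and bounded number sequences -/

/-- `T = One(n)`, the string of `n` ones -/
def isOne {n m : ℕ} (t : Tm n m) (T : Fin m) : Fml n m :=
  .allN (.mem new T ⟺ᶠ .lt new t.up)

/-- `T = S(U)`, the string successor:
`T(i) ↔ i ≤ |U| ∧ ([U(i) ∧ (∃ j < i) ¬ U(j)] ∨ [¬ U(i) ∧ (∀ j < i) U(j)])` -/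
def isSucc {n m : ℕ} (U T : Fin m) : Fml n m :=
  .allN (.mem new T ⟺ᶠ .le new (.len U) ⩓
    ((.mem new U ⩓ exLt new (Fml.mem new U).not) ⩔
      ((Fml.mem new U).not ⩓ allLt new (.mem new U))))

/-- `U < T` in the string ordering: `|U| ≤ |T|` and
`(∃ i ≤ |T|)[(∀ j ≤ |T|)(i < j ∧ U(j) → T(j)) ∧ T(i) ∧ ¬ U(i)]` -/
def strLt {n m : ℕ} (U T : Fin m) : Fml n m :=
  .le (.len U) (.len T) ⩓
    exLe (.len T)
      (allLe (.len T) (.lt new.up new ⩓ .mem new U ⟹ᶠ .mem new T) ⩓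
        .mem new T ⩓ (Fml.mem new U).not)

def strLe {n m : ℕ} (U T : Fin m) : Fml n m := .strEq U T ⩔ strLt U T

/-- `(W)^j = a`, the `j`-th element of the number sequence coded by `W` -/
def seqEq {n m : ℕ} (W : Fin m) (j a : Tm n m) : Fml n m :=
  (.lt a (.len W) ⩓ .mem (.pair j a) W ⩓ allLt a (Fml.mem (.pair j.up new) W).not) ⩔
    (.eq a (.len W) ⩓ allLt a (Fml.mem (.pair j.up new) W).not)

/-- `W` codes the sequence `1, 2, 4, …, 2ⁿ`, all of its members but the last are `≤ x`, and
the last is `> x`: a witness for `n` being the binary length `|x|` of the number `x`. -/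
def binLenW {n m : ℕ} (x l : Tm n m) (W : Fin m) : Fml n m :=
  seqEq W .zero .one ⩓
    allLt l (exLe (.len W)
      (seqEq W new.up new ⩓ .le new x.up.up ⩓ seqEq W new.up.succ new.dbl)) ⩓
    exLe (.len W) (seqEq W l.up new ⩓ .lt x.up new)

/-- `l = |x|`, the number of binary digits of the number `x` (with `|0| = 0`) -/
def binLen {n m : ℕ} (x l : Tm n m) : Fml n m :=
  exSLe (Tm.pair x x.dbl.succ).succ (binLenW (x.upS 1) (l.upS 1) (Fin.last m))

/-- `j < |X|` and the bit `X(|X| - 1 - j)` is `1` -/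
def topBit {n m : ℕ} (X : Fin m) (j : Tm n m) : Fml n m :=
  exLt (.len X) (.eq (.add new j.up.succ) (.len X) ⩓ .mem new X)

/-- `z = val(x, X)`, the number with binary expansion the `x` most significant bits of `X`
(all of them if `|X| ≤ x`), witnessed by the sequence `V` of the numbers `val(0, X), …, val(x, X)`:
`val(j + 1, X)` is `val(j, X)` if `|X| ≤ j`, and otherwise `2 · val(j, X)` plus the next bit. -/
def valW {n m : ℕ} (x z : Tm n m) (X V : Fin m) : Fml n m :=
  (.eq (.len X) .zero ⩓ .eq z .zero) ⩔
    ((Fml.eq (.len X) .zero).not ⩓ seqEq V .zero .zero ⩓ seqEq V x z ⩓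
      allLt x (exLe (.len V) (seqEq V new.up new ⩓
        (.le (.len X) new.up ⟹ᶠ seqEq V new.up.succ new) ⩓
        (.lt new.up (.len X) ⩓ (topBit X new.up).not ⟹ᶠ seqEq V new.up.succ new.dbl) ⩓
        (.lt new.up (.len X) ⩓ topBit X new.up ⟹ᶠ seqEq V new.up.succ new.dbl.succ))))

/-- `l = |Z^[j]|` -/
def rowLen {n m : ℕ} (Z : Fin m) (j l : Tm n m) : Fml n m :=
  allLt (.len Z) (rowMem Z j.up new ⟹ᶠ .lt new l.up) ⩓
    (.eq l .zero ⩔ exLt l (.eq new.succ l.up ⩓ rowMem Z j.up new))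

/-! ## Iterating the operator of a formula

`φ` has the free variables `i` (number, index `p`) and `Y` (string, index `q`), and parameters:
number variables `0, …, p - 1` and string variables `0, …, q - 1`. -/

/-- `φ(i, Z^[j])`, given that `l = |Z^[j]|` -/
def atRow {p q n m : ℕ} (φ : Fml (p + 1) (q + 1)) (hp : p ≤ n) (hq : q ≤ m)
    (i : Tm n m) (Z : Fin m) (j l : Tm n m) : Fml n m :=
  φ.subst (Fin.snoc (fun k => .var (k.castLE hp)) i)
    (Fin.snoc (fun k => .var (k.castLE hq)) (.row Z j l))

/-- The rows of `Z` are the first `v` iterates: `(∀ j ≤ v) |Z^[j]| ≤ x`, `Z^[0] = ∅`,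
`Z^[v] = Y`, and `(∀ j < v)(∀ i < x)[Z^[j+1](i) ↔ φ(i, Z^[j])]`.
Number variables: `x, y, n, v` have the indices `p, p+1, p+2, p+3`, then `j, i, l` in the last part.
String variables: `X, Y, W, V, Z` have the indices `q, …, q+4`. -/
def iterW {p q : ℕ} (φ : Fml (p + 1) (q + 1)) : Fml (p + 4) (q + 5) :=
  allLe (nv (p + 3)) (allLt (.len (sv (q + 4)))
    (rowMem (sv (q + 4)) (nv (p + 4)) (nv (p + 5)) ⟹ᶠ .lt (nv (p + 5)) (nv p))) ⩓
  allLt (.len (sv (q + 4))) (rowMem (sv (q + 4)) .zero (nv (p + 4))).not ⩓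
  allLt (.add (.len (sv (q + 4))) (.len (sv (q + 1))))
    (rowMem (sv (q + 4)) (nv (p + 3)) (nv (p + 4)) ⟺ᶠ .mem (nv (p + 4)) (sv (q + 1))) ⩓
  allLt (nv (p + 3)) (allLt (nv p) (exLe (nv p)
    (rowLen (sv (q + 4)) (nv (p + 4)) (nv (p + 6)) ⩓
      (rowMem (sv (q + 4)) (nv (p + 4)).succ (nv (p + 5)) ⟺ᶠ
        atRow φ (by omega) (by omega) (nv (p + 5)) (sv (q + 4)) (nv (p + 4)) (nv (p + 6))))))

/-- The formula `ψ_φ(x, y, X, Y)`: with `n = |y|` and `v = val(n, X)`, the string `Y` is the last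
row of some string `Z ≤ ⟨v, x⟩ + 1` whose rows are the iterates `0, …, v` of `φ` on `x` bits.
The strings `W` and `V` witness `n = |y|` and `v = val(n, X)`; all string quantifiers are in front.
Indices as in `iterW`: `x, y` are `p, p+1` and `X, Y` are `q, q+1`. -/
def psiP {p q : ℕ} (φ : Fml (p + 1) (q + 1)) : Fml (p + 2) (q + 2) :=
  exSLe (Tm.pair (nv (p + 1)) (nv (p + 1)).dbl.succ).succ
    (exSLe (Tm.pair (nv (p + 1)) (nv (p + 1)).dbl.succ).succ
      (exSLe (Tm.pair (nv (p + 1)).dbl.succ (nv p)).succ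
        (exLe (nv (p + 1)) (exLe (nv (p + 1)).dbl.succ
          (binLenW (nv (p + 1)) (nv (p + 2)) (sv (q + 2)) ⩓
            .le (.len (sv (q + 3))) (Tm.pair (nv (p + 2)) (nv (p + 1)).dbl.succ).succ ⩓
            valW (nv (p + 2)) (nv (p + 3)) (sv q) (sv (q + 3)) ⩓
            .le (.len (sv (q + 4))) (Tm.pair (nv (p + 3)) (nv p)).succ ⩓
            iterW φ)))))

/-- `ψ_φ(x, y, X, Y)` for given terms `x, y` and string variables `X, Y` -/
def psiPAt {p q n m : ℕ} (φ : Fml (p + 1) (q + 1)) (hp : p ≤ n) (hq : q ≤ m)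
    (x y : Tm n m) (X Y : Fin m) : Fml n m :=
  (psiP φ).subst
    (Fin.snoc (Fin.snoc (fun k => .var (k.castLE hp)) x : Fin (p + 1) → Tm n m) y)
    (Fin.snoc (Fin.snoc (fun k => .var (k.castLE hq)) (.var X) : Fin (q + 1) → STm n m) (.var Y))

/-- `|X| ≤ |y| → (∃! Y ≤ x) ψ_φ(x, y, X, Y)`, with `x, y` of index `p, p+1` and `X` of index `q` -/
def existsUniqueIterate {p q : ℕ} (φ : Fml (p + 1) (q + 1)) : Fml (p + 2) (q + 1) :=
  .exN (binLen (nv (p + 1)) (nv (p + 2)) ⩓ .le (.len (sv q)) (nv (p + 2))) ⟹ᶠ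
    exSLe (nv p)
      (psiPAt φ (by omega) (by omega) (nv p) (nv (p + 1)) (sv q) (sv (q + 1)) ⩓
        allSLe (nv p)
          (psiPAt φ (by omega) (by omega) (nv p) (nv (p + 1)) (sv q) (sv (q + 2)) ⟹ᶠ
            .strEq (sv (q + 2)) (sv (q + 1))))

/-- `φ` is inflationary at `x`: `(∀ Y ≤ x)(∀ i < x)[Y(i) → φ(i, Y)]`. Here `x` is the number
variable with index `p`; in the matrix `i` and `Y` have the indices `p + 1` and `q`. -/
def inflationary {p q : ℕ} (φ : Fml (p + 1) (q + 1)) : Fml (p + 1) q :=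
  allSLe (nv p) (allLt (nv p) (.mem (nv (p + 1)) (sv q) ⟹ᶠ
    φ.subst (Fin.snoc (fun k => .var (k.castLE (by omega))) (nv (p + 1))) (fun k => .var k)))

/-- There are `n`, `T`, `U`, `U'` with `n = |x|`, `T = One(n)`, `U ≤ T`, `U' = S(U)` and
`∀ Y, Z [ψ_φ(x, 2x, U', Y) ∧ ψ_φ(x, 2x, U, Z) → (∀ i < x)(Y(i) ↔ Z(i))]`.
Indices: `x, n, i` are `p, p+1, p+2` and `T, U, U', Y, Z` are `q, …, q+4`. -/
def existsFixedPoint {p q : ℕ} (φ : Fml (p + 1) (q + 1)) : Fml (p + 1) q :=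
  .exN (.exS (.exS (.exS
    (binLen (nv p) (nv (p + 1)) ⩓ isOne (nv (p + 1)) (sv q) ⩓ strLe (sv (q + 1)) (sv q) ⩓
      isSucc (sv (q + 1)) (sv (q + 2)) ⩓
      .allS (.allS
        (psiPAt φ (by omega) (by omega) (nv p) (nv p).dbl (sv (q + 2)) (sv (q + 3)) ⩓
          psiPAt φ (by omega) (by omega) (nv p) (nv p).dbl (sv (q + 1)) (sv (q + 4)) ⟹ᶠ
          allLt (nv p) (.mem (nv (p + 2)) (sv (q + 3)) ⟺ᶠ .mem (nv (p + 2)) (sv (q + 4)))))))))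

end TwoSorted

/-! Provability is truth in all models, so the argument takes place inside an arbitrary model `M` of
V¹. Its numbers may be nonstandard; the tools are comprehension and induction for definable
predicates. The classes `S0`, `T0` and `D0` express definability by string variables, number terms
and Σᴮ₀ formulas with parameters, and instance search verifies it. The length of a comprehended
string locates its largest element, which turns comprehension into induction (`ind`). Σᴮ₁
comprehension collects the numbers that have a witness into a string and so gives induction and
minimization for Σᴮ₁ predicates (`ind_ex`, `exists_least_ex`).

Bounded recursion (`exists_seq`) produces the powers of two up to the first one above y, hence |y|,
and the values of the leading bits of X. Σᴮ₁ induction also builds the table of iterates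
(`exists_iter`). All results are unique by Σᴮ₀ induction (`BinLenW.unique`, `ValW.unique`,
`Iter.row_eq`). Thus ψ is the graph of a total function with values of length at most x. This is
claim 2, and claim 1 follows: Y is the value exactly if every string of length at most x that
satisfies ψ equals Y, and there the witnesses are quantified universally.

For claim 3, the iterates of an inflationary operator increase. If none of the rows 0, …, x agreed
with its successor, then the bits that are new at each of these x + 1 stages would map the stages
injectively to x bits, against `pigeonhole`. So the rows v and v + 1 agree for some v ≤ x < 2^|x|,
and v is the value of a string U of at most |x| bits (`PowSeq.exists_str`). For x > 0, |2x| = |x| +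
1 is large enough that the |2x| leading bits of U and of S(U) are all their bits, so the two strings
name the rows v and v + 1. The value is read from the top bit, while the carry of the successor runs
from the bottom bit: `LowSeq.eq_val` links the two readings and `IsSucc.lowSeq` does the increment.
-/

/-! ## Embedding an ordered semiring into an ordered ring -/

section DiffRing

open scoped TensorProduct

variable (N : Type*) [CommSemiring N]

/-- The ring of differences of a commutative semiring. -/
abbrev DiffRing : Type _ := ℤ ⊗[ℕ] N

namespace DiffRing

/-- The comparison of the ring of differences with the group of differences. -/
noncomputable def toGroup : DiffRing N →ₗ[ℕ] Algebra.GrothendieckAddGroup N :=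
  TensorProduct.lift
    { toFun := fun z => z • ((Algebra.GrothendieckAddGroup.of (M := N)).toNatLinearMap)
      map_add' := fun a b => add_smul a b _
      map_smul' := fun a b => by ext; simp [mul_smul] }

variable {N}

/-- The inclusion of a commutative semiring into its ring of differences. -/
noncomputable def incl : N →+* DiffRing N :=
  (Algebra.TensorProduct.includeRight : N →ₐ[ℕ] ℤ ⊗[ℕ] N).toRingHom

theorem toGroup_incl (a : N) : toGroup N (incl a) = Algebra.GrothendieckAddGroup.of a := by
  change TensorProduct.lift _ ((1 : ℤ) ⊗ₜ[ℕ] a) = _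
  rw [TensorProduct.lift.tmul]
  simp only [LinearMap.coe_mk, AddHom.coe_mk, one_smul]
  rfl

/-- A pure tensor `z ⊗ n` with `z = ± k` is plus or minus the image of `k • n`, and differences are
closed under addition. -/
theorem exists_eq_sub (x : DiffRing N) : ∃ a b : N, x = incl a - incl b := by
  induction x using TensorProduct.induction_on with
  | zero => exact ⟨0, 0, by simp⟩
  | tmul z n =>
    obtain ⟨k, rfl | rfl⟩ := z.eq_nat_or_neg
    · refine ⟨k • n, 0, ?_⟩
      simp only [incl, map_zero, sub_zero]
      rw [map_nsmul]
      simp [TensorProduct.smul_tmul']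
    · refine ⟨0, k • n, ?_⟩
      simp only [incl, map_zero, zero_sub]
      rw [map_nsmul]
      simp [TensorProduct.smul_tmul', TensorProduct.neg_tmul]
  | add x y hx hy =>
    obtain ⟨a, b, rfl⟩ := hx
    obtain ⟨c, d, rfl⟩ := hy
    exact ⟨a + c, b + d, by simp only [map_add]; ring⟩

variable [LinearOrder N] [IsStrictOrderedRing N]

theorem of_injective : Function.Injective (Algebra.GrothendieckAddGroup.of (M := N)) :=
  AddLocalization.mk_left_injective (s := (⊤ : AddSubmonoid N)) 0

/-- If a difference `incl a - incl b` is sent to zero, then `a` and `b` agree in the group of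
differences, hence in `N` by cancellation. -/
theorem toGroup_injective : Function.Injective (toGroup N) := by
  refine (injective_iff_map_eq_zero (toGroup N).toAddMonoidHom).2 fun x hx => ?_
  obtain ⟨a, b, rfl⟩ := exists_eq_sub x
  have h : toGroup N (incl a) = toGroup N (incl b) := by
    have := (toGroup N).toAddMonoidHom.map_sub (incl a) (incl b)
    rw [hx] at this
    exact sub_eq_zero.1 this.symm
  rw [toGroup_incl, toGroup_incl] at h
  rw [of_injective h, sub_self]

/-- The tensor product carries the multiplication and the group of differences carries the order;
pulling the order back joins them. -/
noncomputable instance : LinearOrder (DiffRing N) :=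
  LinearOrder.lift' (toGroup N) toGroup_injective

theorem le_iff_toGroup {x y : DiffRing N} : x ≤ y ↔ toGroup N x ≤ toGroup N y := Iff.rfl

theorem incl_le_incl {a b : N} : incl a ≤ incl b ↔ a ≤ b := by
  rw [le_iff_toGroup, toGroup_incl, toGroup_incl]
  exact (AddLocalization.mkOrderEmbedding (s := (⊤ : AddSubmonoid N)) 0).le_iff_le

theorem incl_lt_incl {a b : N} : incl a < incl b ↔ a < b := by
  rw [← not_le, ← not_le, incl_le_incl]

theorem incl_inj {a b : N} : incl a = incl b ↔ a = b := by
  rw [le_antisymm_iff, le_antisymm_iff, incl_le_incl, incl_le_incl]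

instance : IsOrderedAddMonoid (DiffRing N) where
  add_le_add_left a b h c := by
    rw [le_iff_toGroup] at h ⊢
    simpa only [map_add] using add_le_add_left h _

/-- In a canonically ordered `N`, `b ≤ a` can be solved as `a = b + c`, so every positive difference
is the image of a positive element and products of positive elements are positive. This makes
`linarith` and `nlinarith` applicable to inequalities between numbers of a model. -/
instance [CanonicallyOrderedAdd N] : IsStrictOrderedRing (DiffRing N) := by
  have pos : ∀ x : DiffRing N, 0 < x → ∃ c : N, 0 < c ∧ x = incl c := by
    intro x hx
    obtain ⟨a, b, rfl⟩ := exists_eq_sub x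
    rw [sub_pos, incl_lt_incl] at hx
    obtain ⟨c, rfl⟩ := exists_add_of_le hx.le
    refine ⟨c, ?_, by simp⟩
    simpa using hx
  have : Nontrivial (DiffRing N) := ⟨incl 0, incl 1, fun h => zero_ne_one (incl_inj.1 h)⟩
  have : ZeroLEOneClass (DiffRing N) :=
    ⟨by rw [← map_zero incl, ← map_one incl, incl_le_incl]; exact zero_le_one⟩
  refine IsStrictOrderedRing.of_mul_pos fun x y hx hy => ?_
  obtain ⟨c, hc, rfl⟩ := pos x hx
  obtain ⟨d, hd, rfl⟩ := pos y hy
  rw [← map_mul, ← map_zero incl, incl_lt_incl]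
  exact mul_pos hc hd

end DiffRing

end DiffRing

universe w

namespace TwoSorted

/-! ## Semantics of the abbreviations -/

section Semantics

variable {M : Struct.{u, v}}

instance : Zero M.Num := ⟨M.zero⟩
instance : One M.Num := ⟨M.one⟩
instance : Add M.Num := ⟨M.add⟩
instance : Mul M.Num := ⟨M.mul⟩
instance : LE M.Num := ⟨M.le⟩
-- The strict order copies `Fml.lt`, so that `realize_lt` holds by definition; the linear order on a
-- model of V¹ keeps it.
instance : LT M.Num := ⟨fun a b => a ≤ b ∧ a ≠ b⟩
instance : Membership M.Num M.Str := ⟨fun X i => M.mem i X⟩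

/-- The pairing function on the numbers of a structure. -/
def npair (a b : M.Num) : M.Num := (a + b) * (a + b + 1) + (1 + 1) * b

variable {n m : ℕ} {a : Fin n → M.Num} {A : Fin m → M.Str}

/-- Evaluates a variable given by an explicit index: deciding the comparisons unwinds nested uses of
`Fin.snoc`. -/
theorem snoc_mk {T : Type*} {n k : ℕ} (a : Fin n → T) (c : T) (hk : k < n + 1) :
    (Fin.snoc a c : Fin (n + 1) → T) ⟨k, hk⟩ = if h : k < n then a ⟨k, h⟩ else c := by
  simp only [Fin.snoc]
  rfl

@[simp] theorem val_var (i : Fin n) : (Tm.var i : Tm n m).val M a A = a i := rfl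
@[simp] theorem val_zero : (Tm.zero : Tm n m).val M a A = 0 := rfl
@[simp] theorem val_one : (Tm.one : Tm n m).val M a A = 1 := rfl
@[simp] theorem val_add (t s : Tm n m) :
    (Tm.add t s).val M a A = t.val M a A + s.val M a A := rfl
@[simp] theorem val_mul (t s : Tm n m) :
    (Tm.mul t s).val M a A = t.val M a A * s.val M a A := rfl
@[simp] theorem val_len (X : Fin m) : (Tm.len X : Tm n m).val M a A = M.len (A X) := rfl
@[simp] theorem val_nv (k : ℕ) (h : k < n) : (nv k h : Tm n m).val M a A = a ⟨k, h⟩ := rfl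
@[simp] theorem val_succ (t : Tm n m) : t.succ.val M a A = t.val M a A + 1 := rfl
@[simp] theorem val_dbl (t : Tm n m) : t.dbl.val M a A = (1 + 1) * t.val M a A := rfl
@[simp] theorem val_pair (t s : Tm n m) :
    (t.pair s).val M a A = npair (t.val M a A) (s.val M a A) := rfl

@[simp] theorem val_new (c : M.Num) : (new : Tm (n + 1) m).val M (Fin.snoc a c) A = c := by
  simp [new]

@[simp] theorem val_up (t : Tm n m) (c : M.Num) :
    t.up.val M (Fin.snoc a c) A = t.val M a A := by
  induction t with
  | var i => simp [Tm.up]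
  | add t s ht hs => simp [Tm.up, ht, hs]
  | mul t s ht hs => simp [Tm.up, ht, hs]
  | _ => rfl

theorem val_upS (k : ℕ) (t : Tm n m) (B : Fin (m + k) → M.Str) :
    (t.upS k).val M a B = t.val M a (fun j => B (j.castAdd k)) := by
  induction t with
  | add t s ht hs => simp [Tm.upS, ht, hs]
  | mul t s ht hs => simp [Tm.upS, ht, hs]
  | _ => rfl

@[simp] theorem val_upS_one (t : Tm n m) (C : M.Str) :
    (t.upS 1).val M a (Fin.snoc A C) = t.val M a A := by
  rw [val_upS]
  congr 1
  funext j
  exact Fin.snoc_castSucc (α := fun _ => M.Str) ..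

@[simp] theorem realize_eq (t s : Tm n m) :
    (Fml.eq t s).Realize M a A ↔ t.val M a A = s.val M a A := Iff.rfl
@[simp] theorem realize_strEq (X Y : Fin m) :
    (Fml.strEq X Y : Fml n m).Realize M a A ↔ A X = A Y := Iff.rfl
@[simp] theorem realize_le (t s : Tm n m) :
    (Fml.le t s).Realize M a A ↔ t.val M a A ≤ s.val M a A := Iff.rfl
@[simp] theorem realize_mem (t : Tm n m) (X : Fin m) :
    (Fml.mem t X).Realize M a A ↔ t.val M a A ∈ A X := Iff.rfl
@[simp] theorem realize_not (B : Fml n m) : B.not.Realize M a A ↔ ¬ B.Realize M a A := Iff.rfl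
@[simp] theorem realize_and (B C : Fml n m) :
    (B ⩓ C).Realize M a A ↔ B.Realize M a A ∧ C.Realize M a A := Iff.rfl
@[simp] theorem realize_or (B C : Fml n m) :
    (B ⩔ C).Realize M a A ↔ B.Realize M a A ∨ C.Realize M a A := Iff.rfl
@[simp] theorem realize_imp (B C : Fml n m) :
    (B ⟹ᶠ C).Realize M a A ↔ (B.Realize M a A → C.Realize M a A) := by
  simp [Fml.imp, imp_iff_not_or]
@[simp] theorem realize_iff (B C : Fml n m) :
    (B ⟺ᶠ C).Realize M a A ↔ (B.Realize M a A ↔ C.Realize M a A) := by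
  simp [Fml.iff, iff_iff_implies_and_implies]
@[simp] theorem realize_lt (t s : Tm n m) :
    (Fml.lt t s).Realize M a A ↔ t.val M a A < s.val M a A := Iff.rfl
@[simp] theorem realize_allN (B : Fml (n + 1) m) :
    B.allN.Realize M a A ↔ ∀ c : M.Num, B.Realize M (Fin.snoc a c) A := Iff.rfl
@[simp] theorem realize_exN (B : Fml (n + 1) m) :
    B.exN.Realize M a A ↔ ∃ c : M.Num, B.Realize M (Fin.snoc a c) A := Iff.rfl
@[simp] theorem realize_allS (B : Fml n (m + 1)) :
    B.allS.Realize M a A ↔ ∀ C : M.Str, B.Realize M a (Fin.snoc A C) := Iff.rfl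
@[simp] theorem realize_exS (B : Fml n (m + 1)) :
    B.exS.Realize M a A ↔ ∃ C : M.Str, B.Realize M a (Fin.snoc A C) := Iff.rfl
@[simp] theorem realize_allLe (t : Tm n m) (B : Fml (n + 1) m) :
    (allLe t B).Realize M a A ↔ ∀ c ≤ t.val M a A, B.Realize M (Fin.snoc a c) A := by
  simp [allLe]
@[simp] theorem realize_exLe (t : Tm n m) (B : Fml (n + 1) m) :
    (exLe t B).Realize M a A ↔ ∃ c ≤ t.val M a A, B.Realize M (Fin.snoc a c) A := by
  simp [exLe]
@[simp] theorem realize_allLt (t : Tm n m) (B : Fml (n + 1) m) :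
    (allLt t B).Realize M a A ↔ ∀ c < t.val M a A, B.Realize M (Fin.snoc a c) A := by
  simp only [allLt, realize_allLe, realize_imp, realize_lt, val_new, val_up]
  exact ⟨fun h c hc => h c hc.1 hc, fun h c _ hc => h c hc⟩
@[simp] theorem realize_exLt (t : Tm n m) (B : Fml (n + 1) m) :
    (exLt t B).Realize M a A ↔ ∃ c < t.val M a A, B.Realize M (Fin.snoc a c) A := by
  simp only [exLt, realize_exLe, realize_and, realize_lt, val_new, val_up]
  exact ⟨fun ⟨c, _, h⟩ => ⟨c, h⟩, fun ⟨c, h⟩ => ⟨c, h.1.1, h⟩⟩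
@[simp] theorem realize_allSLe (t : Tm n m) (B : Fml n (m + 1)) :
    (allSLe t B).Realize M a A ↔
      ∀ C, M.len C ≤ t.val M a A → B.Realize M a (Fin.snoc A C) := by
  simp [allSLe]
@[simp] theorem realize_exSLe (t : Tm n m) (B : Fml n (m + 1)) :
    (exSLe t B).Realize M a A ↔
      ∃ C, M.len C ≤ t.val M a A ∧ B.Realize M a (Fin.snoc A C) := by
  simp [exSLe]

end Semantics

/-! ## Models of `V¹` -/

/-- The structure `M` is a model of `V¹`. -/
class V1Model (M : Struct.{u, v}) : Prop where
  valid : ∀ (k l : ℕ) (C : Fml k l), V1 k l C → M.Valid C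

section Axioms

variable {M : Struct.{u, v}} [V1Model M]

theorem ax_b1 (x : M.Num) : x + 1 ≠ 0 := by
  have := V1Model.valid (M := M) _ _ _ V1.b1 ![x] ![]
  simpa using this

theorem ax_b2 {x y : M.Num} : x + 1 = y + 1 → x = y := by
  have := V1Model.valid (M := M) _ _ _ V1.b2 ![x, y] ![]
  simpa using this

theorem ax_b3 (x : M.Num) : x + 0 = x := by
  have := V1Model.valid (M := M) _ _ _ V1.b3 ![x] ![]
  simpa using this

theorem ax_b4 (x y : M.Num) : x + (y + 1) = x + y + 1 := by
  have := V1Model.valid (M := M) _ _ _ V1.b4 ![x, y] ![]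
  simpa using this

theorem ax_b5 (x : M.Num) : x * 0 = 0 := by
  have := V1Model.valid (M := M) _ _ _ V1.b5 ![x] ![]
  simpa using this

theorem ax_b6 (x y : M.Num) : x * (y + 1) = x * y + x := by
  have := V1Model.valid (M := M) _ _ _ V1.b6 ![x, y] ![]
  simpa using this

theorem ax_b7 {x y : M.Num} : x ≤ y → y ≤ x → x = y := by
  have := V1Model.valid (M := M) _ _ _ V1.b7 ![x, y] ![]
  simpa using this

theorem ax_b8 (x y : M.Num) : x ≤ x + y := by
  have := V1Model.valid (M := M) _ _ _ V1.b8 ![x, y] ![]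
  simpa using this

theorem ax_b9 (x : M.Num) : 0 ≤ x := by
  have := V1Model.valid (M := M) _ _ _ V1.b9 ![x] ![]
  simpa using this

theorem ax_b10 (x y : M.Num) : x ≤ y ∨ y ≤ x := by
  have := V1Model.valid (M := M) _ _ _ V1.b10 ![x, y] ![]
  simpa using this

theorem ax_b11 {x y : M.Num} : x ≤ y ↔ x < y + 1 := by
  have := V1Model.valid (M := M) _ _ _ V1.b11 ![x, y] ![]
  simpa using this

theorem ax_b12 {x : M.Num} : x ≠ 0 → ∃ y ≤ x, y + 1 = x := by
  have := V1Model.valid (M := M) _ _ _ V1.b12 ![x] ![]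
  simpa [snoc_mk] using this

theorem ax_l1 {x : M.Num} {X : M.Str} : x ∈ X → x < M.len X := by
  have := V1Model.valid (M := M) _ _ _ V1.l1 ![x] ![X]
  simpa [sv] using this

theorem ax_l2 {x : M.Num} {X : M.Str} : x + 1 = M.len X → x ∈ X := by
  have := V1Model.valid (M := M) _ _ _ V1.l2 ![x] ![X]
  simpa [sv] using this

theorem ax_se {X Y : M.Str} (h : M.len X = M.len Y)
    (h' : ∀ i < M.len X, i ∈ X ↔ i ∈ Y) : X = Y := by
  have := V1Model.valid (M := M) _ _ _ V1.se ![] ![X, Y]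
  simp [sv] at this
  exact this h h'

end Axioms

/-! ## Substitution -/

section Subst

theorem Tm.up_subst {n m n' m' : ℕ} (σ : Fin n → Tm n' m') (τ : Fin m → STm n' m')
    (t : Tm n m) :
    t.up.subst (Fin.snoc (fun k => (σ k).up) new) (fun k => (τ k).up) = (t.subst σ τ).up := by
  induction t with
  | var i => simp [Tm.up, Tm.subst]
  | add t s ht hs => simp [Tm.up, Tm.subst, ht, hs]
  | mul t s ht hs => simp [Tm.up, Tm.subst, ht, hs]
  | len X => simp only [Tm.up, Tm.subst]; cases τ X <;> rfl
  | _ => rfl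

theorem new_subst {n m n' m' : ℕ} (σ : Fin n → Tm (n' + 1) m') (τ : Fin m → STm (n' + 1) m')
    (t : Tm (n' + 1) m') :
    (new : Tm (n + 1) m).subst (Fin.snoc σ t) τ = t := by
  simp [new, Tm.subst]

/-- `IsSigB0` recognises bounded quantifiers only in the literal forms `allLe` and `exLe`, so
substitution has to be seen to preserve these forms. -/
theorem allLe_subst {n m n' m' : ℕ} (σ : Fin n → Tm n' m') (τ : Fin m → STm n' m')
    (t : Tm n m) (A : Fml (n + 1) m) :
    (allLe t A).subst σ τ = allLe (t.subst σ τ)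
      (A.subst (Fin.snoc (fun k => (σ k).up) new) (fun k => (τ k).up)) := by
  simp only [allLe, Fml.subst, Fml.imp, Tm.up_subst, new_subst]

theorem exLe_subst {n m n' m' : ℕ} (σ : Fin n → Tm n' m') (τ : Fin m → STm n' m')
    (t : Tm n m) (A : Fml (n + 1) m) :
    (exLe t A).subst σ τ = exLe (t.subst σ τ)
      (A.subst (Fin.snoc (fun k => (σ k).up) new) (fun k => (τ k).up)) := by
  simp only [exLe, Fml.subst, Tm.up_subst, new_subst]

theorem IsSigB0.imp {n m : ℕ} {A B : Fml n m} (hA : IsSigB0 A) (hB : IsSigB0 B) :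
    IsSigB0 (A ⟹ᶠ B) := .or (.not hA) hB

theorem IsSigB0.iff {n m : ℕ} {A B : Fml n m} (hA : IsSigB0 A) (hB : IsSigB0 B) :
    IsSigB0 (A ⟺ᶠ B) := .and (.imp hA hB) (.imp hB hA)

theorem IsSigB0.lt {n m : ℕ} (t s : Tm n m) : IsSigB0 (.lt t s) := .and (.le _ _) (.not (.eq _ _))

theorem IsSigB0.allLt {n m : ℕ} (t : Tm n m) {A : Fml (n + 1) m} (hA : IsSigB0 A) :
    IsSigB0 (allLt t A) := .allLe _ (.imp (.lt _ _) hA)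

theorem IsSigB0.exLt {n m : ℕ} (t : Tm n m) {A : Fml (n + 1) m} (hA : IsSigB0 A) :
    IsSigB0 (exLt t A) := .exLe _ (.and (.lt _ _) hA)

theorem IsSigB0.rowMem {n m : ℕ} (Z : Fin m) (j i : Tm n m) : IsSigB0 (rowMem Z j i) :=
  .and (.lt _ _) (.mem _ _)

theorem IsSigB0.stmMem {n m : ℕ} (t : Tm n m) (s : STm n m) : IsSigB0 (s.mem t) := by
  cases s
  · exact .mem _ _
  · exact .rowMem _ _ _

theorem IsSigB0.stmEq {n m : ℕ} (s r : STm n m) : IsSigB0 (s.eq r) := by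
  cases s <;> cases r <;>
    first
      | exact .strEq _ _
      | exact .and (.eq _ _) (.allLt _ (.iff (.stmMem _ _) (.stmMem _ _)))

/-- A row in the place of a string variable turns memberships and equalities into Σᴮ₀ formulas, and
bounded quantifiers stay bounded. -/
theorem IsSigB0.subst {n m : ℕ} {A : Fml n m} (hA : IsSigB0 A) :
    ∀ {n' m' : ℕ} (σ : Fin n → Tm n' m') (τ : Fin m → STm n' m'), IsSigB0 (A.subst σ τ) := by
  induction hA with
  | eq t s => intros; exact .eq _ _
  | strEq X Y => intros; exact .stmEq _ _
  | le t s => intros; exact .le _ _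
  | mem t X => intros; exact .stmMem _ _
  | not _ ih => intros; exact .not (ih _ _)
  | and _ _ ih ih' => intros; exact .and (ih _ _) (ih' _ _)
  | or _ _ ih ih' => intros; exact .or (ih _ _) (ih' _ _)
  | allLe t _ ih => intros; rw [allLe_subst]; exact .allLe _ (ih _ _)
  | exLe t _ ih => intros; rw [exLe_subst]; exact .exLe _ (ih _ _)

variable {M : Struct.{u, v}}

/-- The string `C` is a value of the substituted object `s`. -/
def STm.Eval {n m : ℕ} (a : Fin n → M.Num) (A : Fin m → M.Str) : STm n m → M.Str → Prop
  | .var X, C => A X = C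
  | .row Z j l, C => l.val M a A = M.len C ∧
      ∀ i, (i < M.len (A Z) ∧ npair (j.val M a A) i ∈ A Z) ↔ i ∈ C

variable {n m : ℕ} {a : Fin n → M.Num} {A : Fin m → M.Str}

theorem STm.Eval.len {s : STm n m} {C : M.Str} (h : s.Eval a A C) :
    s.len.val M a A = M.len C := by
  cases s with
  | var X => simp only [STm.Eval] at h; simp [STm.len, h]
  | row Z j l => exact h.1

theorem STm.Eval.mem {s : STm n m} {C : M.Str} (h : s.Eval a A C) (t : Tm n m) :
    (s.mem t).Realize M a A ↔ t.val M a A ∈ C := by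
  cases s with
  | var X => simp only [STm.Eval] at h; simp [STm.mem, h]
  | row Z j l => simpa [STm.mem, rowMem] using h.2 _

theorem STm.Eval.up {s : STm n m} {C : M.Str} (h : s.Eval a A C) (c : M.Num) :
    s.up.Eval (Fin.snoc a c : Fin (n + 1) → M.Num) A C := by
  cases s with
  | var X => exact h
  | row Z j l => simpa [STm.Eval, STm.up] using h

theorem STm.Eval.upS {s : STm n m} {C : M.Str} (h : s.Eval a A C) (B : M.Str) :
    s.upS.Eval a (Fin.snoc A B : Fin (m + 1) → M.Str) C := by
  cases s with
  | var X => simpa [STm.Eval, STm.upS] using h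
  | row Z j l => simpa [STm.Eval, STm.upS] using h

/-- An equality involving a row is spelled out by lengths and bits; the extensionality axiom SE
turns that agreement into equality of the values. -/
theorem STm.Eval.eq [V1Model M] {s r : STm n m} {C D : M.Str} (h : s.Eval a A C)
    (h' : r.Eval a A D) : (s.eq r).Realize M a A ↔ C = D := by
  have key : (Fml.eq s.len r.len ⩓ allLt s.len (s.up.mem new ⟺ᶠ r.up.mem new)).Realize M a A ↔
      C = D := by
    simp only [realize_and, realize_eq, h.len, h'.len, realize_allLt, realize_iff,
      (h.up _).mem, (h'.up _).mem, val_new]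
    exact ⟨fun hh => ax_se hh.1 hh.2, by rintro rfl; simp⟩
  cases s <;> cases r <;> first | exact key | skip
  simp only [STm.Eval] at h h'
  simp [STm.eq, h, h']

theorem val_subst {n' m' : ℕ} (t : Tm n' m') {σ : Fin n' → Tm n m} {τ : Fin m' → STm n m}
    {C : Fin m' → M.Str} (h : ∀ k, (τ k).Eval a A (C k)) :
    (t.subst σ τ).val M a A = t.val M (fun k => (σ k).val M a A) C := by
  induction t with
  | add t s ht hs => simp [Tm.subst, ht, hs]
  | mul t s ht hs => simp [Tm.subst, ht, hs]
  | len X => exact (h X).len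
  | _ => rfl

/-- No term denotes a row, so the strings `C` being substituted are any values of the objects `τ`.
The assignments are generalised in the induction because a quantifier extends both them and the
substitution. -/
theorem realize_subst [V1Model M] {n' m' : ℕ} (B : Fml n' m') : ∀ {n m : ℕ}
    {a : Fin n → M.Num} {A : Fin m → M.Str} {σ : Fin n' → Tm n m} {τ : Fin m' → STm n m}
    {C : Fin m' → M.Str}, (∀ k, (τ k).Eval a A (C k)) →
    ((B.subst σ τ).Realize M a A ↔ B.Realize M (fun k => (σ k).val M a A) C) := by
  have snocN : ∀ {n n' m : ℕ} (a : Fin n → M.Num) (A : Fin m → M.Str) (σ : Fin n' → Tm n m)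
      (c : M.Num), (fun k => ((Fin.snoc (fun k => (σ k).up) new : Fin (n' + 1) → Tm (n + 1) m)
        k).val M (Fin.snoc a c) A) = Fin.snoc (fun k => (σ k).val M a A) c := by
    intros
    funext k
    refine Fin.lastCases ?_ (fun k => ?_) k <;> simp
  have snocS : ∀ {n m m' : ℕ} (a : Fin n → M.Num) (A : Fin m → M.Str) (τ : Fin m' → STm n m)
      (C : Fin m' → M.Str) (D : M.Str), (∀ k, (τ k).Eval a A (C k)) →
      ∀ k, ((Fin.snoc (fun k => (τ k).upS) (.var (Fin.last _)) : Fin (m' + 1) → STm n (m + 1))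
        k).Eval a (Fin.snoc A D : Fin (m + 1) → M.Str)
          ((Fin.snoc C D : Fin (m' + 1) → M.Str) k) := by
    intro n m m' a A τ C D h k
    refine Fin.lastCases ?_ (fun k => ?_) k
    · simp [STm.Eval]
    · simpa using (h k).upS D
  induction B with
  | eq t s => intro _ _ _ _ _ _ _ h; simp [Fml.subst, val_subst _ h]
  | strEq X Y => intro _ _ _ _ _ _ _ h; simpa [Fml.subst] using (h X).eq (h Y)
  | le t s => intro _ _ _ _ _ _ _ h; simp [Fml.subst, val_subst _ h]
  | mem t X =>
    intro _ _ _ _ _ _ _ h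
    simp only [Fml.subst, (h X).mem, val_subst _ h, realize_mem]
  | not _ ih => intro _ _ _ _ _ _ _ h; simp [Fml.subst, ih h]
  | and _ _ ih ih' => intro _ _ _ _ _ _ _ h; simp [Fml.subst, ih h, ih' h]
  | or _ _ ih ih' => intro _ _ _ _ _ _ _ h; simp [Fml.subst, ih h, ih' h]
  | allN _ ih =>
    intro _ _ _ _ _ _ _ h
    simp only [Fml.subst, realize_allN]
    refine forall_congr' fun c => ?_
    rw [ih (fun k => (h k).up c), snocN]
  | exN _ ih =>
    intro _ _ _ _ _ _ _ h
    simp only [Fml.subst, realize_exN]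
    refine exists_congr fun c => ?_
    rw [ih (fun k => (h k).up c), snocN]
  | allS _ ih =>
    intro _ _ _ _ _ _ _ h
    simp only [Fml.subst, realize_allS]
    refine forall_congr' fun D => ?_
    rw [ih (snocS _ _ _ _ D h)]
    simp
  | exS _ ih =>
    intro _ _ _ _ _ _ _ h
    simp only [Fml.subst, realize_exS]
    refine exists_congr fun D => ?_
    rw [ih (snocS _ _ _ _ D h)]
    simp

theorem realize_rename [V1Model M] {n' m' : ℕ} (B : Fml n' m') (ρ : Fin n' → Fin n)
    (π : Fin m' → Fin m) :
    (B.subst (fun k => .var (ρ k)) (fun k => .var (π k))).Realize M a A ↔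
      B.Realize M (fun k => a (ρ k)) (fun k => A (π k)) :=
  realize_subst B fun _ => rfl

end Subst

/-! ## Definability with parameters -/

/-- `E` is a tuple of numbers and strings of `M`; `num` and `str` are its coordinates and the
constants. -/
class Ctx (M : Struct.{u, v}) (E : Type w) where
  num : Set (E → M.Num)
  str : Set (E → M.Str)
  const_num : ∀ c : M.Num, (fun _ => c) ∈ num
  const_str : ∀ C : M.Str, (fun _ => C) ∈ str

section Definability

variable {M : Struct.{u, v}} {E : Type*}

instance : Ctx M Unit where
  num := Set.univ
  str := Set.univ
  const_num _ := trivial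
  const_str _ := trivial

instance [Ctx M E] : Ctx M (E × M.Num) where
  num := {f | f = Prod.snd ∨ ∃ h ∈ Ctx.num (M := M) (E := E), f = fun e => h e.1}
  str := {f | ∃ h ∈ Ctx.str (M := M) (E := E), f = fun e => h e.1}
  const_num c := Or.inr ⟨_, Ctx.const_num c, rfl⟩
  const_str c := ⟨_, Ctx.const_str c, rfl⟩

instance [Ctx M E] : Ctx M (E × M.Str) where
  num := {f | ∃ h ∈ Ctx.num (M := M) (E := E), f = fun e => h e.1}
  str := {f | f = Prod.snd ∨ ∃ h ∈ Ctx.str (M := M) (E := E), f = fun e => h e.1}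
  const_num c := ⟨_, Ctx.const_num c, rfl⟩
  const_str c := Or.inr ⟨_, Ctx.const_str c, rfl⟩

variable (M) in
/-- Finite families of number and string variables of a context. -/
structure Frame (E : Type*) [Ctx M E] where
  n : ℕ
  m : ℕ
  g : E → Fin n → M.Num
  G : E → Fin m → M.Str
  hg : ∀ i, (fun e => g e i) ∈ Ctx.num (M := M) (E := E)
  hG : ∀ i, (fun e => G e i) ∈ Ctx.str (M := M) (E := E)

variable [Ctx M E]

def Frame.append (F F' : Frame M E) : Frame M E where
  n := F.n + F'.n
  m := F.m + F'.m
  g e := Fin.append (F.g e) (F'.g e)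
  G e := Fin.append (F.G e) (F'.G e)
  hg i := by
    refine Fin.addCases (fun i => ?_) (fun i => ?_) i
    · simpa using F.hg i
    · simpa using F'.hg i
  hG i := by
    refine Fin.addCases (fun i => ?_) (fun i => ?_) i
    · simpa using F.hG i
    · simpa using F'.hG i

/-- `X` is a string variable of the context or constant. -/
class S0 (X : E → M.Str) : Prop where
  out : X ∈ Ctx.str (M := M) (E := E)

/-- `f` is given by a number term. -/
class T0 (f : E → M.Num) : Prop where
  out : ∃ (F : Frame M E) (t : Tm F.n F.m), ∀ e, t.val M (F.g e) (F.G e) = f e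

variable (M) in
/-- `P` is given by a `Σᴮ₀` formula with parameters. -/
class D0 (P : E → Prop) : Prop where
  out : ∃ (F : Frame M E) (A : Fml F.n F.m), IsSigB0 A ∧ ∀ e, A.Realize M (F.g e) (F.G e) ↔ P e

def Frame.inlN (F F' : Frame M E) : Fin F.n → Fin (F.append F').n := Fin.castAdd F'.n
def Frame.inrN (F F' : Frame M E) : Fin F'.n → Fin (F.append F').n := Fin.natAdd F.n
def Frame.inlS (F F' : Frame M E) : Fin F.m → Fin (F.append F').m := Fin.castAdd F'.m
def Frame.inrS (F F' : Frame M E) : Fin F'.m → Fin (F.append F').m := Fin.natAdd F.m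

/-- A term over the left part of a larger frame. -/
def Frame.tmL (F F' : Frame M E) (t : Tm F.n F.m) : Tm (F.append F').n (F.append F').m :=
  t.subst (fun k => .var (F.inlN F' k)) (fun k => .var (F.inlS F' k))

/-- A term over the right part of a larger frame. -/
def Frame.tmR (F F' : Frame M E) (t : Tm F'.n F'.m) : Tm (F.append F').n (F.append F').m :=
  t.subst (fun k => .var (F.inrN F' k)) (fun k => .var (F.inrS F' k))

/-- A formula over the left part of a larger frame. -/
def Frame.fmlL (F F' : Frame M E) (A : Fml F.n F.m) : Fml (F.append F').n (F.append F').m :=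
  A.subst (fun k => .var (F.inlN F' k)) (fun k => .var (F.inlS F' k))

/-- A formula over the right part of a larger frame. -/
def Frame.fmlR (F F' : Frame M E) (A : Fml F'.n F'.m) : Fml (F.append F').n (F.append F').m :=
  A.subst (fun k => .var (F.inrN F' k)) (fun k => .var (F.inrS F' k))

theorem Frame.append_g_inl (F F' : Frame M E) (e : E) :
    (fun k => (F.append F').g e (F.inlN F' k)) = F.g e :=
  funext fun _ => Fin.append_left _ _ _

theorem Frame.append_G_inl (F F' : Frame M E) (e : E) :
    (fun k => (F.append F').G e (F.inlS F' k)) = F.G e :=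
  funext fun _ => Fin.append_left _ _ _

theorem Frame.append_g_inr (F F' : Frame M E) (e : E) :
    (fun k => (F.append F').g e (F.inrN F' k)) = F'.g e :=
  funext fun _ => Fin.append_right _ _ _

theorem Frame.append_G_inr (F F' : Frame M E) (e : E) :
    (fun k => (F.append F').G e (F.inrS F' k)) = F'.G e :=
  funext fun _ => Fin.append_right _ _ _

theorem realize_fmlL [V1Model M] (F F' : Frame M E) (A : Fml F.n F.m) (e : E) :
    (F.fmlL F' A).Realize M ((F.append F').g e) ((F.append F').G e) ↔
      A.Realize M (F.g e) (F.G e) := by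
  refine (realize_rename A _ _).trans ?_
  rw [F.append_g_inl, F.append_G_inl]

theorem realize_fmlR [V1Model M] (F F' : Frame M E) (A : Fml F'.n F'.m) (e : E) :
    (F.fmlR F' A).Realize M ((F.append F').g e) ((F.append F').G e) ↔
      A.Realize M (F'.g e) (F'.G e) := by
  refine (realize_rename A _ _).trans ?_
  rw [F.append_g_inr, F.append_G_inr]

theorem val_tmL (F F' : Frame M E) (t : Tm F.n F.m) (e : E) :
    (F.tmL F' t).val M ((F.append F').g e) ((F.append F').G e) = t.val M (F.g e) (F.G e) := by
  rw [← F.append_g_inl F', ← F.append_G_inl F']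
  exact val_subst t fun _ => rfl

theorem val_tmR (F F' : Frame M E) (t : Tm F'.n F'.m) (e : E) :
    (F.tmR F' t).val M ((F.append F').g e) ((F.append F').G e) = t.val M (F'.g e) (F'.G e) := by
  rw [← F.append_g_inr F', ← F.append_G_inr F']
  exact val_subst t fun _ => rfl

theorem T0.of_num {f : E → M.Num} (h : f ∈ Ctx.num (M := M) (E := E)) : T0 f :=
  ⟨⟨1, 0, fun e _ => f e, fun _ => Fin.elim0, fun _ => h, fun i => i.elim0⟩,
    (.var 0 : Tm 1 0), fun _ => rfl⟩

instance S0.const (C : M.Str) : S0 (fun _ : E => C) := ⟨Ctx.const_str C⟩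

instance T0.const (c : M.Num) : T0 (fun _ : E => c) := .of_num (Ctx.const_num c)

/-- The two terms come with different frames; both are renamed into the concatenation of these
frames. -/
theorem T0.binary (op : {n m : ℕ} → Tm n m → Tm n m → Tm n m) {o : M.Num → M.Num → M.Num}
    (hop : ∀ {n m : ℕ} (t s : Tm n m) (a : Fin n → M.Num) (A : Fin m → M.Str),
      (op t s).val M a A = o (t.val M a A) (s.val M a A)) (f g : E → M.Num) [hf : T0 f]
    [hg : T0 g] :
    T0 (fun e => o (f e) (g e)) := by
  obtain ⟨F, t, ht⟩ := hf
  obtain ⟨F', s, hs⟩ := hg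
  exact ⟨F.append F', op (F.tmL F' t) (F.tmR F' s), fun e => by
    rw [hop, val_tmL, val_tmR, ht, hs]⟩

instance T0.add (f g : E → M.Num) [T0 f] [T0 g] : T0 (fun e => f e + g e) :=
  T0.binary (fun {_ _} => .add) (fun _ _ _ _ => rfl) f g

instance T0.mul (f g : E → M.Num) [T0 f] [T0 g] : T0 (fun e => f e * g e) :=
  T0.binary (fun {_ _} => .mul) (fun _ _ _ _ => rfl) f g

instance T0.npair (f g : E → M.Num) [T0 f] [T0 g] : T0 (fun e => npair (f e) (g e)) :=
  T0.binary (fun {_ _} => .pair) (fun _ _ _ _ => rfl) f g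

instance T0.len (X : E → M.Str) [hX : S0 X] : T0 (fun e => M.len (X e)) :=
  ⟨⟨0, 1, fun _ => Fin.elim0, fun e _ => X e, fun i => i.elim0, fun _ => hX.out⟩, (.len 0 : Tm 0 1),
    fun _ => rfl⟩

/-- A proposition independent of the tuple has one fixed truth value, so `0 = 0` or its negation
defines it, whatever the proposition says. -/
instance D0.const (p : Prop) : D0 M (fun _ : E => p) := by
  let F : Frame M E :=
    ⟨0, 0, fun _ => Fin.elim0, fun _ => Fin.elim0, fun i => i.elim0, fun i => i.elim0⟩
  by_cases hp : p
  · exact ⟨F, .eq .zero .zero, .eq _ _, fun _ => by simp [hp]⟩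
  · exact ⟨F, .not (.eq .zero .zero), .not (.eq _ _), fun _ => by simp [hp]⟩

theorem D0.atom (R : {n m : ℕ} → Tm n m → Tm n m → Fml n m) {r : M.Num → M.Num → Prop}
    (h0 : ∀ {n m : ℕ} (t s : Tm n m), IsSigB0 (R t s))
    (hR : ∀ {n m : ℕ} (t s : Tm n m) (a : Fin n → M.Num) (A : Fin m → M.Str),
      (R t s).Realize M a A ↔ r (t.val M a A) (s.val M a A)) (f g : E → M.Num)
    [hf : T0 f] [hg : T0 g] : D0 M (fun e => r (f e) (g e)) := by
  obtain ⟨F, t, ht⟩ := hf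
  obtain ⟨F', s, hs⟩ := hg
  exact ⟨F.append F', R (F.tmL F' t) (F.tmR F' s), h0 _ _, fun e => by
    rw [hR, val_tmL, val_tmR, ht, hs]⟩

instance D0.eq (f g : E → M.Num) [T0 f] [T0 g] : D0 M (fun e => f e = g e) :=
  D0.atom (fun {_ _} => .eq) .eq (fun _ _ _ _ => Iff.rfl) f g

instance D0.le (f g : E → M.Num) [T0 f] [T0 g] : D0 M (fun e => f e ≤ g e) :=
  D0.atom (fun {_ _} => .le) .le (fun _ _ _ _ => Iff.rfl) f g

instance D0.mem (f : E → M.Num) (X : E → M.Str) [hf : T0 f] [hX : S0 X] :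
    D0 M (fun e => f e ∈ X e) := by
  obtain ⟨F, t, ht⟩ := hf
  let F' : Frame M E :=
    ⟨0, 1, fun _ => Fin.elim0, fun e _ => X e, fun i => i.elim0, fun _ => hX.out⟩
  refine ⟨F.append F', .mem (F.tmL F' t) (F.inrS F' (0 : Fin 1)), .mem _ _, fun e => ?_⟩
  rw [realize_mem, val_tmL, ht]
  exact iff_of_eq (congrArg (f e ∈ ·) (congrFun (F.append_G_inr F' e) (0 : Fin 1)))

section V1

variable [V1Model M]

theorem D0.binary (op : {n m : ℕ} → Fml n m → Fml n m → Fml n m) {o : Prop → Prop → Prop}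
    (h0 : ∀ {n m : ℕ} {A B : Fml n m}, IsSigB0 A → IsSigB0 B → IsSigB0 (op A B))
    (hop : ∀ {n m : ℕ} (A B : Fml n m) (a : Fin n → M.Num) (C : Fin m → M.Str),
      (op A B).Realize M a C ↔ o (A.Realize M a C) (B.Realize M a C)) (P Q : E → Prop)
    [hP : D0 M P] [hQ : D0 M Q] : D0 M (fun e => o (P e) (Q e)) := by
  obtain ⟨F, A, hA, h⟩ := hP
  obtain ⟨F', B, hB, h'⟩ := hQ
  refine ⟨F.append F', op (F.fmlL F' A) (F.fmlR F' B), h0 (hA.subst _ _) (hB.subst _ _),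
    fun e => ?_⟩
  rw [hop, realize_fmlL, realize_fmlR, h, h']

instance D0.and (P Q : E → Prop) [D0 M P] [D0 M Q] : D0 M (fun e => P e ∧ Q e) :=
  D0.binary (fun {_ _} => .and) .and (fun _ _ _ _ => Iff.rfl) P Q

instance D0.or (P Q : E → Prop) [D0 M P] [D0 M Q] : D0 M (fun e => P e ∨ Q e) :=
  D0.binary (fun {_ _} => .or) .or (fun _ _ _ _ => Iff.rfl) P Q

instance D0.imp (P Q : E → Prop) [D0 M P] [D0 M Q] : D0 M (fun e => P e → Q e) :=
  D0.binary (fun {_ _} => .imp) (o := fun p q => p → q) .imp (fun _ _ _ _ => realize_imp ..) P Q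

instance D0.iff (P Q : E → Prop) [D0 M P] [D0 M Q] : D0 M (fun e => P e ↔ Q e) :=
  D0.binary (fun {_ _} => .iff) .iff (fun _ _ _ _ => realize_iff ..) P Q

/-- Several variables of the frame, or none, may stand for the new number. All of them are renamed
to the last variable, which a quantifier can then bind. -/
theorem D0.exists_snoc (P : E × M.Num → Prop) [hP : D0 M P] :
    ∃ (F : Frame M E) (A : Fml (F.n + 1) F.m), IsSigB0 A ∧
      ∀ e c, A.Realize M (Fin.snoc (F.g e) c) (F.G e) ↔ P (e, c) := by
  obtain ⟨F, A, hA, h⟩ := hP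
  choose H hH hGH using F.hG
  have hr : ∀ i, ∃ h ∈ Ctx.num (M := M) (E := E), (∀ x, F.g x i = x.2) ∨ ∀ x, F.g x i = h x.1 := by
    intro i
    rcases F.hg i with hi | ⟨h, hh, hi⟩
    -- The slot of a variable that stands for the new number is filled with the dummy 0; the
    -- renaming below never reads it.
    · exact ⟨_, Ctx.const_num 0, .inl fun x => congrFun hi x⟩
    · exact ⟨h, hh, .inr fun x => congrFun hi x⟩
  choose g hg hgg using hr
  classical
  refine ⟨⟨F.n, F.m, fun e i => g i e, fun e j => H j e, hg, hH⟩,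
    A.subst (fun k => .var (if ∀ x, F.g x k = x.2 then Fin.last _ else k.castSucc))
      (fun k => .var (id k)), hA.subst _ _, fun e c => ?_⟩
  rw [realize_rename, ← h]
  have h1 : (fun k => (Fin.snoc (fun i => g i e) c : Fin (F.n + 1) → M.Num)
      (if ∀ x, F.g x k = x.2 then Fin.last _ else k.castSucc)) = F.g (e, c) := by
    funext k
    split_ifs with hk
    · simp [hk]
    · simp [((hgg k).resolve_left hk)]
  have h2 : (fun k => H (id k) e) = F.G (e, c) := funext fun k => (congrFun (hGH k) (e, c)).symm
  rw [h1, h2]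

theorem D0.exists_snocS (P : E × M.Str → Prop) [hP : D0 M P] [Nonempty M.Str] :
    ∃ (F : Frame M E) (A : Fml F.n (F.m + 1)), IsSigB0 A ∧
      ∀ e C, A.Realize M (F.g e) (Fin.snoc (F.G e) C) ↔ P (e, C) := by
  obtain ⟨F, A, hA, h⟩ := hP
  choose H hH hGH using F.hg
  have hr : ∀ i, ∃ h ∈ Ctx.str (M := M) (E := E), (∀ x, F.G x i = x.2) ∨ ∀ x, F.G x i = h x.1 := by
    intro i
    rcases F.hG i with hi | ⟨h, hh, hi⟩
    · exact ⟨_, Ctx.const_str (Classical.arbitrary _), .inl fun x => congrFun hi x⟩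
    · exact ⟨h, hh, .inr fun x => congrFun hi x⟩
  choose g hg hgg using hr
  classical
  refine ⟨⟨F.n, F.m, fun e i => H i e, fun e j => g j e, hH, hg⟩,
    A.subst (fun k => .var (id k))
      (fun k => .var (if ∀ x, F.G x k = x.2 then Fin.last _ else k.castSucc)),
    hA.subst _ _, fun e c => ?_⟩
  rw [realize_rename, ← h]
  have h1 : (fun k => (Fin.snoc (fun i => g i e) c : Fin (F.m + 1) → M.Str)
      (if ∀ x, F.G x k = x.2 then Fin.last _ else k.castSucc)) = F.G (e, c) := by
    funext k
    split_ifs with hk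
    · simp [hk]
    · simp [((hgg k).resolve_left hk)]
  have h2 : (fun k => H (id k) e) = F.g (e, c) := funext fun k => (congrFun (hGH k) (e, c)).symm
  rw [h1, h2]

/-- Quantifiers over numbers bounded by a term. -/
theorem D0.quantifier (Q : {n m : ℕ} → Tm n m → Fml (n + 1) m → Fml n m)
    {q : M.Num → (M.Num → Prop) → Prop}
    (h0 : ∀ {n m : ℕ} (t : Tm n m) {A : Fml (n + 1) m}, IsSigB0 A → IsSigB0 (Q t A))
    (hQ : ∀ {n m : ℕ} (t : Tm n m) (A : Fml (n + 1) m) (a : Fin n → M.Num) (C : Fin m → M.Str),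
      (Q t A).Realize M a C ↔ q (t.val M a C) (fun c => A.Realize M (Fin.snoc a c) C))
    (f : E → M.Num) (P : E → M.Num → Prop) [hf : T0 f]
    [hP : D0 M (fun e : E × M.Num => P e.1 e.2)] :
    D0 M (fun e => q (f e) (P e)) := by
  obtain ⟨F, t, ht⟩ := hf
  obtain ⟨F', A, hA, h⟩ := D0.exists_snoc (M := M) (fun e : E × M.Num => P e.1 e.2)
  let ρ : Fin (F'.n + 1) → Fin ((F.append F').n + 1) :=
    Fin.snoc (fun k => (F.inrN F' k).castSucc) (Fin.last _)
  let B := A.subst (fun k => .var (ρ k)) (fun k => .var (F.inrS F' k))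
  have hB : ∀ e, (fun c => B.Realize M (Fin.snoc ((F.append F').g e) c) ((F.append F').G e)) =
      P e := by
    intro e
    funext c
    refine propext ((realize_rename A ρ _).trans ?_)
    have h1 : (fun k => (Fin.snoc ((F.append F').g e) c : Fin ((F.append F').n + 1) → M.Num)
        (ρ k)) = Fin.snoc (F'.g e) c := by
      funext k
      refine Fin.lastCases ?_ (fun k => ?_) k
      · simp [ρ]
      · simpa [ρ] using congrFun (F.append_g_inr F' e) k
    rw [h1, F.append_G_inr]
    exact h e c
  refine ⟨F.append F', Q (F.tmL F' t) B, h0 _ (hA.subst _ _), fun e => ?_⟩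
  rw [hQ, val_tmL, ht, hB]

instance D0.allLe (f : E → M.Num) (P : E → M.Num → Prop) [T0 f]
    [D0 M (fun e : E × M.Num => P e.1 e.2)] : D0 M (fun e => ∀ c ≤ f e, P e c) :=
  D0.quantifier (fun {_ _} => TwoSorted.allLe) (q := fun b R => ∀ c ≤ b, R c)
    (fun t _ hA => .allLe t hA)
    (fun _ _ _ _ => realize_allLe ..) f P

instance D0.allLt (f : E → M.Num) (P : E → M.Num → Prop) [T0 f]
    [D0 M (fun e : E × M.Num => P e.1 e.2)] : D0 M (fun e => ∀ c < f e, P e c) :=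
  D0.quantifier (fun {_ _} => TwoSorted.allLt) (q := fun b R => ∀ c < b, R c)
    (fun t _ hA => .allLt t hA)
    (fun _ _ _ _ => realize_allLt ..) f P

instance D0.exLe (f : E → M.Num) (P : E → M.Num → Prop) [T0 f]
    [D0 M (fun e : E × M.Num => P e.1 e.2)] : D0 M (fun e => ∃ c ≤ f e, P e c) :=
  D0.quantifier (fun {_ _} => TwoSorted.exLe) (q := fun b R => ∃ c ≤ b, R c)
    (fun t _ hA => .exLe t hA)
    (fun _ _ _ _ => realize_exLe ..) f P

instance D0.exLt (f : E → M.Num) (P : E → M.Num → Prop) [T0 f]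
    [D0 M (fun e : E × M.Num => P e.1 e.2)] : D0 M (fun e => ∃ c < f e, P e c) :=
  D0.quantifier (fun {_ _} => TwoSorted.exLt) (q := fun b R => ∃ c < b, R c)
    (fun t _ hA => .exLt t hA)
    (fun _ _ _ _ => realize_exLt ..) f P

end V1

/-! ### Variables -/

variable (M) in
/-- The coordinates of `E` are coordinates of `E × B`. -/
class Ext (E B : Type*) [Ctx M E] [Ctx M (E × B)] : Prop where
  num : ∀ f ∈ Ctx.num (M := M) (E := E), (fun e : E × B => f e.1) ∈ Ctx.num (M := M) (E := E × B)
  str : ∀ f ∈ Ctx.str (M := M) (E := E), (fun e : E × B => f e.1) ∈ Ctx.str (M := M) (E := E × B)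

instance : Ext M E M.Num := ⟨fun f hf => .inr ⟨f, hf, rfl⟩, fun f hf => ⟨f, hf, rfl⟩⟩

instance : Ext M E M.Str := ⟨fun f hf => ⟨f, hf, rfl⟩, fun f hf => .inr ⟨f, hf, rfl⟩⟩

/-- Weakening is applied by hand where needed; only its special cases for the coordinates of the
tuple are declared as instances below. -/
theorem T0.weaken (B : Type*) [Ctx M (E × B)] [Ext M E B] (f : E → M.Num) [hf : T0 f] :
    T0 (fun e : E × B => f e.1) := by
  obtain ⟨F, t, ht⟩ := hf
  exact ⟨⟨F.n, F.m, fun e => F.g e.1, fun e => F.G e.1, fun i => Ext.num _ (F.hg i),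
    fun i => Ext.str _ (F.hG i)⟩, t, fun e => ht e.1⟩

theorem S0.weaken (B : Type*) [Ctx M (E × B)] [Ext M E B] (f : E → M.Str) [hf : S0 f] :
    S0 (fun e : E × B => f e.1) := ⟨Ext.str _ hf.out⟩

instance T0.snd : T0 (fun e : E × M.Num => e.2) := .of_num (Or.inl rfl)

instance S0.snd : S0 (fun e : E × M.Str => e.2) := ⟨Or.inl rfl⟩

instance T0.fst1_snd {B : Type*} [Ctx M ((E × M.Num) × B)] [Ext M (E × M.Num) B] :
    T0 (fun e : (E × M.Num) × B => e.1.2) :=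
  T0.weaken B fun e : E × M.Num => e.2

instance S0.fst1_snd {B : Type*} [Ctx M ((E × M.Str) × B)] [Ext M (E × M.Str) B] :
    S0 (fun e : (E × M.Str) × B => e.1.2) :=
  S0.weaken B fun e : E × M.Str => e.2

instance T0.fst2_snd {B C : Type*} [Ctx M ((E × M.Num) × B)] [Ext M (E × M.Num) B]
    [Ctx M (((E × M.Num) × B) × C)] [Ext M ((E × M.Num) × B) C] :
    T0 (fun e : ((E × M.Num) × B) × C => e.1.1.2) :=
  T0.weaken C fun e : (E × M.Num) × B => e.1.2

instance S0.fst2_snd {B C : Type*} [Ctx M ((E × M.Str) × B)] [Ext M (E × M.Str) B]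
    [Ctx M (((E × M.Str) × B) × C)] [Ext M ((E × M.Str) × B) C] :
    S0 (fun e : ((E × M.Str) × B) × C => e.1.1.2) :=
  S0.weaken C fun e : (E × M.Str) × B => e.1.2

instance T0.fst3_snd {B C D : Type*} [Ctx M ((E × M.Num) × B)] [Ext M (E × M.Num) B]
    [Ctx M (((E × M.Num) × B) × C)] [Ext M ((E × M.Num) × B) C]
    [Ctx M ((((E × M.Num) × B) × C) × D)] [Ext M (((E × M.Num) × B) × C) D] :
    T0 (fun e : (((E × M.Num) × B) × C) × D => e.1.1.1.2) :=
  T0.weaken D fun e : ((E × M.Num) × B) × C => e.1.1.2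

instance S0.fst3_snd {B C D : Type*} [Ctx M ((E × M.Str) × B)] [Ext M (E × M.Str) B]
    [Ctx M (((E × M.Str) × B) × C)] [Ext M ((E × M.Str) × B) C]
    [Ctx M ((((E × M.Str) × B) × C) × D)] [Ext M (((E × M.Str) × B) × C) D] :
    S0 (fun e : (((E × M.Str) × B) × C) × D => e.1.1.1.2) :=
  S0.weaken D fun e : ((E × M.Str) × B) × C => e.1.1.2

instance T0.fst4_snd {B C D F : Type*} [Ctx M ((E × M.Num) × B)] [Ext M (E × M.Num) B]
    [Ctx M (((E × M.Num) × B) × C)] [Ext M ((E × M.Num) × B) C]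
    [Ctx M ((((E × M.Num) × B) × C) × D)] [Ext M (((E × M.Num) × B) × C) D]
    [Ctx M (((((E × M.Num) × B) × C) × D) × F)] [Ext M ((((E × M.Num) × B) × C) × D) F] :
    T0 (fun e : ((((E × M.Num) × B) × C) × D) × F => e.1.1.1.1.2) :=
  T0.weaken F fun e : (((E × M.Num) × B) × C) × D => e.1.1.1.2

end Definability

/-! ## Comprehension and induction -/

section Comprehension

variable {M : Struct.{u, v}} {E : Type*} [Ctx M E]

/-- A frame over `E × M.Num` is a renaming of a frame over `E` together with the new number. -/
theorem Frame.split (F : Frame M (E × M.Num)) :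
    ∃ (F' : Frame M E) (ρ : Fin F.n → Fin (F'.n + 1)) (π : Fin F.m → Fin F'.m), ∀ e c,
      (fun k => (Fin.snoc (F'.g e) c : Fin (F'.n + 1) → M.Num) (ρ k)) = F.g (e, c) ∧
      (fun k => F'.G e (π k)) = F.G (e, c) := by
  choose H hH hGH using F.hG
  have hr : ∀ i, ∃ h ∈ Ctx.num (M := M) (E := E), (∀ x, F.g x i = x.2) ∨ ∀ x, F.g x i = h x.1 := by
    intro i
    rcases F.hg i with hi | ⟨h, hh, hi⟩
    · exact ⟨_, Ctx.const_num 0, .inl fun x => congrFun hi x⟩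
    · exact ⟨h, hh, .inr fun x => congrFun hi x⟩
  choose g hg hgg using hr
  classical
  refine ⟨⟨F.n, F.m, fun e i => g i e, fun e j => H j e, hg, hH⟩,
    fun k => if ∀ x, F.g x k = x.2 then Fin.last _ else k.castSucc, id, fun e c => ⟨?_, ?_⟩⟩
  · funext k
    dsimp only
    split_ifs with hk
    · simp [hk]
    · simp [((hgg k).resolve_left hk)]
  · exact funext fun k => (congrFun (hGH k) (e, c)).symm

/-- The same formula serves, provided every coordinate, composed with the map of tuples, is again a
coordinate or a constant. -/
theorem D0.reindex {E' : Type*} [Ctx M E'] (P : E → Prop) [hP : D0 M P] (φ : E' → E)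
    (hN : ∀ f ∈ Ctx.num (M := M) (E := E), (fun e => f (φ e)) ∈ Ctx.num (M := M) (E := E'))
    (hS : ∀ f ∈ Ctx.str (M := M) (E := E), (fun e => f (φ e)) ∈ Ctx.str (M := M) (E := E')) :
    D0 M (fun e => P (φ e)) := by
  obtain ⟨F, A, hA, h⟩ := hP
  exact ⟨⟨F.n, F.m, fun e => F.g (φ e), fun e => F.G (φ e), fun i => hN _ (F.hg i),
    fun i => hS _ (F.hG i)⟩, A, hA, fun e => h _⟩

variable [V1Model M]

theorem comp_realize {k l : ℕ} (A : Fml (k + 2) l) (hA : IsSigB1 A) (a : Fin k → M.Num)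
    (C : Fin l → M.Str) (b : M.Num) :
    ∃ Y : M.Str, M.len Y ≤ b ∧
      ∀ i < b, i ∈ Y ↔ A.Realize M (Fin.snoc (Fin.snoc a b : Fin (k + 1) → M.Num) i) C := by
  have := V1Model.valid (M := M) _ _ _ (V1.comp A hA) (Fin.snoc a b) C
  simp only [realize_exSLe, realize_allLt, realize_iff, val_nv, realize_mem, snoc_mk, sv] at this
  simp only [lt_self_iff_false, dite_false] at this
  obtain ⟨Y, hY, h⟩ := this
  refine ⟨Y, hY, fun i hi => (h i hi).trans ?_⟩
  refine (realize_rename A id Fin.castSucc).trans ?_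
  simp

instance : Nonempty M.Str :=
  let ⟨Y, _⟩ := comp_realize (M := M) (k := 0) (l := 0) (.eq .zero .zero) (.base (.eq _ _))
    Fin.elim0 Fin.elim0 0
  ⟨Y⟩

/-- Comprehension for `Σᴮ₀` predicates. -/
theorem comp (P : M.Num → Prop) [hP : D0 M (fun e : Unit × M.Num => P e.2)] (b : M.Num) :
    ∃ Y : M.Str, M.len Y ≤ b ∧ ∀ i < b, i ∈ Y ↔ P i := by
  obtain ⟨F, A, hA, h⟩ := D0.exists_snoc (M := M) (fun e : Unit × M.Num => P e.2)
  -- The comprehension axiom places its bound between the parameters and the element variable; the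
  -- renaming skips that position.
  let ρ : Fin (F.n + 1) → Fin (F.n + 2) :=
    Fin.snoc (fun k => k.castSucc.castSucc) (Fin.last _)
  obtain ⟨Y, hY, hYi⟩ := comp_realize (M := M) (A.subst (fun k => .var (ρ k)) fun k => .var (id k))
    (.base (hA.subst _ _)) (F.g ()) (F.G ()) b
  refine ⟨Y, hY, fun i hi => (hYi i hi).trans ?_⟩
  rw [realize_rename, ← h () i]
  have : (fun k => (Fin.snoc (Fin.snoc (F.g ()) b : Fin (F.n + 1) → M.Num) i :
      Fin (F.n + 2) → M.Num) (ρ k)) = Fin.snoc (F.g ()) i := by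
    funext k
    refine Fin.lastCases ?_ (fun k => ?_) k <;> simp [ρ]
  rw [this]
  rfl

/-- Comprehension for `Σᴮ₁` predicates. -/
theorem comp_ex (Q : M.Num → M.Str → Prop)
    [hQ : D0 M (fun e : (Unit × M.Num) × M.Str => Q e.1.2 e.2)] (t b : M.Num) :
    ∃ Y : M.Str, M.len Y ≤ b ∧ ∀ i < b, i ∈ Y ↔ ∃ Z, M.len Z ≤ t ∧ Q i Z := by
  obtain ⟨F, A, hA, h⟩ := D0.exists_snocS (M := M)
    (fun e : (Unit × M.Num) × M.Str => Q e.1.2 e.2)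
  obtain ⟨F', ρ, π, hF⟩ := F.split
  -- Two positions are skipped: `t`, added as a parameter so that the string quantifier is bounded
  -- by a variable, and the comprehension bound `b`.
  let ρ' : Fin (F'.n + 1) → Fin (F'.n + 1 + 2) :=
    Fin.snoc (fun k => k.castSucc.castSucc.castSucc) (Fin.last _)
  let π' : Fin (F.m + 1) → Fin (F'.m + 1) := Fin.snoc (fun k => (π k).castSucc) (Fin.last _)
  obtain ⟨Y, hY, hYi⟩ := comp_realize (M := M) (k := F'.n + 1) (l := F'.m)
    (exSLe (nv F'.n) (A.subst (fun k => .var (ρ' (ρ k))) fun k => .var (π' k)))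
    (.step (nv F'.n) (.base (hA.subst _ _))) (Fin.snoc (F'.g ()) t) (F'.G ()) b
  refine ⟨Y, hY, fun i hi => (hYi i hi).trans ?_⟩
  rw [realize_exSLe]
  refine exists_congr fun Z => and_congr ?_ ?_
  · rw [val_nv]
    simp [snoc_mk]
  · refine (realize_rename A (fun k => ρ' (ρ k)) π').trans ?_
    rw [← h ((), i) Z, ← (hF () i).1, ← (hF () i).2]
    refine iff_of_eq (congrArg₂ _ (funext fun k => ?_) (funext fun k => ?_))
    · refine Fin.lastCases ?_ (fun k => ?_) (ρ k) <;> simp [ρ']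
    · refine Fin.lastCases ?_ (fun k => ?_) k <;> simp [π']

/-! ### Induction and the ordered semiring of numbers -/

theorem ax_le_refl (x : M.Num) : x ≤ x := by
  simpa only [ax_b3] using ax_b8 x 0

theorem le_of_succ_le' {x y : M.Num} (h : x + 1 ≤ y) : x ≤ y := by
  rcases ax_b10 x y with h' | h'
  · exact h'
  · have := ax_b11.1 h'
    exact absurd (ax_b7 this.1 h) this.2

/-- Substitution of a term in a unary predicate. -/
theorem D0.comp₁ (P : M.Num → Prop) [D0 M (fun e : Unit × M.Num => P e.2)] (f : E → M.Num)
    [T0 f] : D0 M (fun e => P (f e)) := by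
  have : D0 M (fun e : E × M.Num => P e.2) := by
    refine D0.reindex (fun e : Unit × M.Num => P e.2) (fun e : E × M.Num => ((), e.2)) ?_ ?_
    · rintro _ (rfl | ⟨h, -, rfl⟩)
      · exact .inl rfl
      · exact Ctx.const_num (h ())
    · rintro _ ⟨h, -, rfl⟩
      exact Ctx.const_str (h ())
  have := T0.weaken M.Num f
  -- A term is substituted by means of a bounded quantifier, which instance search already handles.
  have h : (fun e => P (f e)) = fun e => ∃ c ≤ f e, c = f e ∧ P c := funext fun e =>
    propext ⟨fun h => ⟨f e, ax_le_refl _, rfl, h⟩, by rintro ⟨_, _, rfl, h⟩; exact h⟩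
  rw [h]
  infer_instance

/-- Substitution of terms in a ternary predicate. -/
theorem D0.comp₃ (P : M.Num → M.Num → M.Num → Prop)
    [D0 M (fun e : ((Unit × M.Num) × M.Num) × M.Num => P e.1.1.2 e.1.2 e.2)] (f g h : E → M.Num)
    [T0 f] [T0 g] [T0 h] :
    D0 M (fun e => P (f e) (g e) (h e)) := by
  have : D0 M (fun e : ((E × M.Num) × M.Num) × M.Num => P e.1.1.2 e.1.2 e.2) := by
    refine D0.reindex (fun e : ((Unit × M.Num) × M.Num) × M.Num => P e.1.1.2 e.1.2 e.2)
      (fun e : ((E × M.Num) × M.Num) × M.Num => ((((), e.1.1.2), e.1.2), e.2)) ?_ ?_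
    · rintro _ (rfl | ⟨_, rfl | ⟨_, rfl | ⟨h, -, rfl⟩, rfl⟩, rfl⟩)
      · exact .inl rfl
      · exact .inr ⟨_, .inl rfl, rfl⟩
      · exact .inr ⟨_, .inr ⟨_, .inl rfl, rfl⟩, rfl⟩
      · exact Ctx.const_num (h ())
    · rintro _ ⟨_, ⟨_, ⟨h, -, rfl⟩, rfl⟩, rfl⟩
      exact Ctx.const_str (h ())
  have := T0.weaken M.Num f
  have := T0.weaken M.Num g
  have := T0.weaken M.Num h
  have := T0.weaken M.Num fun e : E × M.Num => g e.1
  have := T0.weaken M.Num fun e : E × M.Num => h e.1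
  have := T0.weaken M.Num fun e : (E × M.Num) × M.Num => h e.1.1
  have h : (fun e => P (f e) (g e) (h e)) = fun e =>
      ∃ a ≤ f e, a = f e ∧ ∃ b ≤ g e, b = g e ∧ ∃ c ≤ h e, c = h e ∧ P a b c := funext fun e =>
    propext ⟨fun h => ⟨_, ax_le_refl _, rfl, _, ax_le_refl _, rfl, _, ax_le_refl _, rfl, h⟩,
      by rintro ⟨_, _, rfl, _, _, rfl, _, _, rfl, h⟩; exact h⟩
  rw [h]
  infer_instance

/-- Induction for `Σᴮ₀` predicates. -/
theorem ind (P : M.Num → Prop) [D0 M (fun e : Unit × M.Num => P e.2)] (h0 : P 0)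
    (h1 : ∀ n, P n → P (n + 1)) (n : M.Num) : P n := by
  by_contra hn
  have := D0.comp₁ P (fun e : (Unit × M.Num) × M.Num => e.2)
  -- `Y` is an initial segment of the numbers up to `n`, and it contains 0. Its length is `z + 1`
  -- with `z ∈ Y` by L2. Then `P` holds up to `z + 1`, so either `z = n`, which contradicts the
  -- failure at `n`, or `z + 1` is an element of `Y` not below its length, which contradicts L1.
  obtain ⟨Y, hY, h⟩ := comp (M := M) (fun i => ∀ j ≤ i, P j) (n + 1)
  have hY0 : (0 : M.Num) ∈ Y := by
    refine (h 0 ⟨ax_b9 _, (ax_b1 n).symm⟩).2 fun j hj => ?_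
    rwa [ax_b7 hj (ax_b9 j)]
  have hne : M.len Y ≠ 0 := fun h0 => by
    have := ax_l1 hY0
    rw [h0] at this
    exact this.2 rfl
  obtain ⟨z, -, hz⟩ := ax_b12 hne
  have hzY : z ∈ Y := ax_l2 hz
  have hzn : z ≤ n := by
    by_cases hzn : z = n
    · rw [hzn]; exact ax_le_refl n
    · exact le_of_succ_le' (ax_b11.2 ⟨hz ▸ hY, fun h => hzn (ax_b2 h)⟩)
  have hP := (h z (ax_b11.1 hzn)).1 hzY
  have hP' : ∀ j ≤ z + 1, P j := by
    intro j hj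
    by_cases hj' : j = z + 1
    · rw [hj']
      exact h1 z (hP z (ax_le_refl z))
    · exact hP j (ax_b11.2 ⟨hj, hj'⟩)
  by_cases hzn' : z = n
  · exact hn (hP n (hzn' ▸ ax_le_refl _))
  · have hlt : z + 1 < n + 1 := ⟨hz ▸ hY, fun h => hzn' (ax_b2 h)⟩
    have := ax_l1 ((h (z + 1) hlt).2 hP')
    exact this.2 hz

theorem num_zero_add (x : M.Num) : 0 + x = x := by
  refine ind (fun x : M.Num => 0 + x = x) (ax_b3 0) (fun x hx => ?_) x
  rw [ax_b4, hx]

theorem num_add_assoc (x y z : M.Num) : x + y + z = x + (y + z) := by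
  refine ind (fun z : M.Num => x + y + z = x + (y + z)) ?_ (fun z hz => ?_) z
  · rw [ax_b3, ax_b3]
  · rw [ax_b4, ax_b4, ax_b4, hz]

theorem num_succ_add (x y : M.Num) : x + 1 + y = x + y + 1 := by
  refine ind (fun y : M.Num => x + 1 + y = x + y + 1) ?_ (fun y hy => ?_) y
  · rw [ax_b3, ax_b3]
  · rw [ax_b4, ax_b4, hy]

theorem num_add_comm (x y : M.Num) : x + y = y + x := by
  refine ind (fun y : M.Num => x + y = y + x) ?_ (fun y hy => ?_) y
  · rw [ax_b3, num_zero_add]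
  · rw [ax_b4, num_succ_add, hy]

theorem num_zero_mul (x : M.Num) : 0 * x = 0 := by
  refine ind (fun x : M.Num => 0 * x = 0) (ax_b5 0) (fun x hx => ?_) x
  rw [ax_b6, hx, ax_b3]

theorem num_succ_mul (x y : M.Num) : (x + 1) * y = x * y + y := by
  refine ind (fun y : M.Num => (x + 1) * y = x * y + y) ?_ (fun y hy => ?_) y
  · rw [ax_b5, ax_b5, ax_b3]
  · rw [ax_b6, ax_b6, hy, num_add_assoc, num_add_assoc]
    congr 1
    rw [ax_b4, ax_b4, num_add_comm x y]

theorem num_mul_comm (x y : M.Num) : x * y = y * x := by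
  refine ind (fun y : M.Num => x * y = y * x) ?_ (fun y hy => ?_) y
  · rw [ax_b5, num_zero_mul]
  · rw [ax_b6, num_succ_mul, hy]

theorem num_mul_add (x y z : M.Num) : x * (y + z) = x * y + x * z := by
  refine ind (fun z : M.Num => x * (y + z) = x * y + x * z) ?_ (fun z hz => ?_) z
  · rw [ax_b5, ax_b3, ax_b3]
  · rw [ax_b4, ax_b6, ax_b6, hz, num_add_assoc]

theorem num_mul_assoc (x y z : M.Num) : x * y * z = x * (y * z) := by
  refine ind (fun z : M.Num => x * y * z = x * (y * z)) ?_ (fun z hz => ?_) z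
  · rw [ax_b5, ax_b5, ax_b5]
  · rw [ax_b6, ax_b6, hz, num_mul_add]

theorem num_mul_one (x : M.Num) : x * 1 = x := by
  rw [← num_zero_add (1 : M.Num), ax_b6, ax_b5, num_zero_add]

instance : CommSemiring M.Num where
  add_assoc := num_add_assoc
  zero_add := num_zero_add
  add_zero := ax_b3
  add_comm := num_add_comm
  nsmul := nsmulRec
  left_distrib := num_mul_add
  right_distrib x y z := by
    rw [num_mul_comm, num_mul_add, num_mul_comm z x, num_mul_comm z y]
  zero_mul := num_zero_mul
  mul_zero := ax_b5
  mul_assoc := num_mul_assoc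
  one_mul x := by rw [num_mul_comm, num_mul_one]
  mul_one := num_mul_one
  mul_comm := num_mul_comm

theorem num_add_right_cancel {x y z : M.Num} : x + z = y + z → x = y := by
  refine ind (fun z : M.Num => x + z = y + z → x = y) ?_ (fun z hz h => ?_) z
  · simp
  · rw [ax_b4, ax_b4] at h
    exact hz (ax_b2 h)

theorem num_exists_add {x y : M.Num} (h : x ≤ y) : ∃ z, y = x + z := by
  -- The difference is bounded by `y`, so the induction predicate is Σᴮ₀.
  have : ∀ y : M.Num, x ≤ y → ∃ z ≤ y, y = x + z := by
    refine ind (fun y : M.Num => x ≤ y → ∃ z ≤ y, y = x + z) ?_ (fun y ih h => ?_)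
    · intro h
      exact ⟨0, ax_le_refl 0, by rw [ax_b7 h (ax_b9 x), add_zero]⟩
    · by_cases hx : x = y + 1
      · exact ⟨0, ax_b9 _, by rw [hx, add_zero]⟩
      · obtain ⟨z, -, hz⟩ := ih (ax_b11.2 ⟨h, hx⟩)
        refine ⟨z + 1, ?_, by rw [ax_b4, ← hz]⟩
        rw [hz, add_assoc, add_comm x]
        exact ax_b8 _ _
  obtain ⟨z, -, hz⟩ := this y h
  exact ⟨z, hz⟩

theorem num_le_trans {x y z : M.Num} (h : x ≤ y) (h' : y ≤ z) : x ≤ z := by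
  obtain ⟨c, rfl⟩ := num_exists_add h
  obtain ⟨d, rfl⟩ := num_exists_add h'
  rw [add_assoc]
  exact ax_b8 _ _

noncomputable instance : LinearOrder M.Num where
  le_refl := ax_le_refl
  le_trans _ _ _ := num_le_trans
  le_antisymm _ _ := ax_b7
  lt_iff_le_not_ge a b :=
    ⟨fun h => ⟨h.1, fun h' => h.2 (ax_b7 h.1 h')⟩, fun h => ⟨h.1, fun e => h.2 (e ▸ ax_le_refl a)⟩⟩
  le_total := ax_b10
  toDecidableLE := Classical.decRel _

theorem num_lt_succ {x y : M.Num} : x < y + 1 ↔ x ≤ y := ax_b11.symm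

theorem num_succ_le {x y : M.Num} : x + 1 ≤ y ↔ x < y := by
  rw [← not_lt, num_lt_succ, not_le]

instance : IsOrderedCancelAddMonoid M.Num where
  add_le_add_left a b h c := by
    obtain ⟨d, rfl⟩ := num_exists_add h
    rw [add_right_comm]
    exact ax_b8 _ _
  le_of_add_le_add_left a b c h := by
    obtain ⟨d, hd⟩ := num_exists_add h
    rw [add_assoc, add_comm a, add_comm a] at hd
    rw [num_add_right_cancel hd]
    exact ax_b8 _ _

instance : CanonicallyOrderedAdd M.Num where
  exists_add_of_le h := num_exists_add h
  le_add_self a b := by rw [add_comm]; exact ax_b8 _ _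
  le_self_add a b := ax_b8 _ _

instance : IsStrictOrderedRing M.Num := by
  have h01 : (0 : M.Num) ≠ 1 := fun h => ax_b1 (0 : M.Num) (by rw [← h, add_zero])
  have key : ∀ a b c : M.Num, a < b → 0 < c → a * c < b * c := by
    intro a b c h hc
    obtain ⟨d, rfl⟩ := num_exists_add (num_succ_le.2 h)
    obtain ⟨c, -, rfl⟩ := ax_b12 hc.ne'
    rw [add_assoc, add_mul]
    refine lt_add_of_pos_right _ (num_succ_le.1 ?_)
    rw [add_mul, one_mul, zero_add, add_comm c, add_assoc]
    exact ax_b8 _ _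
  exact
    { exists_pair_ne := ⟨0, 1, h01⟩
      zero_le_one := ax_b9 1
      mul_lt_mul_of_pos_left := fun a ha b c h => by
        simpa only [mul_comm a] using key _ _ _ h ha
      mul_lt_mul_of_pos_right := fun a ha b c h => key _ _ _ h ha }

theorem num_cases (x : M.Num) : x = 0 ∨ ∃ y, x = y + 1 := by
  by_cases h : x = 0
  · exact .inl h
  · obtain ⟨y, -, rfl⟩ := ax_b12 h
    exact .inr ⟨y, rfl⟩

/-- Complete induction for `Σᴮ₀` predicates, as a least number principle. -/
theorem exists_least (P : M.Num → Prop) [D0 M (fun e : Unit × M.Num => P e.2)] {n : M.Num}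
    (hn : P n) : ∃ k, P k ∧ ∀ j < k, ¬ P j := by
  by_contra! h
  have := D0.comp₁ P (fun e : (Unit × M.Num) × M.Num => e.2)
  have : ∀ n : M.Num, ∀ j ≤ n, ¬ P j := by
    refine ind (fun n : M.Num => ∀ j ≤ n, ¬ P j) ?_ fun n ih j hj hP => ?_
    · intro j hj hP
      obtain ⟨i, hi, -⟩ := h j hP
      exact absurd (hi.trans_le hj) (not_lt.2 (ax_b9 i))
    · obtain ⟨i, hi, hPi⟩ := h j hP
      exact ih i (num_lt_succ.1 (hi.trans_le hj)) hPi
  exact this n n le_rfl hn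

/-- The least number principle for `Σᴮ₁` predicates. -/
theorem exists_least_ex (Q : M.Num → M.Str → Prop)
    [D0 M (fun e : (Unit × M.Num) × M.Str => Q e.1.2 e.2)] (t : M.Num) {n : M.Num}
    (hn : ∃ Z, M.len Z ≤ t ∧ Q n Z) :
    ∃ k ≤ n, (∃ Z, M.len Z ≤ t ∧ Q k Z) ∧ ∀ j < k, ¬ ∃ Z, M.len Z ≤ t ∧ Q j Z := by
  -- Once the numbers having a witness form a string, membership in it is Σᴮ₀ and the simpler least
  -- number principle applies.
  obtain ⟨Y, -, hY⟩ := comp_ex Q t (n + 1)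
  obtain ⟨k, hk, hk'⟩ := exists_least (fun i : M.Num => i ∈ Y) ((hY n (num_lt_succ.2 le_rfl)).2 hn)
  have hkn : k ≤ n := not_lt.1 fun h => hk' n h ((hY n (num_lt_succ.2 le_rfl)).2 hn)
  refine ⟨k, hkn, (hY k (num_lt_succ.2 hkn)).1 hk, fun j hj hQ => hk' j hj ?_⟩
  exact (hY j (num_lt_succ.2 (hj.le.trans hkn))).2 hQ

/-- Induction up to `b` for `Σᴮ₁` predicates. -/
theorem ind_ex (Q : M.Num → M.Str → Prop)
    [D0 M (fun e : (Unit × M.Num) × M.Str => Q e.1.2 e.2)] (t b : M.Num)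
    (h0 : ∃ Z, M.len Z ≤ t ∧ Q 0 Z)
    (h1 : ∀ n < b, ∀ Z, M.len Z ≤ t → Q n Z → ∃ Z', M.len Z' ≤ t ∧ Q (n + 1) Z') :
    ∃ Z, M.len Z ≤ t ∧ Q b Z := by
  -- The Σᴮ₁ predicate becomes membership in a string, so that Σᴮ₀ induction suffices.
  obtain ⟨Y, -, hY⟩ := comp_ex Q t (b + 1)
  have : ∀ n : M.Num, n ≤ b → n ∈ Y := by
    refine ind (fun n : M.Num => n ≤ b → n ∈ Y) ?_ fun n ih hn => ?_
    · intro h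
      exact (hY 0 (num_lt_succ.2 h)).2 h0
    · have hnb := num_succ_le.1 hn
      obtain ⟨Z, hZ, hQ⟩ := (hY n (num_lt_succ.2 hnb.le)).1 (ih hnb.le)
      exact (hY _ (num_lt_succ.2 hn)).2 (h1 n hnb Z hZ hQ)
  exact (hY b (num_lt_succ.2 le_rfl)).1 (this b le_rfl)

end Comprehension

/-! ## Pairing, rows and number sequences in a model of `V¹` -/

section Coding

variable {M : Struct.{u, v}} [V1Model M] {E : Type*} [Ctx M E]

/-- With its two companions below, it moves polynomial relations between numbers into an ordered
ring, where subtraction is available. -/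
theorem num_le_incl {a b : M.Num} : a ≤ b ↔ DiffRing.incl a ≤ DiffRing.incl b :=
  DiffRing.incl_le_incl.symm

theorem num_lt_incl {a b : M.Num} : a < b ↔ DiffRing.incl a < DiffRing.incl b :=
  DiffRing.incl_lt_incl.symm

theorem num_eq_incl {a b : M.Num} : a = b ↔ DiffRing.incl a = DiffRing.incl b :=
  DiffRing.incl_inj.symm

theorem incl_nonneg (a : M.Num) : 0 ≤ DiffRing.incl a := by
  rw [← map_zero DiffRing.incl, DiffRing.incl_le_incl]
  exact ax_b9 a

theorem num_nonneg (a : M.Num) : 0 ≤ a := ax_b9 a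

theorem num_pos_iff {a : M.Num} : 0 < a ↔ a ≠ 0 :=
  ⟨ne_of_gt, fun h => lt_of_le_of_ne (num_nonneg a) h.symm⟩

theorem le_npair_right (a b : M.Num) : b ≤ npair a b := by
  have ha := incl_nonneg a
  have hb := incl_nonneg b
  simp only [npair, num_le_incl, map_add, map_mul, map_one]
  nlinarith

theorem npair_le_npair {a b c d : M.Num} (h : a ≤ c) (h' : b ≤ d) : npair a b ≤ npair c d := by
  unfold npair
  gcongr

theorem npair_inj {a b c d : M.Num} : npair a b = npair c d ↔ a = c ∧ b = d := by
  refine ⟨fun h => ?_, by rintro ⟨rfl, rfl⟩; rfl⟩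
  -- With s = a + b, the pair is s(s + 1) + 2b, where 2b ≤ 2s is less than the gap 2(s + 1) to the
  -- next value of s(s + 1). So the sum of the coordinates can be recovered, and then b.
  have key : ∀ a b c d : M.Num, a + b < c + d → npair a b < npair c d := by
    intro a b c d h
    have ha := incl_nonneg a
    have hd := incl_nonneg d
    have hb := incl_nonneg b
    rw [← num_succ_le] at h
    simp only [npair, num_le_incl, num_lt_incl, map_add, map_mul, map_one] at h ⊢
    nlinarith
  have hs : a + b = c + d :=
    le_antisymm (not_lt.1 fun h' => (key _ _ _ _ h').ne' h)
      (not_lt.1 fun h' => (key _ _ _ _ h').ne h)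
  unfold npair at h
  rw [hs] at h
  simp only [num_eq_incl, map_add, map_mul, map_one] at h hs ⊢
  constructor <;> linarith

/-- By L1 and L2 the length is one more than the largest element, so the elements determine it and
SE needs no separate hypothesis on lengths. -/
theorem str_ext {X Y : M.Str} (h : ∀ i, i ∈ X ↔ i ∈ Y) : X = Y := by
  have key : ∀ X Y : M.Str, (∀ i, i ∈ X ↔ i ∈ Y) → M.len X ≤ M.len Y := by
    intro X Y h
    rcases num_cases (M.len X) with h0 | ⟨z, hz⟩
    · rw [h0]; exact num_nonneg _
    · rw [hz, num_succ_le]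
      exact ax_l1 ((h z).1 (ax_l2 hz.symm))
  exact ax_se (le_antisymm (key _ _ h) (key _ _ fun i => (h i).symm)) fun i _ => h i

theorem len_le_of {X : M.Str} {b : M.Num} (h : ∀ i ∈ X, i < b) : M.len X ≤ b := by
  rcases num_cases (M.len X) with h0 | ⟨z, hz⟩
  · rw [h0]; exact num_nonneg _
  · rw [hz, num_succ_le]
    exact h z (ax_l2 hz.symm)

/-- Comprehension, without bits beyond the bound. -/
theorem comp' (P : M.Num → Prop) [hP : D0 M (fun e : Unit × M.Num => P e.2)] (b : M.Num) :
    ∃ Y : M.Str, M.len Y ≤ b ∧ ∀ i, i ∈ Y ↔ i < b ∧ P i := by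
  obtain ⟨Y, hY, h⟩ := comp P b
  exact ⟨Y, hY, fun i => ⟨fun hi => have hb := (ax_l1 hi).trans_le hY; ⟨hb, (h i hb).1 hi⟩,
    fun hi => (h i hi.1).2 hi.2⟩⟩

/-- Substitution of terms in a binary predicate. -/
theorem D0.comp₂ (P : M.Num → M.Num → Prop)
    [D0 M (fun e : (Unit × M.Num) × M.Num => P e.1.2 e.2)] (f g : E → M.Num) [T0 f] [T0 g] :
    D0 M (fun e => P (f e) (g e)) := by
  have : D0 M (fun e : (E × M.Num) × M.Num => P e.1.2 e.2) := by
    refine D0.reindex (fun e : (Unit × M.Num) × M.Num => P e.1.2 e.2)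
      (fun e : (E × M.Num) × M.Num => (((), e.1.2), e.2)) ?_ ?_
    · rintro _ (rfl | ⟨_, rfl | ⟨h, -, rfl⟩, rfl⟩)
      · exact .inl rfl
      · exact .inr ⟨_, .inl rfl, rfl⟩
      · exact Ctx.const_num (h ())
    · rintro _ ⟨_, ⟨h, -, rfl⟩, rfl⟩
      exact Ctx.const_str (h ())
  have := T0.weaken M.Num f
  have := T0.weaken M.Num g
  have := T0.weaken M.Num fun e : E × M.Num => g e.1
  have h : (fun e => P (f e) (g e)) = fun e =>
      ∃ a ≤ f e, a = f e ∧ ∃ b ≤ g e, b = g e ∧ P a b := funext fun e =>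
    propext ⟨fun h => ⟨_, le_rfl, rfl, _, le_rfl, rfl, h⟩,
      by rintro ⟨_, _, rfl, _, _, rfl, h⟩; exact h⟩
  rw [h]
  infer_instance

/-- Comprehension for binary relations. -/
theorem comp_pair (R : M.Num → M.Num → Prop)
    [D0 M (fun e : (Unit × M.Num) × M.Num => R e.1.2 e.2)] (J K : M.Num) :
    ∃ W : M.Str, M.len W ≤ npair J K + 1 ∧
      ∀ j a, npair j a ∈ W ↔ j ≤ J ∧ a ≤ K ∧ R j a := by
  have := D0.comp₂ R (fun e : ((Unit × M.Num) × M.Num) × M.Num => e.1.2) (fun e => e.2)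
  obtain ⟨W, hW, h⟩ := comp' (M := M) (fun i => ∃ j ≤ J, ∃ a ≤ K, i = npair j a ∧ R j a)
    (npair J K + 1)
  refine ⟨W, hW, fun j a => (h _).trans ⟨?_, ?_⟩⟩
  · rintro ⟨-, j', hj, a', ha, he, hR⟩
    obtain ⟨rfl, rfl⟩ := npair_inj.1 he
    exact ⟨hj, ha, hR⟩
  · rintro ⟨hj, ha, hR⟩
    exact ⟨num_lt_succ.2 (npair_le_npair hj ha), j, hj, a, ha, rfl, hR⟩

/-! ### Rows -/

def RowMem (Z : M.Str) (j i : M.Num) : Prop := i < M.len Z ∧ npair j i ∈ Z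

/-- The guard is automatic: i ≤ ⟨j, i⟩, and elements of `Z` lie below its length. -/
theorem rowMem_iff {Z : M.Str} {j i : M.Num} : RowMem Z j i ↔ npair j i ∈ Z :=
  ⟨fun h => h.2, fun h => ⟨(le_npair_right j i).trans_lt (ax_l1 h), h⟩⟩

theorem exists_row (Z : M.Str) (j : M.Num) : ∃ Y : M.Str, ∀ i, i ∈ Y ↔ npair j i ∈ Z := by
  obtain ⟨Y, -, h⟩ := comp' (M := M) (fun i => npair j i ∈ Z) (M.len Z)
  exact ⟨Y, fun i => (h i).trans rowMem_iff⟩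

/-- The string `Z^[j]`. -/
noncomputable def row (Z : M.Str) (j : M.Num) : M.Str := (exists_row Z j).choose

theorem mem_row {Z : M.Str} {j i : M.Num} : i ∈ row Z j ↔ npair j i ∈ Z :=
  (exists_row Z j).choose_spec i

theorem row_len_le (Z : M.Str) (j : M.Num) : M.len (row Z j) ≤ M.len Z :=
  len_le_of fun _ hi => (rowMem_iff.2 (mem_row.1 hi)).1

def RowLen (Z : M.Str) (j l : M.Num) : Prop :=
  (∀ i < M.len Z, RowMem Z j i → i < l) ∧ (l = 0 ∨ ∃ i < l, i + 1 = l ∧ RowMem Z j i)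

theorem rowLen_iff {Z : M.Str} {j l : M.Num} : RowLen Z j l ↔ l = M.len (row Z j) := by
  constructor
  · rintro ⟨h, h'⟩
    refine le_antisymm ?_ (len_le_of fun i hi => ?_)
    · rcases h' with rfl | ⟨i, -, rfl, hi⟩
      · exact num_nonneg _
      · exact num_succ_le.2 (ax_l1 (mem_row.2 (rowMem_iff.1 hi)))
    · have := rowMem_iff.2 (mem_row.1 hi)
      exact h i this.1 this
  · rintro rfl
    refine ⟨fun i _ hi => ax_l1 (mem_row.2 (rowMem_iff.1 hi)), ?_⟩
    rcases num_cases (M.len (row Z j)) with h | ⟨i, hi⟩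
    · exact .inl h
    · exact .inr ⟨i, num_succ_le.1 hi.ge, hi.symm, rowMem_iff.2 (mem_row.1 (ax_l2 hi.symm))⟩

/-! ### Number sequences -/

/-- The `j`-th member is the least element of row `j`, with `M.len W` as the default for an empty
row. -/
def SeqEq (W : M.Str) (j a : M.Num) : Prop :=
  (a < M.len W ∧ npair j a ∈ W ∧ ∀ c < a, ¬ npair j c ∈ W) ∨
    (a = M.len W ∧ ∀ c < a, ¬ npair j c ∈ W)

instance D0.seqEq (W : E → M.Str) (j a : E → M.Num) [S0 W] [T0 j] [T0 a] :
    D0 M (fun e => SeqEq (W e) (j e) (a e)) := by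
  have := T0.weaken M.Num j
  have := S0.weaken M.Num W
  unfold SeqEq
  infer_instance

theorem SeqEq.le_len {W : M.Str} {j a : M.Num} (h : SeqEq W j a) : a ≤ M.len W :=
  h.elim (fun h => h.1.le) fun h => h.1.le

theorem SeqEq.unique {W : M.Str} {j a b : M.Num} (h : SeqEq W j a) (h' : SeqEq W j b) :
    a = b := by
  have key : ∀ a b : M.Num, SeqEq W j a → SeqEq W j b → ¬ a < b := by
    rintro a b (⟨_, ha, _⟩ | ⟨rfl, _⟩) hb hab
    · rcases hb with hb | hb
      · exact hb.2.2 a hab ha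
      · exact hb.2 a hab ha
    · exact absurd hb.le_len (not_le.2 hab)
  exact le_antisymm (not_lt.1 (key _ _ h' h)) (not_lt.1 (key _ _ h h'))

theorem SeqEq.of_iff {W : M.Str} {j a : M.Num} (h : ∀ c, npair j c ∈ W ↔ c = a) :
    SeqEq W j a := by
  refine .inl ⟨(le_npair_right j a).trans_lt (ax_l1 ((h a).2 rfl)), (h a).2 rfl, ?_⟩
  exact fun c hc hm => hc.ne ((h c).1 hm)

/-- Recursion: number sequences of bounded numbers, with a step relation `G` and an invariant
`R`. -/
theorem exists_seq (G : M.Num → M.Num → M.Num → Prop) (R : M.Num → M.Num → Prop)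
    [D0 M (fun e : ((Unit × M.Num) × M.Num) × M.Num => G e.1.1.2 e.1.2 e.2)]
    [D0 M (fun e : (Unit × M.Num) × M.Num => R e.1.2 e.2)] (J K a₀ : M.Num) (h0 : a₀ ≤ K)
    (hR : R 0 a₀)
    (hG : ∀ j < J, ∀ a ≤ K, R j a → ∃ b ≤ K, G j a b ∧ R (j + 1) b) :
    ∃ W : M.Str, M.len W ≤ npair J K + 1 ∧ SeqEq W 0 a₀ ∧
      (∀ j ≤ J, ∃ a ≤ K, SeqEq W j a ∧ R j a) ∧
      ∀ j < J, ∃ a ≤ K, ∃ b ≤ K, SeqEq W j a ∧ SeqEq W (j + 1) b ∧ G j a b := by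
  have := D0.comp₂ R (fun e : ((((Unit × M.Num) × M.Str) × M.Num) × M.Num) => e.1.2) (fun e => e.2)
  have := D0.comp₃ G (fun e : ((((Unit × M.Num) × M.Str) × M.Num) × M.Num) × M.Num => e.1.1.2)
    (fun e => e.1.2) (fun e => e.2)
  -- Σᴮ₁ induction on the part of the sequence computed so far. The bound on the witness is the same
  -- at every stage, as `ind_ex` requires.
  refine ind_ex (M := M) (fun n W => SeqEq W 0 a₀ ∧
      (∀ j ≤ n, ∃ a ≤ K, SeqEq W j a ∧ R j a) ∧
      ∀ j < n, ∃ a ≤ K, ∃ b ≤ K, SeqEq W j a ∧ SeqEq W (j + 1) b ∧ G j a b)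
    (npair J K + 1) J ?_ ?_
  · obtain ⟨W, hW, h⟩ := comp_pair (M := M) (fun _ a => a = a₀) J K
    have hs : SeqEq W 0 a₀ := .of_iff fun c => (h 0 c).trans
      ⟨fun h => h.2.2, fun h => ⟨num_nonneg _, h ▸ h0, h⟩⟩
    refine ⟨W, hW, hs, fun j hj => ⟨a₀, h0, ?_⟩, fun j hj => absurd hj (not_lt.2 (num_nonneg j))⟩
    rw [le_antisymm hj (num_nonneg j)]
    exact ⟨hs, hR⟩
  · rintro n hn W hW ⟨hW0, hWR, hWG⟩
    obtain ⟨a, ha, hna, hRa⟩ := hWR n le_rfl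
    obtain ⟨b, hb, hGb, hRb⟩ := hG n hn a ha hRa
    -- The code is rebuilt with exactly one element in each row up to `n + 1`: the old members are
    -- copied and `b` is appended.
    obtain ⟨W', hW', h⟩ := comp_pair (M := M)
      (fun j c => (j ≤ n ∧ SeqEq W j c) ∨ (j = n + 1 ∧ c = b)) J K
    have hold : ∀ j ≤ n, ∀ c ≤ K, SeqEq W j c → SeqEq W' j c := by
      refine fun j hj c hc hs => .of_iff fun d => (h j d).trans ⟨?_, ?_⟩
      · rintro ⟨-, -, ⟨-, hd⟩ | ⟨rfl, -⟩⟩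
        · exact hd.unique hs
        · exact absurd hj (not_le.2 (num_lt_succ.2 le_rfl))
      · rintro rfl
        exact ⟨hj.trans hn.le, hc, .inl ⟨hj, hs⟩⟩
    have hnew : SeqEq W' (n + 1) b := by
      refine .of_iff fun d => (h _ d).trans ⟨?_, ?_⟩
      · rintro ⟨-, -, ⟨hj, -⟩ | ⟨-, hd⟩⟩
        · exact absurd hj (not_le.2 (num_lt_succ.2 le_rfl))
        · exact hd
      · rintro rfl
        exact ⟨num_succ_le.2 hn, hb, .inr ⟨rfl, rfl⟩⟩
    refine ⟨W', hW', hold 0 (num_nonneg n) _ h0 hW0, fun j hj => ?_, fun j hj => ?_⟩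
    · rcases hj.lt_or_eq with hj | rfl
      · obtain ⟨c, hc, hs, hRc⟩ := hWR j (num_lt_succ.1 hj)
        exact ⟨c, hc, hold j (num_lt_succ.1 hj) c hc hs, hRc⟩
      · exact ⟨b, hb, hnew, hRb⟩
    · rcases (num_lt_succ.1 hj).lt_or_eq with hj | rfl
      · obtain ⟨c, hc, d, hd, hsc, hsd, hcd⟩ := hWG j hj
        exact ⟨c, hc, d, hd, hold j hj.le c hc hsc, hold _ (num_succ_le.2 hj) d hd hsd, hcd⟩
      · exact ⟨a, ha, b, hb, hold j le_rfl a ha hna, hnew, hGb⟩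

end Coding

set_option synthInstance.maxHeartbeats 400000
set_option synthInstance.maxSize 10000

/-! ## Binary length, binary values, and the pigeonhole principle -/

section Binary

variable {M : Struct.{u, v}}

/-! ### Powers of two -/

/-- `W` codes `1, 2, 4, …, 2ⁿ`. -/
def PowSeq (n : M.Num) (W : M.Str) : Prop :=
  SeqEq W 0 1 ∧ ∀ j < n, ∃ a ≤ M.len W, SeqEq W j a ∧ SeqEq W (j + 1) ((1 + 1) * a)

def BinLenW (x n : M.Num) (W : M.Str) : Prop :=
  SeqEq W 0 1 ∧
    (∀ j < n, ∃ a ≤ M.len W, SeqEq W j a ∧ a ≤ x ∧ SeqEq W (j + 1) ((1 + 1) * a)) ∧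
    ∃ a ≤ M.len W, SeqEq W n a ∧ x < a

theorem BinLenW.powSeq {x n : M.Num} {W : M.Str} (h : BinLenW x n W) : PowSeq n W :=
  ⟨h.1, fun j hj => let ⟨a, ha, h1, _, h2⟩ := h.2.1 j hj; ⟨a, ha, h1, h2⟩⟩

variable [V1Model M] {E : Type*} [Ctx M E]

theorem exists_binLenW (x : M.Num) :
    ∃ n ≤ x, ∃ W, M.len W ≤ npair x ((1 + 1) * x + 1) + 1 ∧ BinLenW x n W := by
  obtain ⟨W, hW, hW0, hWR, hWG⟩ := exists_seq (M := M)
    -- Doubling stops once `x` is exceeded, which keeps all members at most 2x + 1. The invariant `j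
    -- + 1 ≤ a` forces this to happen within `x` steps.
    (fun _ a b => (a ≤ x ∧ b = (1 + 1) * a) ∨ (x < a ∧ b = a)) (fun j a => x < a ∨ j + 1 ≤ a)
    x ((1 + 1) * x + 1) 1 le_add_self (by simp) (by
      intro j hj a ha hR
      rcases lt_or_ge x a with h | h
      · exact ⟨a, ha, .inr ⟨h, rfl⟩, .inl h⟩
      · have hj := hR.resolve_left (not_lt.2 h)
        refine ⟨(1 + 1) * a, ?_, .inl ⟨h, rfl⟩, .inr ?_⟩
        · exact (mul_le_mul_right h _).trans le_self_add
        · rw [add_mul, one_mul]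
          exact add_le_add hj (le_add_self.trans hj))
  obtain ⟨a, ha, hxa, hRa⟩ := hWR x le_rfl
  have hxa' : x < a := hRa.elim id num_succ_le.1
  -- The binary length is the first index whose member exceeds `x`; before it, only the doubling
  -- case of the recursion can occur.
  obtain ⟨n, ⟨b, hb, hnb, hxb⟩, hmin⟩ := exists_least (M := M)
    (fun n => ∃ a ≤ (1 + 1) * x + 1, SeqEq W n a ∧ x < a) ⟨a, ha, hxa, hxa'⟩
  have hnx : n ≤ x := not_lt.1 fun h => hmin x h ⟨a, ha, hxa, hxa'⟩
  refine ⟨n, hnx, W, hW, hW0, fun j hj => ?_, b, hnb.le_len, hnb, hxb⟩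
  obtain ⟨c, hc, d, hd, hjc, hjd, h⟩ := hWG j (hj.trans_le hnx)
  rcases h with ⟨hcx, rfl⟩ | ⟨hxc, -⟩
  · exact ⟨c, hjc.le_len, hjc, hcx, hjd⟩
  · exact absurd ⟨c, hc, hjc, hxc⟩ (hmin j hj)

theorem PowSeq.exists {n : M.Num} {W : M.Str} (h : PowSeq n W) :
    ∀ j ≤ n, ∃ p ≤ M.len W, SeqEq W j p ∧ 0 < p := by
  have : ∀ j : M.Num, j ≤ n → ∃ p ≤ M.len W, SeqEq W j p ∧ 0 < p := by
    refine ind (fun j : M.Num => j ≤ n → ∃ p ≤ M.len W, SeqEq W j p ∧ 0 < p) ?_ ?_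
    · exact fun _ => ⟨1, h.1.le_len, h.1, zero_lt_one⟩
    · intro j ih hj
      obtain ⟨p, -, hp, hp0⟩ := ih ((le_self_add).trans hj)
      obtain ⟨q, -, hq, hq'⟩ := h.2 j (num_succ_le.1 hj)
      obtain rfl := hp.unique hq
      exact ⟨_, hq'.le_len, hq', by positivity⟩
  exact this

theorem PowSeq.unique {n n' : M.Num} {W W' : M.Str} (h : PowSeq n W) (h' : PowSeq n' W') :
    ∀ j : M.Num, j ≤ n → j ≤ n' → ∃ a ≤ M.len W, SeqEq W j a ∧ SeqEq W' j a := by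
  refine ind (fun j : M.Num => j ≤ n → j ≤ n' → ∃ a ≤ M.len W, SeqEq W j a ∧ SeqEq W' j a) ?_ ?_
  · exact fun _ _ => ⟨1, h.1.le_len, h.1, h'.1⟩
  · intro j ih hj hj'
    obtain ⟨a, ha, h1, h2⟩ := ih (le_self_add.trans hj) (le_self_add.trans hj')
    obtain ⟨b, -, hb, hb'⟩ := h.2 j (num_succ_le.1 hj)
    obtain ⟨c, -, hc, hc'⟩ := h'.2 j (num_succ_le.1 hj')
    obtain rfl := h1.unique hb
    obtain rfl := h2.unique hc
    exact ⟨_, hb'.le_len, hb', hc'⟩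

/-- Two codes of the powers of two agree on their common part, so for `n < n'` the `n`-th power
would be both above `x` and at most `x`. -/
theorem BinLenW.unique {x n n' : M.Num} {W W' : M.Str} (h : BinLenW x n W)
    (h' : BinLenW x n' W') : n = n' := by
  have key : ∀ (n n' : M.Num) (W W' : M.Str), BinLenW x n W → BinLenW x n' W' → ¬ n < n' := by
    intro n n' W W' h h' hn
    obtain ⟨a, -, ha, ha'⟩ := h.powSeq.unique h'.powSeq n le_rfl hn.le
    obtain ⟨b, -, hb, hxb⟩ := h.2.2
    obtain ⟨c, -, hc, hcx, -⟩ := h'.2.1 n hn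
    obtain rfl := ha.unique hb
    obtain rfl := ha'.unique hc
    exact absurd hcx (not_le.2 hxb)
  exact le_antisymm (not_lt.1 (key _ _ _ _ h' h)) (not_lt.1 (key _ _ _ _ h h'))

/-- `|2x| = |x| + 1` for positive `x`. -/
theorem BinLenW.half {x m : M.Num} {W : M.Str} (hx : 0 < x) (h : BinLenW ((1 + 1) * x) m W) :
    ∃ n, m = n + 1 ∧ BinLenW x n W := by
  obtain ⟨h0, h1, a, -, ha, hxa⟩ := h
  rcases num_cases m with rfl | ⟨n, rfl⟩
  · obtain rfl := ha.unique h0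
    rw [← num_succ_le, zero_add] at hx
    have h1 : (1 : M.Num) ≤ (1 + 1) * x := by
      rw [add_mul, one_mul]
      exact hx.trans le_self_add
    exact absurd h1 (not_le.2 hxa)
  · have hlt : ∀ {p q : M.Num}, (1 + 1) * p < (1 + 1) * q → p < q :=
      fun h => lt_of_mul_lt_mul_left h (num_nonneg _)
    have hle : ∀ {p q : M.Num}, (1 + 1) * p ≤ (1 + 1) * q → p ≤ q :=
      fun h => le_of_mul_le_mul_left h (by positivity)
    -- The same code without its last power works for `x`: each comparison with `x` is one for `2x`
    -- at the next index, with a factor 2 cancelled.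
    refine ⟨n, rfl, h0, fun j hj => ?_, ?_⟩
    · obtain ⟨b, hb, hjb, -, hjb'⟩ := h1 j (hj.trans (num_lt_succ.2 le_rfl))
      obtain ⟨c, -, hjc, hcx, -⟩ := h1 (j + 1) (num_lt_succ.2 (num_succ_le.2 hj))
      obtain rfl := hjc.unique hjb'
      exact ⟨b, hb, hjb, hle hcx, hjb'⟩
    · obtain ⟨b, hb, hjb, -, hjb'⟩ := h1 n (num_lt_succ.2 le_rfl)
      obtain rfl := ha.unique hjb'
      exact ⟨b, hb, hjb, hlt hxa⟩

/-! ### The value of the leading bits of a string -/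

def TopBit (X : M.Str) (j : M.Num) : Prop := ∃ i < M.len X, i + (j + 1) = M.len X ∧ i ∈ X

instance D0.topBit (X : E → M.Str) (j : E → M.Num) [S0 X] [T0 j] :
    D0 M (fun e => TopBit (X e) (j e)) := by
  have := T0.weaken M.Num j
  have := S0.weaken M.Num X
  unfold TopBit
  infer_instance

def ValW (x z : M.Num) (X V : M.Str) : Prop :=
  (M.len X = 0 ∧ z = 0) ∨
    (M.len X ≠ 0 ∧ SeqEq V 0 0 ∧ SeqEq V x z ∧ ∀ j < x, ∃ a ≤ M.len V, SeqEq V j a ∧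
      (M.len X ≤ j → SeqEq V (j + 1) a) ∧
      (j < M.len X ∧ ¬ TopBit X j → SeqEq V (j + 1) ((1 + 1) * a)) ∧
      (j < M.len X ∧ TopBit X j → SeqEq V (j + 1) ((1 + 1) * a + 1)))

theorem BinLenW.exists_valW {y n : M.Num} {W : M.Str} (h : BinLenW y n W) (X : M.Str) :
    ∃ z ≤ (1 + 1) * y + 1, ∃ V, M.len V ≤ npair n ((1 + 1) * y + 1) + 1 ∧ ValW n z X V := by
  by_cases hX : M.len X = 0
  · obtain ⟨V, hV, -⟩ := comp' (M := M) (fun _ => True) (npair n ((1 + 1) * y + 1) + 1)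
    -- For the empty string the value is 0 by definition, and any `V` within the length bound will
    -- do.
    exact ⟨0, num_nonneg _, V, hV, .inl ⟨hX, rfl⟩⟩
  obtain ⟨V, hV, hV0, hVR, hVG⟩ := exists_seq (M := M)
    (fun j a b => (M.len X ≤ j → b = a) ∧ (j < M.len X ∧ ¬ TopBit X j → b = (1 + 1) * a) ∧
      (j < M.len X ∧ TopBit X j → b = (1 + 1) * a + 1))
    -- The value of `j` leading bits is less than 2^j. For `j < n` this power is at most `y`, so the
    -- next value is at most 2y + 1.
    (fun j a => ∃ p ≤ M.len W, SeqEq W j p ∧ a < p)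
    n ((1 + 1) * y + 1) 0 (num_nonneg _) ⟨1, h.1.le_len, h.1, zero_lt_one⟩ (by
      rintro j hj a ha ⟨p, -, hp, hap⟩
      obtain ⟨q, -, hq, hqy, hq'⟩ := h.2.1 j hj
      obtain rfl := hp.unique hq
      have hay : (1 + 1) * a + 1 ≤ (1 + 1) * y + 1 := by
        gcongr
        exact hap.le.trans hqy
      have hap' : (1 + 1) * a + 1 < (1 + 1) * p := by
        have := num_succ_le.2 hap
        simp only [num_le_incl, num_lt_incl, map_add, map_mul, map_one] at this ⊢
        linarith
      rcases lt_or_ge j (M.len X) with hjX | hjX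
      · by_cases ht : TopBit X j
        · refine ⟨_, hay, ⟨fun h => absurd hjX (not_lt.2 h), fun h => absurd ht h.2,
            fun _ => rfl⟩, _, hq'.le_len, hq', hap'⟩
        · refine ⟨_, le_self_add.trans hay, ⟨fun h => absurd hjX (not_lt.2 h), fun _ => rfl,
            fun h => absurd h.2 ht⟩, _, hq'.le_len, hq', lt_of_le_of_lt le_self_add hap'⟩
      · refine ⟨a, ha, ⟨fun _ => rfl, fun h => absurd h.1 (not_lt.2 hjX),
          fun h => absurd h.1 (not_lt.2 hjX)⟩, _, hq'.le_len, hq', ?_⟩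
        rw [add_mul, one_mul]
        exact hap.trans_le le_self_add)
  obtain ⟨z, hz, hnz, -⟩ := hVR n le_rfl
  refine ⟨z, hz, V, hV, .inr ⟨hX, hV0, hnz, fun j hj => ?_⟩⟩
  obtain ⟨a, -, b, -, ha, hb, h1, h2, h3⟩ := hVG j hj
  exact ⟨a, ha.le_len, ha, fun h => h1 h ▸ hb, fun h => h2 h ▸ hb, fun h => h3 h ▸ hb⟩

theorem ValW.unique {x z z' : M.Num} {X V V' : M.Str} (h : ValW x z X V) (h' : ValW x z' X V') :
    z = z' := by
  rcases h with ⟨h, rfl⟩ | ⟨h, h0, hz, hs⟩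
  · rcases h' with ⟨-, rfl⟩ | ⟨h', -⟩
    · rfl
    · exact absurd h h'
  rcases h' with ⟨h', -⟩ | ⟨-, h0', hz', hs'⟩
  · exact absurd h' h
  have : ∀ j : M.Num, j ≤ x → ∃ a ≤ M.len V, SeqEq V j a ∧ SeqEq V' j a := by
    refine ind (fun j : M.Num => j ≤ x → ∃ a ≤ M.len V, SeqEq V j a ∧ SeqEq V' j a) ?_ ?_
    · exact fun _ => ⟨0, h0.le_len, h0, h0'⟩
    · intro j ih hj
      obtain ⟨a, -, ha, ha'⟩ := ih (le_self_add.trans hj)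
      obtain ⟨b, -, hb, hb1, hb2, hb3⟩ := hs j (num_succ_le.1 hj)
      obtain ⟨c, -, hc, hc1, hc2, hc3⟩ := hs' j (num_succ_le.1 hj)
      obtain rfl := ha.unique hb
      obtain rfl := ha'.unique hc
      rcases lt_or_ge j (M.len X) with hjX | hjX
      · by_cases ht : TopBit X j
        · exact ⟨_, (hb3 ⟨hjX, ht⟩).le_len, hb3 ⟨hjX, ht⟩, hc3 ⟨hjX, ht⟩⟩
        · exact ⟨_, (hb2 ⟨hjX, ht⟩).le_len, hb2 ⟨hjX, ht⟩, hc2 ⟨hjX, ht⟩⟩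
      · exact ⟨_, (hb1 hjX).le_len, hb1 hjX, hc1 hjX⟩
  obtain ⟨a, -, ha, ha'⟩ := this x le_rfl
  rw [hz.unique ha, hz'.unique ha']

/-! ### The value of the trailing bits of a string -/

/-- `L` codes the values of the strings of the `i` least significant bits of `U`, for `i ≤ m`;
the powers of two are read off `W`. -/
def LowSeq (W U L : M.Str) (m : M.Num) : Prop :=
  SeqEq L 0 0 ∧ ∀ i < m, ∃ a ≤ M.len L, ∃ p ≤ M.len W, SeqEq L i a ∧ SeqEq W i p ∧
    (i ∈ U → SeqEq L (i + 1) (a + p)) ∧ (i ∉ U → SeqEq L (i + 1) a)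

theorem PowSeq.exists_lowSeq {m : M.Num} {W : M.Str} (h : PowSeq m W) (U : M.Str) :
    ∃ L, LowSeq W U L m := by
  obtain ⟨L, -, hL0, -, hLG⟩ := exists_seq (M := M)
    (fun i a b => ∃ p ≤ M.len W, SeqEq W i p ∧ (i ∈ U → b = a + p) ∧ (i ∉ U → b = a))
    -- The partial value stays below the corresponding power of two, and those powers are members of
    -- `W`, hence bounded by its length.
    (fun j a => ∃ p ≤ M.len W, SeqEq W j p ∧ a < p) m (M.len W) 0 (num_nonneg _)
    ⟨1, h.1.le_len, h.1, zero_lt_one⟩ (by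
      rintro j hj a ha ⟨p, -, hp, hap⟩
      obtain ⟨q, -, hq, hq'⟩ := h.2 j hj
      obtain rfl := hp.unique hq
      have hap' : a + p < (1 + 1) * p := by
        rw [add_mul, one_mul]
        exact add_lt_add_left hap p
      by_cases hU : j ∈ U
      · exact ⟨a + p, (hap'.le.trans hq'.le_len), ⟨p, hp.le_len, hp, fun _ => rfl,
          fun h => absurd hU h⟩, _, hq'.le_len, hq', hap'⟩
      · exact ⟨a, ha, ⟨p, hp.le_len, hp, fun h => absurd h hU, fun _ => rfl⟩, _, hq'.le_len, hq',
          lt_of_le_of_lt le_self_add hap'⟩)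
  refine ⟨L, hL0, fun i hi => ?_⟩
  obtain ⟨a, -, b, -, ha, hb, p, hp, hip, h1, h2⟩ := hLG i hi
  exact ⟨a, ha.le_len, p, hp, ha, hip, fun h => h1 h ▸ hb, fun h => h2 h ▸ hb⟩

theorem LowSeq.exists {W U L : M.Str} {m : M.Num} (h : LowSeq W U L m) :
    ∀ i ≤ m, ∃ a ≤ M.len L, SeqEq L i a := by
  intro i hi
  rcases num_cases i with rfl | ⟨j, rfl⟩
  · exact ⟨0, h.1.le_len, h.1⟩
  · obtain ⟨a, -, p, -, -, -, h1, h2⟩ := h.2 j (num_succ_le.1 hi)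
    by_cases hU : j ∈ U
    · exact ⟨_, (h1 hU).le_len, h1 hU⟩
    · exact ⟨_, (h2 hU).le_len, h2 hU⟩

/-- The trailing bits beyond the length do not contribute. -/
theorem LowSeq.eq_of_len_le {W U L : M.Str} {m a : M.Num} (h : LowSeq W U L m)
    (ha : SeqEq L (M.len U) a) : ∀ i : M.Num, M.len U ≤ i → i ≤ m → SeqEq L i a := by
  refine ind (fun i : M.Num => M.len U ≤ i → i ≤ m → SeqEq L i a) ?_ ?_
  · intro h0 _
    rwa [le_antisymm h0 (num_nonneg _)] at ha
  · intro i ih h1 h2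
    rcases h1.lt_or_eq with h1 | h1
    · have hi := ih (num_lt_succ.1 h1) (le_self_add.trans h2)
      obtain ⟨b, -, p, -, hb, -, -, hb'⟩ := h.2 i (num_succ_le.1 h2)
      obtain rfl := hb.unique hi
      exact hb' fun hU => absurd (ax_l1 hU) (not_lt.2 (num_lt_succ.1 h1))
    · rwa [← h1]

/-- The value of the leading bits agrees with the value of the trailing bits. -/
theorem LowSeq.eq_val {W U L V : M.Str} {m z a : M.Num} (h : LowSeq W U L m) (hW : PowSeq m W)
    (hU : M.len U ≤ m) (hV : ValW m z U V) (ha : SeqEq L m a) : z = a := by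
  obtain ⟨b, -, hb⟩ := h.exists _ hU
  obtain rfl := (h.eq_of_len_le hb m hU le_rfl).unique ha
  rcases hV with ⟨h0, rfl⟩ | ⟨-, hV0, hVz, hV⟩
  · rw [h0] at hb
    exact h.1.unique hb
  -- Cutting `U` into `j` leading and `i` trailing bits splits its value as `b = c * 2^i + d`.
  -- Moving the cut down by one bit preserves the sum, and at `i = 0` only `c` is left.
  have h1 : ∀ j : M.Num, j ≤ M.len U → ∃ i ≤ M.len U, ∃ c ≤ M.len V, ∃ p ≤ M.len W,
      ∃ d ≤ M.len L, i + j = M.len U ∧ SeqEq V j c ∧ SeqEq W i p ∧ SeqEq L i d ∧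
        b = c * p + d := by
    refine ind (fun j : M.Num => j ≤ M.len U → ∃ i ≤ M.len U, ∃ c ≤ M.len V, ∃ p ≤ M.len W,
      ∃ d ≤ M.len L, i + j = M.len U ∧ SeqEq V j c ∧ SeqEq W i p ∧ SeqEq L i d ∧
        b = c * p + d) ?_ ?_
    · intro _
      obtain ⟨p, hp, hip, -⟩ := hW.exists _ hU
      exact ⟨_, le_rfl, 0, num_nonneg _, p, hp, b, hb.le_len, add_zero _, hV0, hip, hb, by simp⟩
    · intro j ih hj
      obtain ⟨i', hi', c, -, p', -, d', -, hij, hc, hp', hd', rfl⟩ := ih (le_self_add.trans hj)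
      rcases num_cases i' with rfl | ⟨i, rfl⟩
      · rw [zero_add] at hij
        rw [hij, num_succ_le] at hj
        exact absurd hj (lt_irrefl _)
      have hij' : i + (j + 1) = M.len U := by rw [← hij]; ring
      have hiU : i < M.len U := num_succ_le.1 hi'
      obtain ⟨d, -, p, -, hd, hp, hd1, hd2⟩ := h.2 i (hiU.trans_le hU)
      obtain ⟨q, -, hq, hq'⟩ := hW.2 i (hiU.trans_le hU)
      obtain rfl := hp.unique hq
      obtain rfl := hp'.unique hq'
      obtain ⟨c', -, hc', -, hV2, hV3⟩ := hV j ((num_succ_le.1 hj).trans_le hU)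
      obtain rfl := hc.unique hc'
      have ht : TopBit U j ↔ i ∈ U := by
        refine ⟨?_, fun hi => ⟨i, hiU, hij', hi⟩⟩
        rintro ⟨k, -, hk, hkU⟩
        rwa [num_add_right_cancel (hk.trans hij'.symm)] at hkU
      by_cases hi : i ∈ U
      · obtain rfl := hd'.unique (hd1 hi)
        have hc3 := hV3 ⟨num_succ_le.1 hj, ht.2 hi⟩
        exact ⟨i, hiU.le, _, hc3.le_len, p, hp.le_len, d, hd.le_len, hij', hc3, hp, hd, by ring⟩
      · obtain rfl := hd'.unique (hd2 hi)
        have hc2 := hV2 ⟨num_succ_le.1 hj, fun h => hi (ht.1 h)⟩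
        exact ⟨i, hiU.le, _, hc2.le_len, p, hp.le_len, _, hd.le_len, hij', hc2, hp, hd, by ring⟩
  obtain ⟨i, -, c, -, p, -, d, -, hi, hc, hp, hd, rfl⟩ := h1 _ le_rfl
  obtain rfl : i = 0 := num_add_right_cancel (hi.trans (zero_add _).symm)
  obtain rfl := hW.1.unique hp
  obtain rfl := h.1.unique hd
  rw [mul_one, add_zero] at *
  -- From the index `M.len U` on, all bits of `U` have been read and the sequence `V` is constant.
  have h2 : ∀ j : M.Num, M.len U ≤ j → j ≤ m → SeqEq V j c := by
    refine ind (fun j : M.Num => M.len U ≤ j → j ≤ m → SeqEq V j c) ?_ ?_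
    · intro h0 _
      rwa [le_antisymm h0 (num_nonneg _)] at hc
    · intro j ih hUj hjm
      rcases hUj.lt_or_eq with hUj | hUj
      · have hUj := num_lt_succ.1 hUj
        obtain ⟨c', -, hc', hV1, -⟩ := hV j (num_succ_le.1 hjm)
        obtain rfl := hc'.unique (ih hUj (le_self_add.trans hjm))
        exact hV1 hUj
      · rwa [← hUj]
  exact hVz.unique (h2 m hU le_rfl)

/-! ### The successor -/

def IsSucc (U U' : M.Str) : Prop := ∀ i, i ∈ U' ↔ i ≤ M.len U ∧
  ((i ∈ U ∧ ∃ j < i, j ∉ U) ∨ (i ∉ U ∧ ∀ j < i, j ∈ U))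

theorem exists_isSucc (U : M.Str) : ∃ U', IsSucc U U' := by
  obtain ⟨U', -, h⟩ := comp' (M := M)
    (fun i => (i ∈ U ∧ ∃ j < i, j ∉ U) ∨ (i ∉ U ∧ ∀ j < i, j ∈ U)) (M.len U + 1)
  exact ⟨U', fun i => by rw [h, num_lt_succ]⟩

theorem IsSucc.len_le {U U' : M.Str} (h : IsSucc U U') : M.len U' ≤ M.len U + 1 :=
  len_le_of fun i hi => num_lt_succ.2 ((h i).1 hi).1

/-- The successor increments the value. -/
theorem IsSucc.lowSeq {U U' W L L' : M.Str} {m a b : M.Num} (h : IsSucc U U') (hW : PowSeq m W)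
    (hL : LowSeq W U L m) (hL' : LowSeq W U' L' m) (hU : M.len U < m) (ha : SeqEq L m a)
    (hb : SeqEq L' m b) : b = a + 1 := by
  -- This tracks the carry. While all bits of `U` below `i` are ones, its low part is 2^i - 1 and
  -- that of `U'` is 0. From the first zero on, the low parts differ by exactly 1.
  have key : ∀ i : M.Num, i ≤ m → ∃ p ≤ M.len W, ∃ a ≤ M.len L, ∃ b ≤ M.len L', SeqEq W i p ∧
      SeqEq L i a ∧ SeqEq L' i b ∧ ((∀ k < i, k ∈ U) → a + 1 = p ∧ b = 0) ∧
      ((∃ k < i, k ∉ U) → b = a + 1) := by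
    refine ind (fun i : M.Num => i ≤ m → ∃ p ≤ M.len W, ∃ a ≤ M.len L, ∃ b ≤ M.len L', SeqEq W i p ∧
      SeqEq L i a ∧ SeqEq L' i b ∧ ((∀ k < i, k ∈ U) → a + 1 = p ∧ b = 0) ∧
      ((∃ k < i, k ∉ U) → b = a + 1)) ?_ ?_
    · intro _
      refine ⟨1, hW.1.le_len, 0, num_nonneg _, 0, num_nonneg _, hW.1, hL.1, hL'.1,
        fun _ => ⟨zero_add _, rfl⟩, ?_⟩
      rintro ⟨k, hk, -⟩
      exact absurd hk (not_lt.2 (num_nonneg k))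
    · intro i ih hi
      obtain ⟨p, -, a, -, b, -, hp, ha, hb, h1, h2⟩ := ih (le_self_add.trans hi)
      have him := num_succ_le.1 hi
      obtain ⟨q, -, hq, hq'⟩ := hW.2 i him
      obtain rfl := hp.unique hq
      obtain ⟨a', -, q, -, ha', hq, hL1, hL2⟩ := hL.2 i him
      obtain rfl := ha.unique ha'
      obtain rfl := hp.unique hq
      obtain ⟨b', -, q, -, hb', hq, hL1', hL2'⟩ := hL'.2 i him
      obtain rfl := hb.unique hb'
      obtain rfl := hp.unique hq
      by_cases hall : ∀ k < i, k ∈ U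
      · obtain ⟨hap, rfl⟩ := h1 hall
        by_cases hiU : i ∈ U
        · have hiU' : i ∉ U' := by
            rw [h]
            rintro ⟨-, ⟨-, j, hj, hjU⟩ | ⟨hiU', -⟩⟩
            · exact hjU (hall j hj)
            · exact hiU' hiU
          refine ⟨_, hq'.le_len, _, (hL1 hiU).le_len, _, (hL2' hiU').le_len, hq', hL1 hiU,
            hL2' hiU', fun _ => ⟨?_, rfl⟩, ?_⟩
          · rw [add_right_comm, hap, add_mul, one_mul]
          · rintro ⟨k, hk, hkU⟩
            rcases (num_lt_succ.1 hk).lt_or_eq with hk | rfl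
            · exact absurd (hall k hk) hkU
            · exact absurd hiU hkU
        -- The definition of the successor demands `i ≤ |U|`. A larger `i` would make `|U|` one of
        -- the positions below `i`, all of which are in `U`.
        · have hile : i ≤ M.len U := by
            refine not_lt.1 fun hlt => ?_
            exact (ax_l1 (hall _ hlt)).false
          have hiU' : i ∈ U' := (h i).2 ⟨hile, .inr ⟨hiU, hall⟩⟩
          refine ⟨_, hq'.le_len, _, (hL2 hiU).le_len, _, (hL1' hiU').le_len, hq', hL2 hiU,
            hL1' hiU', fun hk => ?_, fun _ => ?_⟩
          · exact absurd (hk i (num_lt_succ.2 le_rfl)) hiU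
          · rw [zero_add, hap]
      · push Not at hall
        obtain rfl := h2 hall
        have hnot : ¬ ∀ k < i + 1, k ∈ U := by
          obtain ⟨k, hk, hkU⟩ := hall
          exact fun h => hkU (h k (hk.trans (num_lt_succ.2 le_rfl)))
        by_cases hiU : i ∈ U
        · have hiU' : i ∈ U' := (h i).2 ⟨(ax_l1 hiU).le, .inl ⟨hiU, hall⟩⟩
          exact ⟨_, hq'.le_len, _, (hL1 hiU).le_len, _, (hL1' hiU').le_len, hq', hL1 hiU,
            hL1' hiU', fun h => absurd h hnot, fun _ => add_right_comm _ _ _⟩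
        · have hiU' : i ∉ U' := by
            rw [h]
            rintro ⟨-, ⟨hiU', -⟩ | ⟨-, hj⟩⟩
            · exact hiU hiU'
            · obtain ⟨k, hk, hkU⟩ := hall
              exact hkU (hj k hk)
          exact ⟨_, hq'.le_len, _, (hL2 hiU).le_len, _, (hL2' hiU').le_len, hq', hL2 hiU,
            hL2' hiU', fun h => absurd h hnot, fun _ => rfl⟩
  obtain ⟨p, -, a', -, b', -, -, ha', hb', -, hab⟩ := key m le_rfl
  rw [hb.unique hb', ha.unique ha']
  -- The position `|U|` is a zero bit of `U` below `m`, so the carry has been absorbed.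
  exact hab ⟨_, hU, fun h => (ax_l1 h).false⟩

/-- Every number below `2ⁿ` is the value of a string of length at most `n`. -/
theorem PowSeq.exists_str {n v q : M.Num} {W : M.Str} (hW : PowSeq n W) (hq : SeqEq W n q)
    (hv : v < q) : ∃ U : M.Str, M.len U ≤ n ∧ ∀ L, LowSeq W U L n → SeqEq L n v := by
  have par : ∀ a : M.Num, ∃ b ≤ a, a = (1 + 1) * b ∨ a = (1 + 1) * b + 1 := by
    refine ind (fun a : M.Num => ∃ b ≤ a, a = (1 + 1) * b ∨ a = (1 + 1) * b + 1) ?_ ?_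
    · exact ⟨0, le_rfl, .inl (by simp)⟩
    · rintro a ⟨b, hb, rfl | rfl⟩
      · exact ⟨b, hb.trans le_self_add, .inr rfl⟩
      · refine ⟨b + 1, ?_, .inl (by ring)⟩
        gcongr
  -- `S` codes the repeated halvings of `v`; bit `i` of `U` will be the parity of its `i`-th member.
  obtain ⟨S, -, hS0, -, hSG⟩ := exists_seq (M := M)
    (fun _ a b => a = (1 + 1) * b ∨ a = (1 + 1) * b + 1) (fun _ _ => True) n v v le_rfl trivial
    (fun j _ a ha _ => let ⟨b, hb, h⟩ := par a; ⟨b, hb.trans ha, h, trivial⟩)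
  obtain ⟨U, hU, hUi⟩ := comp' (M := M)
    (fun i => ∃ b ≤ M.len S, SeqEq S i ((1 + 1 : M.Num) * b + (1 : M.Num))) n
  refine ⟨U, hU, fun L hL => ?_⟩
  -- The `i` low bits and the remaining quotient `s` always recombine to `v`.
  have key : ∀ i : M.Num, i ≤ n → ∃ a ≤ M.len L, ∃ s ≤ M.len S, ∃ p ≤ M.len W, SeqEq L i a ∧
      SeqEq S i s ∧ SeqEq W i p ∧ a + s * p = v := by
    refine ind (fun i : M.Num => i ≤ n → ∃ a ≤ M.len L, ∃ s ≤ M.len S, ∃ p ≤ M.len W, SeqEq L i a ∧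
      SeqEq S i s ∧ SeqEq W i p ∧ a + s * p = v) ?_ ?_
    · exact fun _ => ⟨0, num_nonneg _, v, hS0.le_len, 1, hW.1.le_len, hL.1, hS0, hW.1, by simp⟩
    · intro i ih hi
      obtain ⟨a, -, s, -, p, -, ha, hs, hp, rfl⟩ := ih (le_self_add.trans hi)
      have hin := num_succ_le.1 hi
      obtain ⟨p', -, hp', hp2⟩ := hW.2 i hin
      obtain rfl := hp.unique hp'
      obtain ⟨a', -, p', -, ha', hp', hL1, hL2⟩ := hL.2 i hin
      obtain rfl := ha.unique ha'
      obtain rfl := hp.unique hp'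
      obtain ⟨s', -, b, -, hs', hb, hsb⟩ := hSG i hin
      obtain rfl := hs.unique hs'
      rcases hsb with rfl | rfl
      · have hiU : i ∉ U := by
          rw [hUi]
          rintro ⟨-, c, -, hc⟩
          have := hs.unique hc
          have h1 : ∀ b c : M.Num, (1 + 1) * b ≠ (1 + 1) * c + 1 := by
            intro b c h
            rcases lt_or_ge c b with hbc | hbc
            · rw [← num_succ_le] at hbc
              simp only [num_le_incl, num_eq_incl, map_add, map_mul, map_one] at h hbc
              linarith
            · simp only [num_le_incl, num_eq_incl, map_add, map_mul, map_one] at h hbc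
              linarith
          exact h1 _ _ this
        exact ⟨_, (hL2 hiU).le_len, b, hb.le_len, _, hp2.le_len, hL2 hiU, hb, hp2, by ring⟩
      · have hbs : b ≤ (1 + 1) * b + 1 := by
          rw [add_mul, one_mul, add_assoc]
          exact le_self_add
        have hiU : i ∈ U := (hUi i).2 ⟨hin, b, hbs.trans hs.le_len, hs⟩
        exact ⟨_, (hL1 hiU).le_len, b, hb.le_len, _, hp2.le_len, hL1 hiU, hb, hp2, by ring⟩
  obtain ⟨a, -, s, -, p, -, ha, hs, hp, rfl⟩ := key n le_rfl
  obtain rfl := hp.unique hq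
  -- A nonzero quotient after `n` halvings would give `v ≥ 2ⁿ`.
  have hs0 : s = 0 := by
    by_contra h
    have h1 : 1 ≤ s := by
      rw [← zero_add (1 : M.Num), num_succ_le]
      exact num_pos_iff.2 h
    have : p ≤ a + s * p := (le_mul_of_one_le_left (num_nonneg p) h1).trans le_add_self
    exact absurd hv (not_lt.2 this)
  subst hs0
  simpa using ha

/-! ### The pigeonhole principle -/

/-- The Σᴮ₁ least number principle yields a smallest `n` with a counterexample of bounded length. If
it is `m + 1`, a counterexample for `m` arises by redirecting whatever is sent to `m` to the image
of `m + 1`. -/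
theorem pigeonhole (F : M.Str) (n : M.Num) (htot : ∀ j ≤ n, ∃ i < n, npair j i ∈ F)
    (hinj : ∀ j ≤ n, ∀ j' ≤ n, ∀ i < n, npair j i ∈ F → npair j' i ∈ F → j = j') : False := by
  obtain ⟨k, hkn, ⟨F, hF, htot, hinj⟩, hmin⟩ := exists_least_ex (M := M)
    (fun n F => (∀ j ≤ n, ∃ i < n, npair j i ∈ F) ∧
      ∀ j ≤ n, ∀ j' ≤ n, ∀ i < n, npair j i ∈ F → npair j' i ∈ F → j = j')
    -- The bound has room both for the given `F` and for every relation on numbers up to `n`, in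
    -- particular the redirected one.
    (M.len F + npair n n + 1) (n := n) ⟨F, by rw [add_assoc]; exact le_self_add, htot, hinj⟩
  rcases num_cases k with rfl | ⟨m, rfl⟩
  · obtain ⟨i, hi, -⟩ := htot 0 le_rfl
    exact absurd hi (not_lt.2 (num_nonneg i))
  obtain ⟨F', hF', h⟩ := comp_pair (M := M)
    (fun j i => npair j i ∈ F ∨ (npair j m ∈ F ∧ npair (m + 1) i ∈ F)) m m
  have hm : m < m + 1 := num_lt_succ.2 le_rfl
  refine hmin m hm ⟨F', ?_, ?_, ?_⟩
  · rw [add_assoc]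
    refine hF'.trans (le_trans ?_ le_add_self)
    gcongr
    exact npair_le_npair (hm.le.trans hkn) (hm.le.trans hkn)
  · intro j hj
    obtain ⟨i, hi, hji⟩ := htot j (hj.trans hm.le)
    rcases (num_lt_succ.1 hi).lt_or_eq with him | rfl
    · exact ⟨i, him, (h _ _).2 ⟨hj, him.le, .inl hji⟩⟩
    · obtain ⟨i', hi', hmi'⟩ := htot (i + 1) le_rfl
      rcases (num_lt_succ.1 hi').lt_or_eq with him' | rfl
      · exact ⟨i', him', (h _ _).2 ⟨hj, him'.le, .inr ⟨hji, hmi'⟩⟩⟩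
      · have := hinj j (hj.trans hm.le) _ le_rfl _ hi hji hmi'
        exact absurd hj (not_le.2 (this ▸ hm))
  · intro j hj j' hj' i hi h1 h2
    have hjm := hj.trans hm.le
    have hjm' := hj'.trans hm.le
    have him := hi.trans hm
    have hne : ∀ j ≤ m, j ≠ m + 1 := fun j hj e => absurd hj (not_le.2 (e ▸ hm))
    rcases ((h _ _).1 h1).2.2 with h1 | ⟨h1, h1'⟩ <;>
      rcases ((h _ _).1 h2).2.2 with h2 | ⟨h2, h2'⟩
    · exact hinj j hjm j' hjm' i him h1 h2
    · exact absurd (hinj j hjm _ le_rfl i him h1 h2') (hne j hj)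
    · exact absurd (hinj j' hjm' _ le_rfl i him h2 h1') (hne j' hj')
    · exact hinj j hjm j' hjm' m hm h1 h2

end Binary

/-! ## Iterates -/

section Iterates

variable {M : Struct.{u, v}} {p q : ℕ}

/-- `φ(i, Y)` for fixed values of the parameters. -/
def Op (φ : Fml (p + 1) (q + 1)) (a : Fin p → M.Num) (A : Fin q → M.Str) (i : M.Num) (Y : M.Str) :
    Prop :=
  φ.Realize M (Fin.snoc a i) (Fin.snoc A Y)

theorem realize_rowLen {n m : ℕ} (Z : Fin m) (j l : Tm n m) (a : Fin n → M.Num)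
    (A : Fin m → M.Str) :
    (rowLen Z j l).Realize M a A ↔ RowLen (A Z) (j.val M a A) (l.val M a A) := by
  simp [rowLen, RowLen, rowMem, RowMem]

variable [V1Model M] (φ : Fml (p + 1) (q + 1))

/-- The term `l` supplies the length of the row inside `φ`, so the substitution is correct only if
`l` has that value. -/
theorem realize_atRow {n m : ℕ} (hp : p ≤ n) (hq : q ≤ m) (i : Tm n m) (Z : Fin m)
    (j l : Tm n m) (a : Fin n → M.Num) (A : Fin m → M.Str)
    (hl : l.val M a A = M.len (row (A Z) (j.val M a A))) :
    (atRow φ hp hq i Z j l).Realize M a A ↔ Op φ (fun k => a (k.castLE hp))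
      (fun k => A (k.castLE hq)) (i.val M a A) (row (A Z) (j.val M a A)) := by
  refine (realize_subst φ (C := Fin.snoc (fun k => A (k.castLE hq)) (row (A Z) (j.val M a A)))
    fun k => ?_).trans ?_
  · refine Fin.lastCases ?_ (fun k => ?_) k
    · simp only [Fin.snoc_last, STm.Eval]
      exact ⟨hl, fun i => (rowMem_iff (Z := A Z)).trans mem_row.symm⟩
    · simp [STm.Eval]
  · refine iff_of_eq (congrArg (φ.Realize M · _) (funext fun k => ?_))
    refine Fin.lastCases ?_ (fun k => ?_) k <;> simp

theorem IsSigB0.rowLen {n m : ℕ} (Z : Fin m) (j l : Tm n m) : IsSigB0 (rowLen Z j l) :=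
  .and (.allLt _ (.imp (.rowMem _ _ _) (.lt _ _)))
    (.or (.eq _ _) (.exLt _ (.and (.eq _ _) (.rowMem _ _ _))))

variable {φ} (a : Fin p → M.Num) (A : Fin q → M.Str)

/-- The row length is not a number term. It enters as a further variable, pinned down by the Σᴮ₀
formula `rowLen`, whose truth licenses the substitution of the row in `φ`. -/
theorem D0.op_row_aux (hφ : IsSigB0 φ) : D0 M (fun e : (((Unit × M.Num) × M.Num) × M.Num) × M.Str =>
    e.1.2 = M.len (row e.2 e.1.1.2) ∧ Op φ a A e.1.1.1.2 (row e.2 e.1.1.2)) := by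
  let B : Fml (p + 3) (q + 1) := TwoSorted.rowLen (sv q) (nv (p + 1)) (nv (p + 2)) ⩓
    atRow φ (by omega) (by omega) (nv p) (sv q) (nv (p + 1)) (nv (p + 2))
  refine ⟨⟨p + 3, q + 1, fun e => Fin.snoc (Fin.snoc (Fin.snoc a e.1.1.1.2 : Fin (p + 1) → M.Num)
    e.1.1.2 : Fin (p + 2) → M.Num) e.1.2, fun e => Fin.snoc A e.2, fun i => ?_, fun i => ?_⟩,
    B, .and (.rowLen _ _ _) (hφ.subst _ _), fun e => ?_⟩
  · refine Fin.lastCases ?_ (fun i => ?_) i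
    · simpa using ⟨_, .inl rfl, rfl⟩
    refine Fin.lastCases ?_ (fun i => ?_) i
    · simpa using ⟨_, .inr ⟨_, .inl rfl, rfl⟩, rfl⟩
    refine Fin.lastCases ?_ (fun i => ?_) i
    · simpa using ⟨_, .inr ⟨_, .inr ⟨_, .inl rfl, rfl⟩, rfl⟩, rfl⟩
    · simpa using Ctx.const_num (a i)
  · refine Fin.lastCases ?_ (fun i => ?_) i
    · simpa using .inl rfl
    · simpa using Ctx.const_str (A i)
  · rw [realize_and, realize_rowLen, rowLen_iff]
    have hlt : ∀ (k : Fin p) (c : ℕ), k.1 < p + c := fun k c => by omega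
    have hlt' : ∀ (k : Fin q) (c : ℕ), k.1 < q + c := fun k c => by omega
    constructor
    · rintro ⟨h1, h2⟩
      rw [realize_atRow φ _ _ _ _ _ _ _ _ h1] at h2
      simp [snoc_mk, sv, Fin.castLE, hlt] at h1 h2
      exact ⟨h1, h2⟩
    · rintro ⟨h1, h2⟩
      have h1' : Tm.val M (Fin.snoc (Fin.snoc (Fin.snoc a e.1.1.1.2 : Fin (p + 1) → M.Num)
          e.1.1.2 : Fin (p + 2) → M.Num) e.1.2 : Fin (p + 3) → M.Num)
          (Fin.snoc A e.2 : Fin (q + 1) → M.Str) (nv (p + 2)) = M.len (row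
          ((Fin.snoc A e.2 : Fin (q + 1) → M.Str) (sv q)) (Tm.val M (Fin.snoc (Fin.snoc (Fin.snoc a
          e.1.1.1.2 : Fin (p + 1) → M.Num) e.1.1.2 : Fin (p + 2) → M.Num) e.1.2 :
          Fin (p + 3) → M.Num) (Fin.snoc A e.2 : Fin (q + 1) → M.Str) (nv (p + 1)))) := by
        simpa [snoc_mk, sv] using h1
      refine ⟨h1', ?_⟩
      rw [realize_atRow φ _ _ _ _ _ _ _ _ h1']
      simpa [snoc_mk, sv, Fin.castLE, hlt, hlt'] using h2

/-- The auxiliary row length is at most the length of the whole string, so it can be eliminated by a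
bounded quantifier. -/
theorem D0.op_row (hφ : IsSigB0 φ) {E : Type*} [Ctx M E] (f : E → M.Num) (Z : E → M.Str) (j : E → M.Num)
    [T0 f]
    [hZ : S0 Z] [T0 j] : D0 M (fun e => Op φ a A (f e) (row (Z e) (j e))) := by
  have := D0.op_row_aux a A hφ
  have : D0 M (fun e : ((E × M.Num) × M.Num) × M.Num =>
      e.2 = M.len (row (Z e.1.1.1) e.1.2) ∧ Op φ a A e.1.1.2 (row (Z e.1.1.1) e.1.2)) := by
    refine D0.reindex (fun e : (((Unit × M.Num) × M.Num) × M.Num) × M.Str =>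
      e.1.2 = M.len (row e.2 e.1.1.2) ∧ Op φ a A e.1.1.1.2 (row e.2 e.1.1.2))
      (fun e : ((E × M.Num) × M.Num) × M.Num => ((((((), e.1.1.2), e.1.2), e.2), Z e.1.1.1) :
        (((Unit × M.Num) × M.Num) × M.Num) × M.Str)) ?_ ?_
    · rintro _ ⟨_, rfl | ⟨_, rfl | ⟨_, rfl | ⟨h, -, rfl⟩, rfl⟩, rfl⟩, rfl⟩
      · exact .inl rfl
      · exact .inr ⟨_, .inl rfl, rfl⟩
      · exact .inr ⟨_, .inr ⟨_, .inl rfl, rfl⟩, rfl⟩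
      · exact Ctx.const_num (h ())
    · rintro _ (rfl | ⟨_, ⟨_, ⟨_, ⟨h, -, rfl⟩, rfl⟩, rfl⟩, rfl⟩)
      · exact ⟨_, ⟨_, ⟨_, hZ.out, rfl⟩, rfl⟩, rfl⟩
      · exact Ctx.const_str (h ())
  have := T0.weaken M.Num f
  have := T0.weaken M.Num j
  have := T0.weaken M.Num fun e : E × M.Num => j e.1
  have := S0.weaken M.Num Z
  have := S0.weaken M.Num fun e : E × M.Num => Z e.1
  have h : (fun e => Op φ a A (f e) (row (Z e) (j e))) = fun e =>
      ∃ c ≤ f e, c = f e ∧ ∃ d ≤ j e, d = j e ∧ ∃ l ≤ M.len (Z e),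
        (l = M.len (row (Z e) d) ∧ Op φ a A c (row (Z e) d)) := funext fun e =>
    propext ⟨fun h => ⟨_, le_rfl, rfl, _, le_rfl, rfl, _, row_len_le _ _, rfl, h⟩,
      by rintro ⟨_, _, rfl, _, _, rfl, _, _, _, h⟩; exact h⟩
  rw [h]
  infer_instance

variable (φ) in
/-- The rows `0, …, v` of `Z` are the iterates of `φ` on `x` bits. -/
def Iter (x v : M.Num) (Z : M.Str) : Prop :=
  (∀ j ≤ v, ∀ i, npair j i ∈ Z → i < x) ∧ (∀ i, npair 0 i ∉ Z) ∧
    ∀ j < v, ∀ i < x, npair (j + 1) i ∈ Z ↔ Op φ a A i (row Z j)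

theorem exists_iter (hφ : IsSigB0 φ) (x v : M.Num) :
    ∃ Z, M.len Z ≤ npair v x + 1 ∧ Iter φ a A x v Z := by
  have := D0.op_row (M := M) a A hφ
    (fun e : ((((Unit × M.Num) × M.Str) × M.Num) × M.Num) => e.2) (fun e => e.1.1.2)
    (fun e => e.1.2)
  -- Induction on the number of completed steps. The bounds `i < M.len Z` make the predicate Σᴮ₀ and
  -- lose nothing, because elements of rows satisfy them.
  have key := ind_ex (M := M) (fun n Z => (∀ j ≤ v, ∀ i < M.len Z, npair j i ∈ Z → i < x) ∧
      (∀ i < M.len Z, npair 0 i ∉ Z) ∧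
      ∀ j < n, ∀ i < x, npair (j + 1) i ∈ Z ↔ Op φ a A i (row Z j)) (npair v x + 1) v
  have key' := key ?_ ?_
  · obtain ⟨Z, hZ, h1, h2, h3⟩ := key'
    have hlt : ∀ {j i}, npair j i ∈ Z → i < M.len Z := fun h => (rowMem_iff.2 h).1
    exact ⟨Z, hZ, fun j hj i h => h1 j hj i (hlt h) h, fun i h => h2 i (hlt h) h, h3⟩
  · obtain ⟨Z, hZ, h⟩ := comp' (M := M) (fun _ => False) (npair v x + 1)
    exact ⟨Z, hZ, fun j _ i _ hm => ((h _).1 hm).2.elim, fun i _ hm => ((h _).1 hm).2,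
      fun j hj => absurd hj (not_lt.2 (num_nonneg j))⟩
  · rintro n hn Z hZ ⟨h1, h2, h3⟩
    have := D0.op_row (M := M) a A hφ (fun e : ((Unit × M.Num) × M.Num) => e.2) (fun _ => Z)
      (fun _ => n)
    -- The rows up to `n` are copied and row `n + 1` is computed from row `n`; requiring `i < x`
    -- keeps every row within `x` bits.
    obtain ⟨Z', hZ', h⟩ := comp_pair (M := M) (fun j i => i < x ∧
      ((j ≤ n ∧ npair j i ∈ Z) ∨ (j = n + 1 ∧ Op φ a A i (row Z n)))) v x
    have hn1 : n < n + 1 := num_lt_succ.2 le_rfl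
    have hold : ∀ j ≤ n, ∀ i, npair j i ∈ Z' ↔ npair j i ∈ Z := by
      refine fun j hj i => (h j i).trans ⟨?_, fun hm => ?_⟩
      · rintro ⟨-, -, -, ⟨-, hm⟩ | ⟨rfl, -⟩⟩
        · exact hm
        · exact absurd hj (not_le.2 hn1)
      · have hi := h1 j (hj.trans hn.le) i (rowMem_iff.2 hm).1 hm
        exact ⟨hj.trans hn.le, hi.le, hi, .inl ⟨hj, hm⟩⟩
    have hrow : ∀ j ≤ n, row Z' j = row Z j := fun j hj =>
      str_ext fun i => by rw [mem_row, mem_row, hold j hj]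
    refine ⟨Z', hZ', fun j _ i _ hm => ((h j i).1 hm).2.2.1, fun i _ hm => ?_, fun j hj i hi => ?_⟩
    · have hm := (hold 0 (num_nonneg n) i).1 hm
      exact h2 i (rowMem_iff.2 hm).1 hm
    · rw [hrow j (num_lt_succ.1 hj)]
      rcases (num_lt_succ.1 hj).lt_or_eq with hj | rfl
      · rw [hold _ (num_succ_le.2 hj), h3 j hj i hi]
      · refine (h _ _).trans ⟨?_, fun hm => ⟨num_succ_le.2 hn, hi.le, hi, .inr ⟨rfl, hm⟩⟩⟩
        rintro ⟨-, -, -, ⟨hj', -⟩ | ⟨-, hm⟩⟩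
        · exact absurd hj' (not_le.2 hn1)
        · exact hm

variable {a A}

/-- Induction on `j` compares the rows only below `x`, which is a Σᴮ₀ statement; the length bound on
rows upgrades it to equality of strings, as needed for applying the operator. The two tables may
have different heights. -/
theorem Iter.row_eq {x v v' : M.Num} {Z Z' : M.Str} (h : Iter φ a A x v Z)
    (h' : Iter φ a A x v' Z') {j : M.Num} (hj : j ≤ v) (hj' : j ≤ v') : row Z j = row Z' j := by
  have ext : ∀ j ≤ v, j ≤ v' → (∀ i < x, npair j i ∈ Z ↔ npair j i ∈ Z') → row Z j = row Z' j := by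
    intro j hj hj' hi
    refine str_ext fun i => ?_
    rw [mem_row, mem_row]
    exact ⟨fun hm => (hi i (h.1 j hj i hm)).1 hm, fun hm => (hi i (h'.1 j hj' i hm)).2 hm⟩
  have key : ∀ j : M.Num, j ≤ v → j ≤ v' → ∀ i < x, npair j i ∈ Z ↔ npair j i ∈ Z' := by
    refine ind (fun j : M.Num => j ≤ v → j ≤ v' → ∀ i < x, npair j i ∈ Z ↔ npair j i ∈ Z') ?_ ?_
    · exact fun _ _ i _ => iff_of_false (h.2.1 i) (h'.2.1 i)
    · intro j ih hj hj' i hi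
      have hjv : j ≤ v := le_self_add.trans hj
      have hjv' : j ≤ v' := le_self_add.trans hj'
      rw [h.2.2 j (num_succ_le.1 hj) i hi, h'.2.2 j (num_succ_le.1 hj') i hi,
        ext j hjv hjv' (ih hjv hjv')]
  exact ext j hj hj' (key j hj hj')

/-- The iterates of an inflationary operator on `x` bits are constant from a number `v ≤ x` on. -/
theorem Iter.exists_fixed {x : M.Num} {Z : M.Str} (h : Iter φ a A x (x + 1) Z)
    (hinf : ∀ Y, M.len Y ≤ x → ∀ i < x, i ∈ Y → Op φ a A i Y) :
    ∃ v ≤ x, ∀ i, i ∈ row Z (v + 1) ↔ i ∈ row Z v := by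
  have hx : x < x + 1 := num_lt_succ.2 le_rfl
  have mono : ∀ j ≤ x, ∀ i, npair j i ∈ Z → npair (j + 1) i ∈ Z := by
    intro j hj i hi
    have hjx := hj.trans hx.le
    have hix := h.1 j hjx i hi
    refine (h.2.2 j (hj.trans_lt hx) i hix).2 (hinf _ ?_ i hix (mem_row.2 hi))
    exact len_le_of fun k hk => h.1 j hjx k (mem_row.1 hk)
  have mono' : ∀ j i, npair j i ∈ Z → ∀ k : M.Num, j ≤ k → k ≤ x + 1 → npair k i ∈ Z := by
    intro j i hi
    refine ind (fun k : M.Num => j ≤ k → k ≤ x + 1 → npair k i ∈ Z) ?_ ?_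
    · intro hj _
      rwa [le_antisymm hj (num_nonneg j)] at hi
    · intro k ih hjk hk
      rcases hjk.lt_or_eq with hjk | rfl
      · exact mono k (num_lt_succ.1 (num_succ_le.1 hk)) i (ih (num_lt_succ.1 hjk)
          (le_self_add.trans hk))
      · exact hi
  by_contra! hne
  -- `F` relates a stage `j ≤ x` to the bits `i < x` that appear at that stage. Without a fixed
  -- point each of the `x + 1` stages has one, and since bits never disappear, none appears at two
  -- stages.
  obtain ⟨F, -, hF⟩ := comp_pair (M := M) (fun j i => npair (j + 1) i ∈ Z ∧ npair j i ∉ Z) x x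
  refine pigeonhole F x (fun j hj => ?_) fun j hj j' hj' i hi h1 h2 => ?_
  · obtain ⟨i, hi⟩ := hne j hj
    rw [mem_row, mem_row] at hi
    have hi' : npair (j + 1) i ∈ Z ∧ npair j i ∉ Z := by
      rcases hi with hi | hi
      · exact hi
      · exact absurd (mono j hj i hi.2) hi.1
    have hix := h.1 (j + 1) (by gcongr) i hi'.1
    exact ⟨i, hix, (hF j i).2 ⟨hj, hix.le, hi'⟩⟩
  · have key : ∀ j j', j' ≤ x → npair j i ∈ F → npair j' i ∈ F → ¬ j < j' := by
      intro j j' hj' h1 h2 hlt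
      exact ((hF _ _).1 h2).2.2.2 (mono' _ _ ((hF _ _).1 h1).2.2.1 j' (num_succ_le.2 hlt)
        (hj'.trans hx.le))
    exact le_antisymm (not_lt.1 (key _ _ hj h2 h1)) (not_lt.1 (key _ _ hj' h1 h2))

/-! ### The formula `ψ` -/

variable (φ a A) in
/-- The strings `W, V, Z` witness that `Y` is the `X`-th iterate. -/
def PsiMatrix (x y : M.Num) (X Y W V Z : M.Str) : Prop :=
  ∃ n ≤ y, ∃ v ≤ (1 + 1) * y + 1, BinLenW y n W ∧ M.len V ≤ npair n ((1 + 1) * y + 1) + 1 ∧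
    ValW n v X V ∧ M.len Z ≤ npair v x + 1 ∧ Iter φ a A x v Z ∧ Y = row Z v

variable (φ a A) in
def Psi (x y : M.Num) (X Y : M.Str) : Prop :=
  ∃ W, M.len W ≤ npair y ((1 + 1) * y + 1) + 1 ∧ ∃ V, M.len V ≤ npair y ((1 + 1) * y + 1) + 1 ∧
    ∃ Z, M.len Z ≤ npair ((1 + 1) * y + 1) x + 1 ∧ PsiMatrix φ a A x y X Y W V Z

theorem PsiMatrix.len_le {x y : M.Num} {X Y W V Z : M.Str}
    (h : PsiMatrix φ a A x y X Y W V Z) : M.len Y ≤ x := by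
  obtain ⟨n, -, v, -, -, -, -, -, hI, rfl⟩ := h
  exact len_le_of fun i hi => hI.1 v le_rfl i (mem_row.1 hi)

theorem PsiMatrix.unique {x y : M.Num} {X Y W V Z Y' W' V' Z' : M.Str}
    (h : PsiMatrix φ a A x y X Y W V Z) (h' : PsiMatrix φ a A x y X Y' W' V' Z') : Y = Y' := by
  obtain ⟨n, -, v, -, hn, -, hv, -, hI, rfl⟩ := h
  obtain ⟨n', -, v', -, hn', -, hv', -, hI', rfl⟩ := h'
  obtain rfl := hn.unique hn'
  obtain rfl := hv.unique hv'
  exact hI.row_eq hI' le_rfl le_rfl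

/-- Only |y| leading bits of `X` are read, which bounds `v` by 2y + 1 for strings `X` of any length.
The equivalence with the Πᴮ₁ form needs totality in this generality. -/
theorem exists_psi (hφ : IsSigB0 φ) (x y : M.Num) (X : M.Str) :
    ∃ Y, M.len Y ≤ x ∧ Psi φ a A x y X Y := by
  obtain ⟨n, hny, W, hW, hn⟩ := exists_binLenW y
  obtain ⟨v, hvy, V, hV, hv⟩ := hn.exists_valW X
  obtain ⟨Z, hZ, hI⟩ := exists_iter a A hφ x v
  have h : PsiMatrix φ a A x y X (row Z v) W V Z := ⟨n, hny, v, hvy, hn, hV, hv, hZ, hI, rfl⟩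
  refine ⟨_, h.len_le, W, hW, V, hV.trans ?_, Z, hZ.trans ?_, h⟩
  · exact add_le_add_left (npair_le_npair hny le_rfl) 1
  · exact add_le_add_left (npair_le_npair hvy le_rfl) 1

/-- The fixed point of an inflationary operator, as the iterate of a string `U`. -/
theorem exists_fixedPoint (hφ : IsSigB0 φ) {x : M.Num}
    (hinf : ∀ Y, M.len Y ≤ x → ∀ i < x, i ∈ Y → Op φ a A i Y) {n : M.Num} {W : M.Str}
    (hn : BinLenW x n W) : ∃ U, M.len U ≤ n ∧ ∀ U', IsSucc U U' → ∀ Y Y',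
      Psi φ a A x ((1 + 1) * x) U' Y → Psi φ a A x ((1 + 1) * x) U Y' →
        ∀ i < x, i ∈ Y ↔ i ∈ Y' := by
  -- The identity |2x| = |x| + 1 fails at `x = 0`, where there are no bits to compare.
  rcases num_cases x with rfl | hx
  · obtain ⟨U, hU, -⟩ := comp' (M := M) (fun _ => False) n
    exact ⟨U, hU, fun _ _ _ _ _ _ i hi => absurd hi (not_lt.2 (num_nonneg i))⟩
  have hx : 0 < x := by
    obtain ⟨y, rfl⟩ := hx
    exact num_lt_succ.2 (num_nonneg y)
  obtain ⟨m, -, W', -, hm⟩ := exists_binLenW ((1 + 1) * x)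
  obtain ⟨n', rfl, hn'⟩ := hm.half hx
  obtain rfl := hn.unique hn'
  obtain ⟨Z, -, hZ⟩ := exists_iter a A hφ x (x + 1)
  obtain ⟨v, hv, hfix⟩ := hZ.exists_fixed hinf
  obtain ⟨q, -, hq, hxq⟩ := hn'.2.2
  -- The witness: `v ≤ x < 2^|x|`, so `v` has a binary expansion of at most `|x|` bits.
  obtain ⟨U, hU, hUL⟩ := hn'.powSeq.exists_str hq (hv.trans_lt hxq)
  have hlt : n < n + 1 := num_lt_succ.2 le_rfl
  refine ⟨U, hU, ?_⟩
  rintro U' hS Y Y' ⟨W₁, -, V₁, -, Z₁, -, n₁, -, v₁, -, hn₁, -, hv₁, -, hI₁, rfl⟩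
    ⟨W₂, -, V₂, -, Z₂, -, n₂, -, v₂, -, hn₂, -, hv₂, -, hI₂, rfl⟩ i hi
  obtain rfl := hm.unique hn₁
  obtain rfl := hm.unique hn₂
  obtain ⟨L, hL⟩ := hm.powSeq.exists_lowSeq U
  obtain ⟨L', hL'⟩ := hm.powSeq.exists_lowSeq U'
  have hLn : SeqEq L n v := hUL L ⟨hL.1, fun i hi => hL.2 i (hi.trans hlt)⟩
  -- Bit `n` of `U` is zero because its length is at most `n`, so the value is unchanged at `n + 1 =
  -- |2x|`, the number of bits that `ψ` reads.
  have hLv : SeqEq L (n + 1) v := by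
    obtain ⟨c, -, -, -, hc, -, -, hc'⟩ := hL.2 n hlt
    obtain rfl := hc.unique hLn
    exact hc' fun hnU => absurd (ax_l1 hnU) (not_lt.2 hU)
  obtain ⟨b, -, hb⟩ := hL'.exists _ le_rfl
  obtain rfl := hS.lowSeq hm.powSeq hL hL' (num_lt_succ.2 hU) hLv hb
  obtain rfl := hL'.eq_val hm.powSeq (hS.len_le.trans (by gcongr)) hv₁ hb
  obtain rfl := hL.eq_val hm.powSeq (hU.trans hlt.le) hv₂ hLv
  rw [hI₁.row_eq hZ le_rfl (by gcongr), hI₂.row_eq hZ le_rfl (hv.trans le_self_add)]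
  exact hfix i

end Iterates

/-! ## The formulas of the theorem -/

section Formulas

variable {M : Struct.{u, v}} {n m p q : ℕ}

theorem realize_seqEq (W : Fin m) (j t : Tm n m) (a : Fin n → M.Num) (A : Fin m → M.Str) :
    (seqEq W j t).Realize M a A ↔ SeqEq (A W) (j.val M a A) (t.val M a A) := by
  simp [seqEq, SeqEq]

theorem realize_binLenW (x l : Tm n m) (W : Fin m) (a : Fin n → M.Num) (A : Fin m → M.Str) :
    (binLenW x l W).Realize M a A ↔ BinLenW (x.val M a A) (l.val M a A) (A W) := by
  simp [binLenW, BinLenW, realize_seqEq]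

theorem realize_topBit (X : Fin m) (j : Tm n m) (a : Fin n → M.Num) (A : Fin m → M.Str) :
    (topBit X j).Realize M a A ↔ TopBit (A X) (j.val M a A) := by
  simp [topBit, TopBit]

theorem realize_valW (x z : Tm n m) (X V : Fin m) (a : Fin n → M.Num) (A : Fin m → M.Str) :
    (valW x z X V).Realize M a A ↔ ValW (x.val M a A) (z.val M a A) (A X) (A V) := by
  simp [valW, ValW, realize_seqEq, realize_topBit]

theorem IsSigB0.seqEq (W : Fin m) (j t : Tm n m) : IsSigB0 (seqEq W j t) :=
  .or (.and (.lt _ _) (.and (.mem _ _) (.allLt _ (.not (.mem _ _)))))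
    (.and (.eq _ _) (.allLt _ (.not (.mem _ _))))

theorem IsSigB0.binLenW (x l : Tm n m) (W : Fin m) : IsSigB0 (binLenW x l W) :=
  .and (.seqEq _ _ _) (.and (.allLt _ (.exLe _ (.and (.seqEq _ _ _) (.and (.le _ _)
    (.seqEq _ _ _))))) (.exLe _ (.and (.seqEq _ _ _) (.lt _ _))))

theorem IsSigB0.topBit (X : Fin m) (j : Tm n m) : IsSigB0 (topBit X j) :=
  .exLt _ (.and (.eq _ _) (.mem _ _))

theorem IsSigB0.valW (x z : Tm n m) (X V : Fin m) : IsSigB0 (valW x z X V) :=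
  .or (.and (.eq _ _) (.eq _ _)) (.and (.not (.eq _ _)) (.and (.seqEq _ _ _) (.and (.seqEq _ _ _)
    (.allLt _ (.exLe _ (.and (.seqEq _ _ _) (.and (.imp (.le _ _) (.seqEq _ _ _))
      (.and (.imp (.and (.lt _ _) (.not (.topBit _ _))) (.seqEq _ _ _))
        (.imp (.and (.lt _ _) (.topBit _ _)) (.seqEq _ _ _))))))))))

theorem IsSigB0.iterW {φ : Fml (p + 1) (q + 1)} (hφ : IsSigB0 φ) : IsSigB0 (iterW φ) :=
  .and (.allLe _ (.allLt _ (.imp (.rowMem _ _ _) (.lt _ _))))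
    (.and (.allLt _ (.not (.rowMem _ _ _)))
      (.and (.allLt _ (.iff (.rowMem _ _ _) (.mem _ _)))
        (.allLt _ (.allLt _ (.exLe _ (.and (.rowLen _ _ _)
          (.iff (.rowMem _ _ _) (hφ.subst _ _))))))))

/-- The `Σᴮ₀` part of the formula `ψ`. -/
def psiMatrix (φ : Fml (p + 1) (q + 1)) : Fml (p + 2) (q + 5) :=
  exLe (nv (p + 1)) (exLe (nv (p + 1)).dbl.succ
    (binLenW (nv (p + 1)) (nv (p + 2)) (sv (q + 2)) ⩓
      .le (.len (sv (q + 3))) (Tm.pair (nv (p + 2)) (nv (p + 1)).dbl.succ).succ ⩓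
      valW (nv (p + 2)) (nv (p + 3)) (sv q) (sv (q + 3)) ⩓
      .le (.len (sv (q + 4))) (Tm.pair (nv (p + 3)) (nv p)).succ ⩓
      iterW φ))

theorem IsSigB0.psiMatrix {φ : Fml (p + 1) (q + 1)} (hφ : IsSigB0 φ) : IsSigB0 (psiMatrix φ) :=
  .exLe _ (.exLe _ (.and (.binLenW _ _ _) (.and (.le _ _) (.and (.valW _ _ _ _)
    (.and (.le _ _) (.iterW hφ))))))

theorem isSigB1_psiP {φ : Fml (p + 1) (q + 1)} (hφ : IsSigB0 φ) : IsSigB1 (psiP φ) :=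
  .step (Tm.pair (nv (p + 1)) (nv (p + 1)).dbl.succ).succ
    (.step (Tm.pair (nv (p + 1)) (nv (p + 1)).dbl.succ).succ
      (.step (Tm.pair (nv (p + 1)).dbl.succ (nv p)).succ (.base (.psiMatrix hφ))))

theorem fin_lt_add (k : Fin p) (c : ℕ) : k.1 < p + c := by omega

variable [V1Model M]

theorem realize_rowMem (Z : Fin m) (j i : Tm n m) (a : Fin n → M.Num) (A : Fin m → M.Str) :
    (rowMem Z j i).Realize M a A ↔ npair (j.val M a A) (i.val M a A) ∈ A Z :=
  rowMem_iff (Z := A Z)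

/-- The innermost quantified number can only be the length of row `j`, which is at most `x`, so
bounding it by `x` is harmless. -/
theorem realize_iterW (φ : Fml (p + 1) (q + 1)) (a : Fin (p + 4) → M.Num)
    (A : Fin (q + 5) → M.Str) :
    (iterW φ).Realize M a A ↔
      Iter φ (fun k => a (k.castLE (by omega))) (fun k => A (k.castLE (by omega)))
        (a ⟨p, by omega⟩) (a ⟨p + 3, by omega⟩) (A ⟨q + 4, by omega⟩) ∧
      A ⟨q + 1, by omega⟩ = row (A ⟨q + 4, by omega⟩) (a ⟨p + 3, by omega⟩) := by
  have hrow : ∀ (j i c : M.Num),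
      (rowLen (sv (q + 4)) (nv (p + 4)) (nv (p + 6)) ⩓
        (rowMem (sv (q + 4)) (nv (p + 4)).succ (nv (p + 5)) ⟺ᶠ
        atRow φ (by omega) (by omega) (nv (p + 5)) (sv (q + 4)) (nv (p + 4)) (nv (p + 6))) :
        Fml (p + 7) (q + 5)).Realize M
        (Fin.snoc (Fin.snoc (Fin.snoc a j : Fin (p + 5) → M.Num) i : Fin (p + 6) → M.Num) c) A ↔
      c = M.len (row (A ⟨q + 4, by omega⟩) j) ∧ (npair (j + 1) i ∈ A ⟨q + 4, by omega⟩ ↔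
        Op φ (fun k => a (k.castLE (by omega))) (fun k => A (k.castLE (by omega))) i
          (row (A ⟨q + 4, by omega⟩) j)) := by
    intro j i c
    have h0 : ((rowLen (sv (q + 4)) (nv (p + 4)) (nv (p + 6)) : Fml (p + 7) (q + 5)).Realize M
        (Fin.snoc (Fin.snoc (Fin.snoc a j : Fin (p + 5) → M.Num) i : Fin (p + 6) → M.Num) c) A) ↔
        c = M.len (row (A ⟨q + 4, by omega⟩) j) := by
      rw [realize_rowLen, rowLen_iff]
      simp [snoc_mk, sv]
    rw [realize_and, h0]
    refine and_congr_right fun hc => ?_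
    rw [realize_iff, realize_atRow φ _ _ _ _ _ _ _ _ (by simpa [snoc_mk, sv] using hc)]
    simp [snoc_mk, sv, realize_rowMem, Fin.castLE, fin_lt_add]
  have h : (iterW φ).Realize M a A ↔
      (∀ j ≤ a ⟨p + 3, by omega⟩, ∀ i < M.len (A ⟨q + 4, by omega⟩),
        npair j i ∈ A ⟨q + 4, by omega⟩ → i < a ⟨p, by omega⟩) ∧
      (∀ i < M.len (A ⟨q + 4, by omega⟩), npair 0 i ∉ A ⟨q + 4, by omega⟩) ∧
      (∀ i < M.len (A ⟨q + 4, by omega⟩) + M.len (A ⟨q + 1, by omega⟩),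
        npair (a ⟨p + 3, by omega⟩) i ∈ A ⟨q + 4, by omega⟩ ↔ i ∈ A ⟨q + 1, by omega⟩) ∧
      ∀ j < a ⟨p + 3, by omega⟩, ∀ i < a ⟨p, by omega⟩, ∃ c ≤ a ⟨p, by omega⟩,
        c = M.len (row (A ⟨q + 4, by omega⟩) j) ∧ (npair (j + 1) i ∈ A ⟨q + 4, by omega⟩ ↔
        Op φ (fun k => a (k.castLE (by omega))) (fun k => A (k.castLE (by omega))) i
          (row (A ⟨q + 4, by omega⟩) j)) := by
    refine and_congr ?_ (and_congr ?_ (and_congr ?_ ?_))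
    · simp [snoc_mk, sv, realize_rowMem]
    · simp [snoc_mk, sv, realize_rowMem]
    · simp [snoc_mk, sv, realize_rowMem]
    · simp only [realize_allLt, realize_exLe, hrow]
      simp [snoc_mk]
  have hlt : ∀ {Z : M.Str} {j i}, npair j i ∈ Z → i < M.len Z := fun h => (rowMem_iff.2 h).1
  rw [h]
  constructor
  · rintro ⟨h1, h2, h3, h4⟩
    refine ⟨⟨fun j hj i hi => h1 j hj i (hlt hi) hi, fun i hi => h2 i (hlt hi) hi,
      fun j hj i hi => ?_⟩, str_ext fun i => ?_⟩
    · obtain ⟨c, -, -, hc⟩ := h4 j hj i hi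
      exact hc
    · rw [mem_row]
      -- The bound `|Z| + |Y|` covers the elements of the row and those of `Y`, so agreement below
      -- it is full equality.
      exact ⟨fun hi => (h3 i ((ax_l1 hi).trans_le le_add_self)).2 hi,
        fun hi => (h3 i ((hlt hi).trans_le le_self_add)).1 hi⟩
  · rintro ⟨⟨h1, h2, h3⟩, h4⟩
    refine ⟨fun j hj i _ hi => h1 j hj i hi, fun i _ => h2 i, fun i _ => ?_, fun j hj i hi =>
      ⟨_, len_le_of fun k hk => h1 j hj.le k (mem_row.1 hk), rfl, h3 j hj i hi⟩⟩
    rw [h4, mem_row]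

theorem realize_psiMatrix (φ : Fml (p + 1) (q + 1)) (a : Fin (p + 2) → M.Num)
    (A : Fin (q + 5) → M.Str) :
    (psiMatrix φ).Realize M a A ↔
      PsiMatrix φ (fun k => a (k.castLE (by omega))) (fun k => A (k.castLE (by omega)))
        (a ⟨p, by omega⟩) (a ⟨p + 1, by omega⟩) (A ⟨q, by omega⟩) (A ⟨q + 1, by omega⟩)
        (A ⟨q + 2, by omega⟩) (A ⟨q + 3, by omega⟩) (A ⟨q + 4, by omega⟩) := by
  simp [psiMatrix, PsiMatrix, realize_binLenW, realize_valW, realize_iterW, snoc_mk, sv,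
    Fin.castLE, fin_lt_add, Nat.add_assoc]

theorem realize_psiP (φ : Fml (p + 1) (q + 1)) (a : Fin (p + 2) → M.Num)
    (A : Fin (q + 2) → M.Str) :
    (psiP φ).Realize M a A ↔
      Psi φ (fun k => a (k.castLE (by omega))) (fun k => A (k.castLE (by omega)))
        (a ⟨p, by omega⟩) (a ⟨p + 1, by omega⟩) (A ⟨q, by omega⟩) (A ⟨q + 1, by omega⟩) := by
  change (exSLe _ (exSLe _ (exSLe _ (psiMatrix φ)))).Realize M a A ↔ _
  simp [Psi, realize_psiMatrix, snoc_mk, Fin.castLE, fin_lt_add, Nat.add_assoc]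

theorem realize_psiPAt (φ : Fml (p + 1) (q + 1)) (hp : p ≤ n) (hq : q ≤ m) (x y : Tm n m)
    (X Y : Fin m) (a : Fin n → M.Num) (A : Fin m → M.Str) :
    (psiPAt φ hp hq x y X Y).Realize M a A ↔
      Psi φ (fun k => a (k.castLE hp)) (fun k => A (k.castLE hq)) (x.val M a A) (y.val M a A)
        (A X) (A Y) := by
  refine (realize_subst (psiP φ) (C := Fin.snoc (Fin.snoc (fun k => A (k.castLE hq)) (A X) :
    Fin (q + 1) → M.Str) (A Y)) fun k => ?_).trans ?_
  · refine Fin.lastCases ?_ (fun k => ?_) k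
    · simp [STm.Eval]
    · refine Fin.lastCases ?_ (fun k => ?_) k <;> simp [STm.Eval]
  · rw [realize_psiP]
    simp [snoc_mk, Fin.castLE]

/-- The renaming of the variables of `psiMatrix` that makes room for one more variable after
`Y`, which takes the place of `Y`. -/
def skipIndex (k : Fin (q + 5)) : Fin (q + 6) :=
  if k.1 < q + 1 then ⟨k.1, by omega⟩ else ⟨k.1 + 1, by omega⟩

/-- A `Πᴮ₁` formula equivalent to `ψ`: every string that satisfies `ψ` in the place of `Y` is
`Y`. -/
def psiPi (φ : Fml (p + 1) (q + 1)) : Fml (p + 2) (q + 2) :=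
  allSLe (nv p)
    (allSLe (Tm.pair (nv (p + 1)) (nv (p + 1)).dbl.succ).succ
      (allSLe (Tm.pair (nv (p + 1)) (nv (p + 1)).dbl.succ).succ
        (allSLe (Tm.pair (nv (p + 1)).dbl.succ (nv p)).succ
          ((psiMatrix φ).subst (fun k => .var k) (fun k => .var (skipIndex k)) ⟹ᶠ
            .strEq (sv (q + 2)) (sv (q + 1))))))

theorem isPiB1_psiPi {φ : Fml (p + 1) (q + 1)} (hφ : IsSigB0 φ) : IsPiB1 (psiPi φ) :=
  .step (nv p) (.step (Tm.pair (nv (p + 1)) (nv (p + 1)).dbl.succ).succ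
    (.step (Tm.pair (nv (p + 1)) (nv (p + 1)).dbl.succ).succ
      (.step (Tm.pair (nv (p + 1)).dbl.succ (nv p)).succ
        (.base (.imp (IsSigB0.subst (.psiMatrix hφ) _ _) (.strEq _ _))))))

theorem realize_psiPi (φ : Fml (p + 1) (q + 1)) (a : Fin (p + 2) → M.Num)
    (A : Fin (q + 2) → M.Str) :
    (psiPi φ).Realize M a A ↔ ∀ Y', M.len Y' ≤ a ⟨p, by omega⟩ →
      Psi φ (fun k => a (k.castLE (by omega))) (fun k => A (k.castLE (by omega)))
        (a ⟨p, by omega⟩) (a ⟨p + 1, by omega⟩) (A ⟨q, by omega⟩) Y' →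
      Y' = A ⟨q + 1, by omega⟩ := by
  have h : ∀ B : Fin (q + 6) → M.Str, ((psiMatrix φ).subst (fun k => .var k)
      (fun k => .var (skipIndex k))).Realize M a B ↔
      PsiMatrix φ (fun k => a (k.castLE (by omega))) (fun k => B (k.castLE (by omega)))
        (a ⟨p, by omega⟩) (a ⟨p + 1, by omega⟩) (B ⟨q, by omega⟩) (B ⟨q + 2, by omega⟩)
        (B ⟨q + 3, by omega⟩) (B ⟨q + 4, by omega⟩) (B ⟨q + 5, by omega⟩) := by
    intro B
    refine (realize_rename (psiMatrix φ) id _).trans ?_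
    rw [realize_psiMatrix]
    simp [skipIndex, Fin.castLE, Nat.add_assoc]
  simp [psiPi, h, Psi, snoc_mk, sv, Fin.castLE, fin_lt_add, Nat.add_assoc]

theorem realize_existsUniqueIterate (φ : Fml (p + 1) (q + 1)) (a : Fin (p + 2) → M.Num)
    (A : Fin (q + 1) → M.Str)
    (h : ∃ Y, M.len Y ≤ a ⟨p, by omega⟩ ∧
      Psi φ (fun k => a (k.castLE (by omega))) (fun k => A (k.castLE (by omega)))
        (a ⟨p, by omega⟩) (a ⟨p + 1, by omega⟩) (A ⟨q, by omega⟩) Y ∧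
      ∀ Y', M.len Y' ≤ a ⟨p, by omega⟩ →
        Psi φ (fun k => a (k.castLE (by omega))) (fun k => A (k.castLE (by omega)))
          (a ⟨p, by omega⟩) (a ⟨p + 1, by omega⟩) (A ⟨q, by omega⟩) Y' → Y' = Y) :
    (existsUniqueIterate φ).Realize M a A := by
  rw [existsUniqueIterate, realize_imp]
  intro _
  simpa [realize_psiPAt, snoc_mk, sv, Fin.castLE, fin_lt_add, Nat.add_assoc] using h

theorem realize_inflationary (φ : Fml (p + 1) (q + 1)) (a : Fin (p + 1) → M.Num)
    (A : Fin q → M.Str) :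
    (inflationary φ).Realize M a A ↔ ∀ Y, M.len Y ≤ a ⟨p, by omega⟩ → ∀ i < a ⟨p, by omega⟩,
      i ∈ Y → Op φ (fun k => a (k.castLE (by omega))) A i Y := by
  have h : ∀ (i : M.Num) (Y : M.Str), (φ.subst (Fin.snoc
      (fun k => .var (k.castLE (by omega))) (nv (p + 1)) : Fin (p + 1) → Tm (p + 2) (q + 1))
      (fun k => .var k)).Realize M (Fin.snoc a i : Fin (p + 2) → M.Num) (Fin.snoc A Y) ↔
      Op φ (fun k => a (k.castLE (by omega))) A i Y := by
    intro i Y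
    refine (realize_subst φ (C := Fin.snoc A Y) fun _ => by simp [STm.Eval]).trans ?_
    refine iff_of_eq (congrArg (φ.Realize M · _) (funext fun k => ?_))
    refine Fin.lastCases ?_ (fun k => ?_) k <;> simp [snoc_mk, Fin.castLE]
  simp [inflationary, h, snoc_mk, sv]

theorem realize_existsFixedPoint (φ : Fml (p + 1) (q + 1)) (a : Fin (p + 1) → M.Num)
    (A : Fin q → M.Str)
    (h : ∃ (n : M.Num) (T U U' : M.Str),
      (∃ W, M.len W ≤ npair (a ⟨p, by omega⟩) ((1 + 1) * a ⟨p, by omega⟩ + 1) + 1 ∧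
        BinLenW (a ⟨p, by omega⟩) n W) ∧
      (∀ i, i ∈ T ↔ i < n) ∧
      (U = T ∨ M.len U ≤ M.len T ∧ ∃ i ≤ M.len T,
        (∀ j ≤ M.len T, i < j → j ∈ U → j ∈ T) ∧ i ∈ T ∧ i ∉ U) ∧
      IsSucc U U' ∧
      ∀ Y Z, Psi φ (fun k => a (k.castLE (by omega))) A (a ⟨p, by omega⟩)
          ((1 + 1) * a ⟨p, by omega⟩) U' Y →
        Psi φ (fun k => a (k.castLE (by omega))) A (a ⟨p, by omega⟩)
          ((1 + 1) * a ⟨p, by omega⟩) U Z → ∀ i < a ⟨p, by omega⟩, i ∈ Y ↔ i ∈ Z) :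
    (existsFixedPoint φ).Realize M a A := by
  obtain ⟨n, T, U, U', h1, h2, h3, h4, h5⟩ := h
  refine ⟨n, T, U, U', ?_, ?_, ?_, ?_, ?_⟩
  · simpa [binLen, realize_binLenW, snoc_mk, sv] using h1
  · simpa [isOne, snoc_mk, sv] using h2
  · simpa [strLe, strLt, snoc_mk, sv] using h3
  · simpa [isSucc, IsSucc, snoc_mk, sv] using h4
  · simpa [realize_psiPAt, snoc_mk, sv, Fin.castLE, fin_lt_add, Nat.add_assoc] using h5

end Formulas

end TwoSorted

/-! ### The three claims in an arbitrary model -/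

open TwoSorted in
theorem mainTheorem4 {p q : ℕ} (φ : TwoSorted.Fml (p + 1) (q + 1)) (hφ : TwoSorted.IsSigB0 φ) :
    TwoSorted.IsDelB1.{u, v} TwoSorted.V1 (TwoSorted.psiP φ) ∧
    TwoSorted.Proves.{u, v} TwoSorted.V1 (TwoSorted.existsUniqueIterate φ) ∧
    TwoSorted.Proves.{u, v} TwoSorted.V1
      (TwoSorted.Fml.imp (TwoSorted.inflationary φ) (TwoSorted.existsFixedPoint φ)) := by
  refine ⟨⟨isSigB1_psiP hφ, psiPi φ, isPiB1_psiPi hφ, ?_⟩, ?_, ?_⟩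
  · intro M hM a A
    have : V1Model M := ⟨hM⟩
    rw [realize_iff, realize_psiP, realize_psiPi]
    constructor
    · rintro ⟨W, _, V, _, Z, _, h⟩ Y' _ ⟨W', _, V', _, Z', _, h'⟩
      exact h'.unique h
    · intro h
      -- Totality makes the universal form informative: some string does satisfy `ψ`, and the
      -- hypothesis identifies it with the given one.
      obtain ⟨Y, hY, hψ⟩ := exists_psi (M := M) hφ _ _ _
      obtain rfl := h Y hY hψ
      exact hψ
  · intro M hM a A
    have : V1Model M := ⟨hM⟩
    obtain ⟨Y, hY, hψ⟩ := exists_psi (M := M) hφ _ _ _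
    refine realize_existsUniqueIterate φ a A ⟨Y, hY, hψ, ?_⟩
    obtain ⟨W, _, V, _, Z, _, h⟩ := hψ
    rintro Y' _ ⟨W', _, V', _, Z', _, h'⟩
    exact h'.unique h
  · intro M hM a A
    have : V1Model M := ⟨hM⟩
    rw [realize_imp, realize_inflationary]
    intro hinf
    obtain ⟨n, -, W, hW, hn⟩ := exists_binLenW (a ⟨p, by omega⟩)
    obtain ⟨U, hU, h⟩ := exists_fixedPoint hφ hinf hn
    obtain ⟨U', hS⟩ := exists_isSucc U
    obtain ⟨T, -, hT⟩ := comp' (M := M) (fun _ => True) n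
    replace hT : ∀ i, i ∈ T ↔ i < n := fun i => by simpa using hT i
    have hUT : ∀ i ∈ U, i ∈ T := fun i hi => (hT i).2 ((ax_l1 hi).trans_le hU)
    refine realize_existsFixedPoint φ a A ⟨n, T, U, U', ⟨W, hW, hn⟩, hT, ?_, hS, h U' hS⟩
    -- Every element of `U` lies in `T`. If they differ, any bit of `T` missing from `U` witnesses
    -- `strLt`, which only asks that the higher bits of `U` belong to `T`.
    by_cases hTU : ∀ i ∈ T, i ∈ U
    · exact .inl (str_ext fun i => ⟨hUT i, hTU i⟩)
    · push Not at hTU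
      obtain ⟨i, hi, hiU⟩ := hTU
      exact .inr ⟨len_le_of fun j hj => ax_l1 (hUT j hj), i, (ax_l1 hi).le,
        fun j _ _ hj => hUT j hj, hi, hiU⟩
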